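/- Let $n\ge 0$, $R>0$, $\delta>0$, $T^n=\mathbb R^n/\mathbb Z^n$, and for $0<r\le R$ let $U_r=\{(x,\theta)\in\mathbb R^n\times T^n:\|x\|<r\}$. Put $U=U_R$, $\omega=\sum_i dx_i\wedge d\theta^i$ and $\mu(x,\theta)=x$. Let $\{J_s\}_{0<s<\delta}$ be a family of $\omega$-compatible complex structures on $U$, that is, each $J_s$ is a smooth integrable complex structure with $\omega(J_s\cdot,J_s\cdot)=\omega$ for which $g_{J_s}:=\omega(\cdot,J_s\cdot)$ is positive definite. Let $\mathcal P_{J_s}=T^{1,0}_{J_s}U$ and $\mathcal P_\mu=\ker(d\mu)\otimes\mathbb C$. Assume condition $\spadesuit$: there is a smooth section $\mathcal P$, over $U\times[0,\delta)$, of the bundle of complex Lagrangian subspaces of $TU\otimes\mathbb C$ such that $\mathcal P(\cdot,s)=\mathcal P_{J_s}$ for $0<s<\delta$, $\mathcal P(\cdot,0)=\mathcal P_\mu$, and at every point the derivative $\frac{d}{ds}\mathcal P|_{s=0}$ is given by a complex symmetric matrix with positive definite imaginary part. Here, if for small $s\ge 0$ the space $\mathcal P(p,s)$ is spanned by the vectors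 $\frac{\partial}{\partial\theta^i}+\sum_j A_{ij}(s,p)\frac{\partial}{\partial x_j}$, $i=1,\dots,n$, then the derivative at $p$ is the matrix $A^0(p)=\frac{\partial A}{\partial s}(0,p)$. Write $A^0=P^0+\sqrt{-1}\,Q^0$ with $P^0,Q^0$ real. (i) $A^0$ is smooth on $U$ and $\dfrac{\partial A^0_{ij}}{\partial\theta^k}=\dfrac{\partial A^0_{ik}}{\partial\theta^j}$ on $U$ for all $i,j,k$. (ii) For all $0<r<R$ and $0<\varepsilon<\delta$: there is $\kappa\in\mathbb R$ such that $\mathrm{Ric}_{g_{J_s}}\ge\kappa\, g_{J_s}$ on $U_r$ for all $0<s<\varepsilon$ if and only if $Q^0(x,\theta)$ is independent of $\theta\in T^n$ for $\|x\|<r$. Moreover, if there is $\kappa\in\mathbb R$ such that $\mathrm{Ric}_{g_{J_s}}\ge\kappa\, g_{J_s}$ on $U$ for all $0<s<\delta$, then $Q^0(x,\theta)$ is independent of $\theta$ on all of $U$. -/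

import Mathlib

open scoped ContDiff Topology

noncomputable section

namespace ActionAngle

/-! ### Action-angle coordinates

`B × Tⁿ`, with `B ⊆ ℝⁿ` an open ball and `Tⁿ = ℝⁿ / ℤⁿ`, is handled through its universal cover
`B × ℝⁿ`: a tensor field on `B × Tⁿ` is a tensor field on `B × ℝⁿ` that is `ℤⁿ`-periodic in the
angle coordinates. -/

/-- Indices of the coordinates: `inl i` is the action coordinate `x_i`, `inr i` is the angle
coordinate `θ^i`. -/
abbrev Coord (n : ℕ) : Type := Fin n ⊕ Fin n

/-- Points of `ℝⁿ × ℝⁿ`, and also real tangent vectors, in the coordinates `(x, θ)`. -/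
abbrev Pt (n : ℕ) : Type := Coord n → ℝ

/-- Complexified tangent vectors in the frame `∂/∂x_i`, `∂/∂θ^i`. -/
abbrev CVec (n : ℕ) : Type := Coord n → ℂ

/-- The (universal cover of the) domain `U_R = {(x, θ) : ‖x‖ < R}`, Euclidean norm. -/
def dom (n : ℕ) (R : ℝ) : Set (Pt n) :=
  {p | ∑ i, (p (Sum.inl i)) ^ 2 < R ^ 2}

/-- Translation of the angle coordinates by an integer vector. -/
def shift {n : ℕ} (k : Fin n → ℤ) (p : Pt n) : Pt n :=
  p + Sum.elim (fun _ => 0) (fun i => (k i : ℝ))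

/-- The matrix `Ω_{ab} = ω(e_a, e_b)` of the symplectic form `ω = ∑ dx_i ∧ dθ^i`. -/
def Omega (n : ℕ) (S : Type) [Ring S] : Matrix (Coord n) (Coord n) S :=
  Matrix.fromBlocks 0 1 (-1) 0

/-- The symplectic form `ω = ∑ dx_i ∧ dθ^i`; for `S = ℂ` its complex bilinear extension. -/
def omega {n : ℕ} {S : Type} [Ring S] (u v : Coord n → S) : S :=
  u ⬝ᵥ (Omega n S).mulVec v

/-- The partial derivative in the coordinate with index `a`. -/
def pderiv {ι F : Type} [Fintype ι] [DecidableEq ι] [NormedAddCommGroup F] [NormedSpace ℝ F]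
    (a : ι) (f : (ι → ℝ) → F) (p : ι → ℝ) : F :=
  fderiv ℝ f p (Pi.single a 1)

/-! ### Compatible complex structures -/

/-- The Nijenhuis tensor of the endomorphism field `J`, on vector fields `V` and `W`. -/
def nijenhuis {n : ℕ} (J : Pt n → Matrix (Coord n) (Coord n) ℝ) (V W : Pt n → Pt n) :
    Pt n → Pt n := fun p =>
  VectorField.lieBracket ℝ (fun q => (J q).mulVec (V q)) (fun q => (J q).mulVec (W q)) p
    - (J p).mulVec (VectorField.lieBracket ℝ (fun q => (J q).mulVec (V q)) W p)
    - (J p).mulVec (VectorField.lieBracket ℝ V (fun q => (J q).mulVec (W q)) p)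
    - VectorField.lieBracket ℝ V W p

/-- `J` is an `ω`-compatible complex structure on `U_R = B × Tⁿ`: a smooth endomorphism field with
`J² = -1` and vanishing Nijenhuis tensor, with `ω(J·, J·) = ω` and `ω(·, J·)` positive definite. -/
structure IsCompatibleComplexStructure {n : ℕ} (R : ℝ)
    (J : Pt n → Matrix (Coord n) (Coord n) ℝ) : Prop where
  smooth : ∀ a b, ContDiffOn ℝ ∞ (fun p => J p a b) (dom n R)
  periodic : ∀ p ∈ dom n R, ∀ k : Fin n → ℤ, J (shift k p) = J p
  sq : ∀ p ∈ dom n R, J p * J p = -1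
  integrable : ∀ V W : Pt n → Pt n, ContDiffOn ℝ ∞ V (dom n R) → ContDiffOn ℝ ∞ W (dom n R) →
    ∀ p ∈ dom n R, nijenhuis J V W p = 0
  compatible : ∀ p ∈ dom n R, ∀ u v : Pt n,
    omega ((J p).mulVec u) ((J p).mulVec v) = omega u v
  positive : ∀ p ∈ dom n R, ∀ u : Pt n, u ≠ 0 → 0 < omega u ((J p).mulVec u)

/-- The matrix `(g_J)_{ab} = ω(e_a, J e_b)` of the metric `g_J = ω(·, J·)`. -/
def metric {n : ℕ} (J : Pt n → Matrix (Coord n) (Coord n) ℝ) :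
    Pt n → Matrix (Coord n) (Coord n) ℝ :=
  fun p => Matrix.of fun a b => omega (Pi.single a 1) ((J p).mulVec (Pi.single b 1))

/-! ### Ricci curvature in coordinates -/

section Ricci

variable {ι : Type} [Fintype ι] [DecidableEq ι]

/-- The Christoffel symbol `Γ^k_{ab}` of the metric `g`. -/
def christoffel (g : (ι → ℝ) → Matrix ι ι ℝ) (k a b : ι) (p : ι → ℝ) : ℝ :=
  (1 / 2) * ∑ l, (g p)⁻¹ k l *
    (pderiv a (fun q => g q b l) p + pderiv b (fun q => g q a l) p
      - pderiv l (fun q => g q a b) p)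

/-- The Ricci tensor
`R_{ab} = ∂_k Γ^k_{ab} - ∂_b Γ^k_{ak} + Γ^k_{kl} Γ^l_{ab} - Γ^k_{bl} Γ^l_{ak}`. -/
def ricci (g : (ι → ℝ) → Matrix ι ι ℝ) (p : ι → ℝ) : Matrix ι ι ℝ :=
  Matrix.of fun a b =>
    ∑ k, pderiv k (christoffel g k a b) p - ∑ k, pderiv b (christoffel g k a k) p
      + ∑ k, ∑ l, christoffel g k k l p * christoffel g l a b p
      - ∑ k, ∑ l, christoffel g k b l p * christoffel g l a k p

/-- `Ric_g ≥ κ g` at every point of the set `D`. -/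
def RicciGE (g : (ι → ℝ) → Matrix ι ι ℝ) (κ : ℝ) (D : Set (ι → ℝ)) : Prop :=
  ∀ p ∈ D, ∀ v : ι → ℝ, κ * (v ⬝ᵥ (g p).mulVec v) ≤ v ⬝ᵥ (ricci g p).mulVec v

end Ricci

/-! ### Lagrangian subspaces and polarizations -/

/-- `W` is a Lagrangian subspace of the complexified tangent space. -/
def IsLagrangian {n : ℕ} (W : Submodule ℂ (CVec n)) : Prop :=
  Module.finrank ℂ W = n ∧ ∀ u ∈ W, ∀ v ∈ W, omega u v = 0

/-- The Kähler polarization `T^{1,0}_J` at `p`, the `i`-eigenspace of `J`. -/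
def kahlerPol {n : ℕ} (J : Pt n → Matrix (Coord n) (Coord n) ℝ) (p : Pt n) :
    Submodule ℂ (CVec n) :=
  Module.End.eigenspace (Matrix.toLin' ((J p).map Complex.ofReal)) Complex.I

/-- The real polarization `Ker(dμ) ⊗ ℂ` of `μ(x, θ) = x`. -/
def realPol (n : ℕ) : Submodule ℂ (CVec n) where
  carrier := {w | ∀ i, w (Sum.inl i) = 0}
  add_mem' := by
    intro a b ha hb i
    simp [ha i, hb i]
  zero_mem' := fun _ => rfl
  smul_mem' := by
    intro c a ha i
    simp [ha i]

/-- The span of the vectors `∂/∂θ^i + ∑_j A_{ij} ∂/∂x_j`, that is, the graph over `Ker(dμ) ⊗ ℂ` of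
the linear map with values in the span of the `∂/∂x_j` whose matrix is `A`. -/
def graphPol {n : ℕ} (A : Matrix (Fin n) (Fin n) ℂ) : Submodule ℂ (CVec n) :=
  Submodule.span ℂ (Set.range fun i : Fin n =>
    (Sum.elim (fun j => A i j) (Pi.single i 1) : CVec n))

/-- `P` is a smooth section over `D ⊆ ℝ × ℝ²ⁿ` of the bundle of Lagrangian subspaces: it has local
smooth frames. -/
def IsSmoothLagSection {n : ℕ} (D : Set (ℝ × Pt n))
    (P : ℝ → Pt n → Submodule ℂ (CVec n)) : Prop :=
  ∀ z ∈ D, IsLagrangian (P z.1 z.2) ∧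
    ∃ N ∈ 𝓝 z, ∃ w : Fin n → ℝ × Pt n → CVec n,
      (∀ i, ContDiffOn ℝ ∞ (w i) (N ∩ D)) ∧
      ∀ y ∈ N ∩ D, LinearIndependent ℂ (fun i => w i y) ∧
        Submodule.span ℂ (Set.range fun i => w i y) = P y.1 y.2

/-- `A₀` is the derivative at `s = 0` of the curve `W` of subspaces, `s ≥ 0`, under the usual
identification of the tangent space of the Grassmannian at `Ker(dμ) ⊗ ℂ`: for small `s`, `W s` is
the graph of `A s`, and `A` has the one-sided derivative `A₀` at `0`. -/
def HasPolDeriv {n : ℕ} (W : ℝ → Submodule ℂ (CVec n)) (A₀ : Matrix (Fin n) (Fin n) ℂ) : Prop :=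
  ∃ A : ℝ → Matrix (Fin n) (Fin n) ℂ,
    (∀ᶠ s in 𝓝[≥] (0 : ℝ), W s = graphPol (A s)) ∧
    ∀ i j, HasDerivWithinAt (fun s => A s i j) (A₀ i j) (Set.Ici 0) 0

/-- The imaginary part of a complex matrix. -/
def imPart {n : ℕ} (A : Matrix (Fin n) (Fin n) ℂ) : Matrix (Fin n) (Fin n) ℝ :=
  A.map Complex.im

/-- The condition `♠` on the family `J_s`, `0 < s < δ`, over `U_R`, with first-order term `A₀`: the
polarizations of the `J_s` extend to a smooth section over `U_R × [0, δ)` of the bundle of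
Lagrangian subspaces, which at `s = 0` is the real polarization of `μ = x`, and its `s`-derivative
at `s = 0` is given by symmetric matrices `A₀ p` with positive definite imaginary part. -/
def Spade {n : ℕ} (R δ : ℝ) (J : ℝ → Pt n → Matrix (Coord n) (Coord n) ℝ)
    (A₀ : Pt n → Matrix (Fin n) (Fin n) ℂ) : Prop :=
  ∃ P : ℝ → Pt n → Submodule ℂ (CVec n),
    IsSmoothLagSection (Set.Ico 0 δ ×ˢ dom n R) P ∧
    (∀ s ∈ Set.Ioo 0 δ, ∀ p ∈ dom n R, P s p = kahlerPol (J s) p) ∧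
    (∀ p ∈ dom n R, P 0 p = realPol n) ∧
    ∀ p ∈ dom n R, HasPolDeriv (fun s => P s p) (A₀ p) ∧
      (A₀ p).IsSymm ∧ (imPart (A₀ p)).PosDef

/-- A function of `(x, θ)` does not depend on `θ` on `U_r`. -/
def IndepOfTheta {n : ℕ} {β : Type} (r : ℝ) (f : Pt n → β) : Prop :=
  ∀ p ∈ dom n r, ∀ q ∈ dom n r, (∀ i, p (Sum.inl i) = q (Sum.inl i)) → f p = f q

end ActionAngle

end

open ActionAngle

/-! ### Integrals with parameters and division by t and t² -/

noncomputable section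

namespace ActionAngle

/-! Write the polarization of J_s as the graph of s(P + iQ), with P and Q smooth up to s = 0 and P +
iQ = A₀ there, and put h = Q⁻¹. In the frame (s ∂/∂x, ∂/∂θ) the metric g_{J_s} is s·G, where G =
h(dx − P dθ)² + Q dθ². The Ricci tensor ignores the constant factor s, so Ric ≥ κ g becomes Ric_s ≥
κ s G, where Ric_s, the Ricci matrix in this frame, is smooth up to s = 0. At s = 0 the derivatives
in x drop out, and Ric_0 is the Ricci tensor of a metric depending on the angles alone.

The vanishing of the Nijenhuis tensor, divided by s, says at s = 0 that ∂A₀_{jk}/∂θ^i is symmetric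
in i and j (`IsCollapsingFamily.integrability`). With the symmetry of A₀ this is (i), and it makes
the angle derivatives of P and Q totally symmetric.

A Ricci bound forces Ric_0 ≥ 0 as s → 0. Total symmetry gives Q_{ab} Ric_0(∂x_a, ∂x_b) = −S/2 with S
= ∂_k ∂_m h_{mk} (`sum_mul_ricAlg`), so S ≤ 0. It also exhibits S·Q_{cc} − tr(h ∂_cQ h ∂_cQ) as a
divergence on the torus (`sum_deriv_fluxField`). Both terms are nonpositive and the integral is
zero, so both vanish and ∂_cQ = 0.

Conversely, if Q is constant along the fibres, then G at s = 0 is flat after the local shear x ↦ x −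
φ(θ) with dφ = P dθ, and Ric_0 = 0 (`ricAlg_eq_zero`). Then Ric_s = O(s), and compactness of the
closed ball, the torus and [0, ε] gives Ric_s ≥ κ s G.

The parameter t with s = t² replaces smoothness up to a boundary by smoothness on an open set;
functions of s become even in t, and Hadamard division by t² is available. -/

theorem exists_ball_bound {E G : Type} [NormedAddCommGroup E] [ProperSpace E]
    [NormedAddCommGroup G] {F : ℝ × E → G} {W : Set (ℝ × E)} (hF : ContinuousOn F W)
    {V : Set E} (hV : IsOpen V) (hVW : ∀ τ ∈ Set.Icc (0 : ℝ) 1, ∀ z ∈ V, (τ, z) ∈ W)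
    {z₀ : E} (hz₀ : z₀ ∈ V) :
    ∃ ε > 0, Metric.ball z₀ ε ⊆ V ∧
      ∃ C, ∀ τ ∈ Set.Icc (0 : ℝ) 1, ∀ z ∈ Metric.ball z₀ ε, ‖F (τ, z)‖ ≤ C := by
  obtain ⟨ε, hε, hb⟩ := Metric.nhds_basis_closedBall.mem_iff.1 (hV.mem_nhds hz₀)
  have hK : IsCompact (Set.Icc (0 : ℝ) 1 ×ˢ Metric.closedBall z₀ ε) :=
    isCompact_Icc.prod (isCompact_closedBall z₀ ε)
  obtain ⟨C, hC⟩ := hK.exists_bound_of_continuousOn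
    (hF.mono (fun x hx => hVW x.1 hx.1 x.2 (hb hx.2)))
  exact ⟨ε, hε, Metric.ball_subset_closedBall.trans hb, C, fun τ hτ z hz =>
    hC (τ, z) ⟨hτ, Metric.ball_subset_closedBall hz⟩⟩

theorem continuousOn_section {E G : Type} [NormedAddCommGroup E]
    [NormedAddCommGroup G] {F : ℝ × E → G} {W : Set (ℝ × E)} (hF : ContinuousOn F W)
    {z : E} (hz : ∀ τ ∈ Set.Icc (0 : ℝ) 1, (τ, z) ∈ W) :
    ContinuousOn (fun τ => F (τ, z)) (Set.Icc (0 : ℝ) 1) :=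
  hF.comp (Continuous.continuousOn (by fun_prop)) hz

/-- Smooth dependence of an integral over `[0, 1]` on parameters. -/
theorem contDiffOn_integral_nat {E : Type} [NormedAddCommGroup E] [NormedSpace ℝ E]
    [ProperSpace E] {W : Set (ℝ × E)} (hW : IsOpen W) {V : Set E} (hV : IsOpen V)
    (hVW : ∀ τ ∈ Set.Icc (0 : ℝ) 1, ∀ z ∈ V, (τ, z) ∈ W) (n : ℕ) :
    ∀ (G : Type) [NormedAddCommGroup G] [NormedSpace ℝ G] (F : ℝ × E → G),
      ContDiffOn ℝ n F W → ContDiffOn ℝ n (fun z => ∫ τ in (0 : ℝ)..1, F (τ, z)) V := by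
  have huI : Set.uIoc (0 : ℝ) 1 = Set.Ioc 0 1 := Set.uIoc_of_le zero_le_one
  have hmeas : ∀ (G : Type) [NormedAddCommGroup G] [NormedSpace ℝ G] (F : ℝ × E → G),
      ContinuousOn F W → ∀ z ∈ V, MeasureTheory.AEStronglyMeasurable (fun τ => F (τ, z))
        (MeasureTheory.volume.restrict (Set.uIoc (0 : ℝ) 1)) := by
    intro G _ _ F hF z hz
    rw [huI]
    exact ((continuousOn_section hF (fun τ hτ => hVW τ hτ z hz)).mono
      Set.Ioc_subset_Icc_self).aestronglyMeasurable measurableSet_Ioc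
  -- The target space stays universally quantified in the induction, because the derivative in the
  -- parameter takes values in `E →L[ℝ] G`.
  induction n with
  | zero =>
    intro G _ _ F hF
    simp only [Nat.cast_zero, contDiffOn_zero] at hF ⊢
    intro z₀ hz₀
    obtain ⟨ε, hε, hbV, C, hC⟩ := exists_ball_bound hF hV hVW hz₀
    apply ContinuousAt.continuousWithinAt
    refine intervalIntegral.continuousAt_of_dominated_interval (bound := fun _ => C) ?_ ?_
      intervalIntegrable_const ?_
    · filter_upwards [Metric.ball_mem_nhds z₀ hε] with z hz using hmeas G F hF z (hbV hz)
    · filter_upwards [Metric.ball_mem_nhds z₀ hε] with z hz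
      refine Filter.Eventually.of_forall fun τ hτ => ?_
      rw [huI] at hτ
      exact hC τ (Set.Ioc_subset_Icc_self hτ) z hz
    · refine Filter.Eventually.of_forall fun τ hτ => ?_
      rw [huI] at hτ
      have := hF.continuousAt (hW.mem_nhds (hVW τ (Set.Ioc_subset_Icc_self hτ) z₀ hz₀))
      exact ContinuousAt.comp (f := fun z => (τ, z)) this (by fun_prop)
  | succ n ih =>
    intro G _ _ F hF
    have hF' := (contDiffOn_succ_iff_fderiv_of_isOpen (n := (n : ℕ∞ω)) hW).1 (by exact_mod_cast hF)
    set F' : ℝ × E → E →L[ℝ] G := fun y => (fderiv ℝ F y).comp (ContinuousLinearMap.inr ℝ ℝ E)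
      with hF'def
    have hF'c : ContDiffOn ℝ n F' W := hF'.2.2.clm_comp contDiffOn_const
    have hder : ∀ z ∈ V, HasFDerivAt (fun z => ∫ τ in (0 : ℝ)..1, F (τ, z))
        (∫ τ in (0 : ℝ)..1, F' (τ, z)) z := by
      intro z₀ hz₀
      obtain ⟨ε, hε, hbV, C, hC⟩ := exists_ball_bound hF'c.continuousOn hV hVW hz₀
      refine intervalIntegral.hasFDerivAt_integral_of_dominated_of_fderiv_le
        (F := fun z τ => F (τ, z)) (F' := fun z τ => F' (τ, z))
        (s := Metric.ball z₀ ε) (bound := fun _ => C)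
        (Metric.ball_mem_nhds z₀ hε) ?_ ?_ ?_ ?_ intervalIntegrable_const ?_
      · filter_upwards [Metric.ball_mem_nhds z₀ hε] with z hz
          using hmeas G F hF.continuousOn z (hbV hz)
      · apply ContinuousOn.intervalIntegrable
        rw [Set.uIcc_of_le zero_le_one]
        exact continuousOn_section hF.continuousOn (fun τ hτ => hVW τ hτ z₀ hz₀)
      · exact hmeas _ F' hF'c.continuousOn z₀ hz₀
      · refine Filter.Eventually.of_forall fun τ hτ => ?_
        rw [huI] at hτ
        exact hC τ (Set.Ioc_subset_Icc_self hτ)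
      · refine Filter.Eventually.of_forall fun τ hτ z hz => ?_
        rw [huI] at hτ
        have h1 := (hF'.1.differentiableAt
          (hW.mem_nhds (hVW τ (Set.Ioc_subset_Icc_self hτ) z (hbV hz)))).hasFDerivAt
        have h2 : HasFDerivAt (fun z : E => (τ, z)) (ContinuousLinearMap.inr ℝ ℝ E) z := by
          simpa using hasFDerivAt_prodMk_right τ z
        exact h1.comp z h2
    have hcast : ((n + 1 : ℕ) : ℕ∞ω) = (n : ℕ∞ω) + 1 := by push_cast; rfl
    rw [hcast, contDiffOn_succ_iff_fderiv_of_isOpen hV]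
    refine ⟨fun z hz => (hder z hz).differentiableAt.differentiableWithinAt, by simp, ?_⟩
    exact (ih _ F' hF'c).congr fun z hz => (hder z hz).fderiv

theorem contDiffOn_integral {E : Type} [NormedAddCommGroup E] [NormedSpace ℝ E]
    [ProperSpace E] {W : Set (ℝ × E)} (hW : IsOpen W) {V : Set E} (hV : IsOpen V)
    (hVW : ∀ τ ∈ Set.Icc (0 : ℝ) 1, ∀ z ∈ V, (τ, z) ∈ W) {F : ℝ × E → ℝ}
    (hF : ContDiffOn ℝ ∞ F W) : ContDiffOn ℝ ∞ (fun z => ∫ τ in (0 : ℝ)..1, F (τ, z)) V :=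
  contDiffOn_infty.2 fun n => contDiffOn_integral_nat hW hV hVW n ℝ F (contDiffOn_infty.1 hF n)

/-- Hadamard's lemma in one of the variables. -/
theorem exists_eq_mul_of_eq_zero {E : Type} [NormedAddCommGroup E] [NormedSpace ℝ E]
    [ProperSpace E] {a : ℝ} {U : Set E} (hU : IsOpen U) {f : ℝ × E → ℝ}
    (hf : ContDiffOn ℝ ∞ f (Set.Ioo (-a) a ×ˢ U)) (h0 : ∀ p ∈ U, f (0, p) = 0) :
    ∃ g : ℝ × E → ℝ, ContDiffOn ℝ ∞ g (Set.Ioo (-a) a ×ˢ U) ∧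
      ∀ z ∈ Set.Ioo (-a) a ×ˢ U, f z = z.1 * g z := by
  have hD : IsOpen (Set.Ioo (-a) a ×ˢ U) := isOpen_Ioo.prod hU
  -- The quotient is ∫₀¹ (∂f/∂t)(τt, p) dτ. The preimage under `m` of the domain is an open set
  -- containing [0, 1] times the domain.
  set m : ℝ × ℝ × E → ℝ × E := fun y => (y.1 * y.2.1, y.2.2) with hm
  have hmc : ContDiff ℝ ∞ m := by fun_prop
  set f' : ℝ × E → ℝ := fun z => fderiv ℝ f z (1, 0)
  have hf' : ContDiffOn ℝ ∞ f' (Set.Ioo (-a) a ×ˢ U) :=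
    (hf.fderiv_of_isOpen hD (m := ∞) (by simp)).clm_apply contDiffOn_const
  have hmem : ∀ τ ∈ Set.Icc (0 : ℝ) 1, ∀ z ∈ Set.Ioo (-a) a ×ˢ U,
      (τ, z) ∈ m ⁻¹' (Set.Ioo (-a) a ×ˢ U) := by
    rintro τ ⟨h1, h2⟩ ⟨t, p⟩ ⟨⟨h3, h4⟩, hp⟩
    simp only at h3 h4
    refine ⟨⟨?_, ?_⟩, hp⟩ <;> simp only [hm] <;> nlinarith
  refine ⟨fun z => ∫ τ in (0 : ℝ)..1, f' (m (τ, z)),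
    contDiffOn_integral (hD.preimage hmc.continuous) hD hmem
      (F := fun y => f' (m y)) (hf'.comp hmc.contDiffOn fun y hy => hy), ?_⟩
  rintro ⟨t, p⟩ hz
  have hder : ∀ τ ∈ Set.uIcc (0 : ℝ) 1,
      HasDerivAt (fun τ => f (τ * t, p)) (t * f' (m (τ, (t, p)))) τ := by
    intro τ hτ
    rw [Set.uIcc_of_le zero_le_one] at hτ
    have h1 := ((hf.differentiableOn (by simp)).differentiableAt
      (hD.mem_nhds (hmem τ hτ _ hz))).hasFDerivAt
    have h2 : HasDerivAt (fun τ : ℝ => (τ * t, p)) ((t, 0) : ℝ × E) τ := by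
      simpa using ((hasDerivAt_id τ).mul_const t).prodMk (hasDerivAt_const τ p)
    have h3 := h1.comp_hasDerivAt τ h2
    have : ((t, 0) : ℝ × E) = t • ((1, 0) : ℝ × E) := by simp
    rw [this, map_smul] at h3
    exact h3
  have hcont : ContinuousOn (fun τ => t * f' (m (τ, (t, p)))) (Set.uIcc (0 : ℝ) 1) := by
    rw [Set.uIcc_of_le zero_le_one]
    refine continuousOn_const.mul (hf'.continuousOn.comp (Continuous.continuousOn ?_)
      fun τ hτ => hmem τ hτ _ hz)
    exact hmc.continuous.comp (by fun_prop)
  have := intervalIntegral.integral_eq_sub_of_hasDerivAt hder hcont.intervalIntegrable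
  rw [intervalIntegral.integral_const_mul] at this
  simp only [one_mul, zero_mul, h0 p hz.2, sub_zero] at this
  exact this.symm

/-- A smooth function that is even in `t` and vanishes at `t = 0` is divisible by `t²`. -/
theorem exists_eq_sq_mul_of_even {E : Type} [NormedAddCommGroup E] [NormedSpace ℝ E]
    [ProperSpace E] {a : ℝ} (ha : 0 < a) {U : Set E} (hU : IsOpen U) {f : ℝ × E → ℝ}
    (hf : ContDiffOn ℝ ∞ f (Set.Ioo (-a) a ×ˢ U)) (h0 : ∀ p ∈ U, f (0, p) = 0)
    (heven : ∀ t ∈ Set.Ioo (-a) a, ∀ p ∈ U, f (-t, p) = f (t, p)) :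
    ∃ g : ℝ × E → ℝ, ContDiffOn ℝ ∞ g (Set.Ioo (-a) a ×ˢ U) ∧
      ∀ z ∈ Set.Ioo (-a) a ×ˢ U, f z = z.1 ^ 2 * g z := by
  obtain ⟨g, hg, hfg⟩ := exists_eq_mul_of_eq_zero hU hf h0
  -- Evenness of f makes g odd away from t = 0; the equation f = t g says nothing about g at 0, so
  -- its value there comes from continuity.
  have hg0 : ∀ p ∈ U, g (0, p) = 0 := by
    intro p hp
    have hmaps : Set.MapsTo (fun t : ℝ => (t, p)) (Set.Ioo (-a) a) (Set.Ioo (-a) a ×ˢ U) :=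
      fun t ht => ⟨ht, hp⟩
    have h1 : ContinuousAt (fun t => g (t, p)) 0 :=
      (hg.continuousOn.comp (Continuous.continuousOn (by fun_prop)) hmaps).continuousAt
        (Ioo_mem_nhds (by simpa using ha) ha)
    have h2 : Filter.Tendsto (fun t => g (-t, p)) (𝓝 0) (𝓝 (g (0, p))) := by
      have : Filter.Tendsto (fun t : ℝ => -t) (𝓝 0) (𝓝 0) := by
        simpa using (continuous_neg (G := ℝ)).tendsto 0
      exact h1.tendsto.comp this
    have h3 : Filter.Tendsto (fun t => g (t, p) + g (-t, p)) (𝓝[≠] 0)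
        (𝓝 (g (0, p) + g (0, p))) := (h1.tendsto.add h2).mono_left nhdsWithin_le_nhds
    have h4 : (fun t => g (t, p) + g (-t, p)) =ᶠ[𝓝[≠] 0] fun _ => 0 := by
      filter_upwards [self_mem_nhdsWithin, nhdsWithin_le_nhds
        (Ioo_mem_nhds (show -a < (0 : ℝ) by simpa using ha) ha)] with t ht hta
      have e1 := hfg (t, p) ⟨hta, hp⟩
      have e2 := hfg (-t, p) ⟨⟨by linarith [hta.2], by linarith [hta.1]⟩, hp⟩
      have e3 := heven t hta p hp
      simp only at e1 e2
      have : t * (g (t, p) + g (-t, p)) = 0 := by linarith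
      exact (mul_eq_zero.1 this).resolve_left ht
    have h5 := tendsto_nhds_unique h3 (tendsto_const_nhds.congr' h4.symm)
    linarith
  obtain ⟨k, hk, hgk⟩ := exists_eq_mul_of_eq_zero hU hg hg0
  refine ⟨k, hk, fun z hz => ?_⟩
  rw [hfg z hz, hgk z hz]
  ring

end ActionAngle

end

/-! ### Rings of smooth functions with their derivations -/

noncomputable section

namespace ActionAngle

open TopologicalSpace (Opens)

section SmoothFun

variable {E E' : Type} [NormedAddCommGroup E] [NormedSpace ℝ E]
  [NormedAddCommGroup E'] [NormedSpace ℝ E']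

/-- Extension by zero of a function on `U`. -/
def extendZero {E : Type} {U : Set E} (f : U → ℝ) : E → ℝ := Function.extend Subtype.val f 0

theorem extendZero_apply {E : Type} {U : Set E} (f : U → ℝ) {p : E} (hp : p ∈ U) :
    extendZero f p = f ⟨p, hp⟩ :=
  Subtype.val_injective.extend_apply f 0 ⟨p, hp⟩

/-- The subalgebra of smooth functions on the open set `U`. -/
def smoothSubalgebra (U : Opens E) : Subalgebra ℝ (U → ℝ) where
  carrier := {f | ContDiffOn ℝ ∞ (extendZero (U := (U : Set E)) f) (U : Set E)}
  mul_mem' {f g} hf hg := by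
    refine (ContDiffOn.mul hf hg).congr fun p hp => ?_
    simp only [extendZero_apply _ hp]; rfl
  add_mem' {f g} hf hg := by
    refine (ContDiffOn.add hf hg).congr fun p hp => ?_
    simp only [extendZero_apply _ hp]; rfl
  algebraMap_mem' c := by
    refine ContDiffOn.congr (f := fun _ => c) contDiffOn_const fun p hp => ?_
    simp only [extendZero_apply _ hp]; rfl

/-- The algebra of smooth functions on the open set `U`. -/
def SmoothFun (U : Opens E) : Type := smoothSubalgebra U

instance (U : Opens E) : CommRing (SmoothFun U) :=
  inferInstanceAs (CommRing (smoothSubalgebra U))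

instance (U : Opens E) : Algebra ℝ (SmoothFun U) :=
  inferInstanceAs (Algebra ℝ (smoothSubalgebra U))

namespace SmoothFun

variable {U : Opens E} {U' : Opens E'}

/-- The function on the whole space underlying a smooth function on `U`. -/
def ext (f : SmoothFun U) : E → ℝ := extendZero (U := (U : Set E)) f.1

theorem contDiffOn_ext (f : SmoothFun U) : ContDiffOn ℝ ∞ f.ext U := f.2

theorem ext_injective {f g : SmoothFun U} (h : ∀ p ∈ U, f.ext p = g.ext p) : f = g := by
  apply Subtype.ext
  funext ⟨p, hp⟩
  have := h p hp
  simpa only [ext, extendZero_apply _ (show p ∈ (U : Set E) from hp)] using this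

/-- The restriction to `U` of a function that is smooth on `U`. -/
def ofFun (F : E → ℝ) (hF : ContDiffOn ℝ ∞ F U) : SmoothFun U :=
  ⟨fun p => F p.1, hF.congr fun p hp => by rw [extendZero_apply _ hp]⟩

theorem ofFun_ext (F : E → ℝ) (hF : ContDiffOn ℝ ∞ F U) {p : E} (hp : p ∈ U) :
    (ofFun F hF).ext p = F p :=
  extendZero_apply _ hp

/-- Evaluation at a point of `U`. -/
def eval (p : E) (hp : p ∈ U) : SmoothFun U →ₐ[ℝ] ℝ :=
  (Pi.evalAlgHom ℝ (fun _ : U => ℝ) ⟨p, hp⟩).comp (smoothSubalgebra U).val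

theorem eval_eq (p : E) (hp : p ∈ U) (f : SmoothFun U) : eval p hp f = f.ext p :=
  (extendZero_apply (U := (U : Set E)) f.1 hp).symm

theorem contDiffAt_ext (f : SmoothFun U) {p : E} (hp : p ∈ U) : ContDiffAt ℝ ∞ f.ext p :=
  f.contDiffOn_ext.contDiffAt (U.isOpen.mem_nhds hp)

theorem differentiableAt_ext (f : SmoothFun U) {p : E} (hp : p ∈ U) :
    DifferentiableAt ℝ f.ext p :=
  (f.contDiffAt_ext hp).differentiableAt (by simp)

theorem ext_mul (f g : SmoothFun U) {p : E} (hp : p ∈ U) : (f * g).ext p = f.ext p * g.ext p := by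
  simp only [← eval_eq p hp, map_mul]

theorem ext_add (f g : SmoothFun U) {p : E} (hp : p ∈ U) : (f + g).ext p = f.ext p + g.ext p := by
  simp only [← eval_eq p hp, map_add]

theorem contDiffOn_fderiv_apply (f : SmoothFun U) (v : E) :
    ContDiffOn ℝ ∞ (fun p => fderiv ℝ f.ext p v) U :=
  (f.contDiffOn_ext.fderiv_of_isOpen U.isOpen (m := ∞) (by simp)).clm_apply contDiffOn_const

/-- The derivative of a smooth function in the direction `v`. -/
def deriv (v : E) : Derivation ℝ (SmoothFun U) (SmoothFun U) where
  toFun f := ofFun _ (f.contDiffOn_fderiv_apply v)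
  map_add' f g := by
    refine ext_injective fun p hp => ?_
    rw [ext_add _ _ hp, ofFun_ext _ _ hp, ofFun_ext _ _ hp, ofFun_ext _ _ hp]
    have : (f + g).ext =ᶠ[𝓝 p] f.ext + g.ext := by
      filter_upwards [U.isOpen.mem_nhds hp] with q hq using ext_add f g hq
    rw [this.fderiv_eq, fderiv_add (f.differentiableAt_ext hp) (g.differentiableAt_ext hp)]
    rfl
  map_smul' c f := by
    refine ext_injective fun p hp => ?_
    rw [ofFun_ext _ _ hp]
    have h : ∀ q ∈ U, (c • f).ext q = c * f.ext q := fun q hq => by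
      simp only [← eval_eq q hq, map_smul, smul_eq_mul]
    have h' : ∀ q ∈ U, ∀ g : SmoothFun U, (c • g).ext q = c * g.ext q := fun q hq g => by
      simp only [← eval_eq q hq, map_smul, smul_eq_mul]
    have : (c • f).ext =ᶠ[𝓝 p] fun q => c * f.ext q := by
      filter_upwards [U.isOpen.mem_nhds hp] with q hq using h q hq
    rw [this.fderiv_eq, RingHom.id_apply, h' p hp, ofFun_ext _ _ hp,
      fderiv_const_mul (f.differentiableAt_ext hp)]
    rfl
  map_one_eq_zero' := by
    refine ext_injective fun p hp => ?_
    have : (1 : SmoothFun U).ext =ᶠ[𝓝 p] fun _ => 1 := by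
      filter_upwards [U.isOpen.mem_nhds hp] with q hq
      rw [← eval_eq q hq, map_one]
    change (ofFun _ ((1 : SmoothFun U).contDiffOn_fderiv_apply v)).ext p = _
    rw [ofFun_ext _ _ hp, this.fderiv_eq, ← eval_eq p hp, map_zero]
    simp
  leibniz' f g := by
    refine ext_injective fun p hp => ?_
    change (ofFun _ ((f * g).contDiffOn_fderiv_apply v)).ext p =
      (f * ofFun _ (g.contDiffOn_fderiv_apply v) + g * ofFun _ (f.contDiffOn_fderiv_apply v)).ext p
    rw [ext_add _ _ hp, ext_mul _ _ hp, ext_mul _ _ hp, ofFun_ext _ _ hp, ofFun_ext _ _ hp,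
      ofFun_ext _ _ hp]
    have : (f * g).ext =ᶠ[𝓝 p] f.ext * g.ext := by
      filter_upwards [U.isOpen.mem_nhds hp] with q hq using ext_mul f g hq
    rw [this.fderiv_eq, fderiv_mul (f.differentiableAt_ext hp) (g.differentiableAt_ext hp)]
    simp

theorem deriv_ext (v : E) (f : SmoothFun U) {p : E} (hp : p ∈ U) :
    (deriv v f).ext p = fderiv ℝ f.ext p v :=
  ofFun_ext _ (f.contDiffOn_fderiv_apply v) hp

theorem fderiv_eq_of_eqOn {F : E → ℝ} {f : SmoothFun U} (h : ∀ p ∈ U, F p = f.ext p) {p : E}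
    (hp : p ∈ U) (v : E) : fderiv ℝ F p v = (deriv v f).ext p := by
  have : F =ᶠ[𝓝 p] f.ext := by
    filter_upwards [U.isOpen.mem_nhds hp] with q hq using h q hq
  rw [deriv_ext v f hp, this.fderiv_eq]

theorem two_le_infty : (2 : ℕ∞ω) ≤ ∞ :=
  WithTop.coe_le_coe.2 (le_top : (2 : ℕ∞) ≤ ⊤)

theorem deriv_comm (v w : E) (f : SmoothFun U) : deriv v (deriv w f) = deriv w (deriv v f) := by
  refine ext_injective fun p hp => ?_
  have hsymm : IsSymmSndFDerivAt ℝ f.ext p := (f.contDiffAt_ext hp).isSymmSndFDerivAt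
    (by rw [minSmoothness_of_isRCLikeNormedField]; exact two_le_infty)
  have hd : DifferentiableAt ℝ (fderiv ℝ f.ext) p :=
    ((f.contDiffAt_ext hp).fderiv_right (m := 1)
      (by rw [one_add_one_eq_two]; exact two_le_infty)).differentiableAt (by simp)
  have key : ∀ v w : E, (deriv v (deriv w f)).ext p = fderiv ℝ (fderiv ℝ f.ext) p v w := by
    intro v w
    rw [← fderiv_eq_of_eqOn (F := fun q => fderiv ℝ f.ext q w)
      (fun q hq => (deriv_ext w f hq).symm) hp v]
    rw [fderiv_clm_apply hd (differentiableAt_const w)]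
    simp
  rw [key, key, hsymm.eq]

theorem isUnit_of_ne_zero {f : SmoothFun U} (h : ∀ p ∈ U, f.ext p ≠ 0) : IsUnit f := by
  refine IsUnit.of_mul_eq_one (ofFun (fun p => (f.ext p)⁻¹) (f.contDiffOn_ext.inv h)) ?_
  refine ext_injective fun p hp => ?_
  rw [ext_mul _ _ hp, ofFun_ext _ _ hp, mul_inv_cancel₀ (h p hp), ← eval_eq p hp, map_one]

/-- Pull-back of smooth functions along a smooth map. -/
def pullback (φ : E' → E) (hφ : ContDiff ℝ ∞ φ) (hU : ∀ p ∈ U', φ p ∈ U) :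
    SmoothFun U →ₐ[ℝ] SmoothFun U' where
  toFun f := ofFun (fun p => f.ext (φ p)) (f.contDiffOn_ext.comp hφ.contDiffOn hU)
  map_one' := ext_injective fun p hp => by
    rw [ofFun_ext _ _ hp, ← eval_eq _ (hU p hp), ← eval_eq _ hp, map_one, map_one]
  map_mul' f g := ext_injective fun p hp => by
    rw [ext_mul _ _ hp, ofFun_ext _ _ hp, ofFun_ext _ _ hp, ofFun_ext _ _ hp, ext_mul _ _ (hU p hp)]
  map_zero' := ext_injective fun p hp => by
    rw [ofFun_ext _ _ hp, ← eval_eq _ (hU p hp), ← eval_eq _ hp, map_zero, map_zero]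
  map_add' f g := ext_injective fun p hp => by
    rw [ext_add _ _ hp, ofFun_ext _ _ hp, ofFun_ext _ _ hp, ofFun_ext _ _ hp, ext_add _ _ (hU p hp)]
  commutes' c := ext_injective fun p hp => by
    rw [ofFun_ext _ _ hp, ← eval_eq _ (hU p hp), ← eval_eq _ hp, AlgHom.commutes, AlgHom.commutes]

theorem pullback_ext (φ : E' → E) (hφ : ContDiff ℝ ∞ φ) (hU : ∀ p ∈ U', φ p ∈ U)
    (f : SmoothFun U) {p : E'} (hp : p ∈ U') : (pullback φ hφ hU f).ext p = f.ext (φ p) :=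
  ofFun_ext _ (f.contDiffOn_ext.comp hφ.contDiffOn hU) hp

theorem deriv_pullback (φ : E' → E) (hφ : ContDiff ℝ ∞ φ) (hU : ∀ p ∈ U', φ p ∈ U)
    {v : E'} {w : E} (hvw : ∀ p ∈ U', fderiv ℝ φ p v = w) (f : SmoothFun U) :
    deriv v (pullback φ hφ hU f) = pullback φ hφ hU (deriv w f) := by
  refine ext_injective fun p hp => ?_
  rw [← fderiv_eq_of_eqOn (F := fun q => f.ext (φ q))
      (fun q hq => (pullback_ext φ hφ hU f hq).symm) hp v, pullback_ext _ _ _ _ hp,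
    deriv_ext _ _ (hU p hp)]
  have h1 := (f.differentiableAt_ext (hU p hp)).hasFDerivAt
  have h2 := (hφ.differentiable (by simp) p).hasFDerivAt
  have h3 := (h1.comp p h2).fderiv
  change fderiv ℝ (f.ext ∘ φ) p v = _
  rw [h3, ContinuousLinearMap.comp_apply, hvw p hp]

end SmoothFun

end SmoothFun

end ActionAngle

end

/-! ### Christoffel symbols and Ricci tensor over a ring with derivations -/

noncomputable section

namespace ActionAngle

section Algebraic

open Matrix

variable {A : Type} [CommRing A] [Algebra ℝ A]

theorem map_deriv_mul {l m k : Type} [Fintype m] (d : Derivation ℝ A A) (M : Matrix l m A)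
    (N : Matrix m k A) : (M * N).map d = M.map d * N + M * N.map d := by
  ext i j
  simp only [Matrix.map_apply, mul_apply, Matrix.add_apply, map_sum, Derivation.leibniz,
    smul_eq_mul, Finset.sum_add_distrib]
  rw [add_comm]
  simp only [mul_comm]

theorem map_deriv_neg {l m : Type} (d : Derivation ℝ A A) (M : Matrix l m A) :
    (-M).map d = -M.map d := by
  ext i j; simp

theorem map_deriv_one {l : Type} [DecidableEq l] (d : Derivation ℝ A A) :
    (1 : Matrix l l A).map d = 0 := by
  ext i j
  by_cases h : i = j <;> simp [h]

theorem eq_zero_of_add_self {x : A} (h : x + x = 0) : x = 0 := by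
  have h1 : (2 : ℝ) • x = 0 := by rw [two_smul, h]
  have h2 : x = (1 / 2 : ℝ) • ((2 : ℝ) • x) := by rw [smul_smul]; norm_num
  rw [h2, h1, smul_zero]

section Ricci

variable {ι : Type} [Fintype ι]

/-- Christoffel symbols of `g`, with inverse `gi`, for a family `D` of derivations. -/
def chrAlg (D : ι → Derivation ℝ A A) (g gi : Matrix ι ι A) (k a b : ι) : A :=
  (1 / 2 : ℝ) • ∑ l, gi k l * (D a (g b l) + D b (g a l) - D l (g a b))

/-- The Ricci tensor of `g`, with inverse `gi`, for a family `D` of commuting derivations. -/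
def ricAlg (D : ι → Derivation ℝ A A) (g gi : Matrix ι ι A) (a b : ι) : A :=
  ∑ k, D k (chrAlg D g gi k a b) - ∑ k, D b (chrAlg D g gi k a k)
    + ∑ k, ∑ l, chrAlg D g gi k k l * chrAlg D g gi l a b
    - ∑ k, ∑ l, chrAlg D g gi k b l * chrAlg D g gi l a k

theorem chrAlg_symm (D : ι → Derivation ℝ A A) {g : Matrix ι ι A} (gi : Matrix ι ι A)
    (hg : g.IsSymm) (k a b : ι) : chrAlg D g gi k a b = chrAlg D g gi k b a := by
  unfold chrAlg
  simp only [hg.apply b a, add_comm (D a _)]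

theorem map_chrAlg {A' : Type} [CommRing A'] [Algebra ℝ A'] (φ : A →ₐ[ℝ] A')
    {D : ι → Derivation ℝ A A} {D' : ι → Derivation ℝ A' A'} (hφ : ∀ i x, φ (D i x) = D' i (φ x))
    (g gi : Matrix ι ι A) (k a b : ι) :
    φ (chrAlg D g gi k a b) = chrAlg D' (g.map φ) (gi.map φ) k a b := by
  simp only [chrAlg, map_smul, map_sum, map_mul, map_add, map_sub, hφ, Matrix.map_apply]

/-- The Ricci tensor is polynomial in the metric, its inverse and their derivatives, hence natural
for homomorphisms that intertwine the derivations. Restriction to t = τ is one of them, also for τ =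
0, so the degenerate limit is computed by evaluation and not by estimates. -/
theorem map_ricAlg {A' : Type} [CommRing A'] [Algebra ℝ A'] (φ : A →ₐ[ℝ] A')
    {D : ι → Derivation ℝ A A} {D' : ι → Derivation ℝ A' A'} (hφ : ∀ i x, φ (D i x) = D' i (φ x))
    (g gi : Matrix ι ι A) (a b : ι) :
    φ (ricAlg D g gi a b) = ricAlg D' (g.map φ) (gi.map φ) a b := by
  simp only [ricAlg, map_sum, map_mul, map_add, map_sub, hφ, map_chrAlg φ hφ]

/-- Rescaling of the coordinates by constants and of the metric by a further constant. -/
theorem chrAlg_rescale (D : ι → Derivation ℝ A A) (g gi : Matrix ι ι A) {c : ι → ℝ}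
    (hc : ∀ i, c i ≠ 0) {r : ℝ} (hr : r ≠ 0) (k a b : ι) :
    chrAlg (fun i => c i • D i) g gi k a b = (c a * c b * (c k)⁻¹) •
      chrAlg D (Matrix.of fun i j => (r * (c i)⁻¹ * (c j)⁻¹) • g i j)
        (Matrix.of fun i j => (r⁻¹ * c i * c j) • gi i j) k a b := by
  simp only [chrAlg, Finset.smul_sum, Matrix.of_apply, Derivation.smul_apply, Derivation.map_smul]
  refine Finset.sum_congr rfl fun l _ => ?_
  simp only [smul_mul_assoc, mul_add, mul_sub, mul_smul_comm, smul_smul, smul_add, smul_sub]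
  have hk := hc k
  have ha := hc a
  have hb := hc b
  have hl := hc l
  congr 1
  · congr 1
    · congr 1; field_simp
    · congr 1; field_simp
  · congr 1; field_simp

/-- The factors belonging to summed indices cancel, which leaves those of a and b. The factor r
disappears because each Christoffel symbol contains the metric and its inverse once. -/
theorem ricAlg_rescale (D : ι → Derivation ℝ A A) (g gi : Matrix ι ι A) {c : ι → ℝ}
    (hc : ∀ i, c i ≠ 0) {r : ℝ} (hr : r ≠ 0) (a b : ι) :
    ricAlg (fun i => c i • D i) g gi a b = (c a * c b) •
      ricAlg D (Matrix.of fun i j => (r * (c i)⁻¹ * (c j)⁻¹) • g i j)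
        (Matrix.of fun i j => (r⁻¹ * c i * c j) • gi i j) a b := by
  simp only [ricAlg, chrAlg_rescale D g gi hc hr, smul_sub, smul_add, Finset.smul_sum,
    Derivation.smul_apply, Derivation.map_smul, smul_mul_smul_comm, smul_smul]
  congr 1
  · congr 1
    · congr 1
      · refine Finset.sum_congr rfl fun k _ => ?_
        congr 1
        have := hc k
        field_simp
      · refine Finset.sum_congr rfl fun k _ => ?_
        congr 1
        have := hc k
        field_simp
    · refine Finset.sum_congr rfl fun k _ => Finset.sum_congr rfl fun l _ => ?_
      congr 1
      have := hc k
      have := hc l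
      field_simp
  · refine Finset.sum_congr rfl fun k _ => Finset.sum_congr rfl fun l _ => ?_
    congr 1
    have := hc k
    have := hc l
    field_simp

variable [DecidableEq ι]

/-- The contracted Christoffel symbols of a symplectic metric vanish. -/
theorem sum_chrAlg_eq_zero (D : ι → Derivation ℝ A A) {g gi E E' : Matrix ι ι A}
    (hg : g.IsSymm) (hgi : gi.IsSymm) (hig : gi * g = 1) (hgig : g * gi = 1) (hE : E * E' = 1)
    (hE' : E' * E = 1)
    (hEd : ∀ a, E.map (D a) = 0) (hsymp : g * E * g = E) (a : ι) :
    ∑ k, chrAlg D g gi k a k = 0 := by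
  have h1 : ∑ k, chrAlg D g gi k a k = (1 / 2 : ℝ) • (gi * g.map (D a)).trace := by
    simp only [chrAlg, ← Finset.smul_sum, Matrix.trace, Matrix.diag, mul_apply, Matrix.map_apply,
      mul_sub, mul_add, Finset.sum_sub_distrib, Finset.sum_add_distrib]
    have e1 : ∑ k, ∑ l, gi k l * D l (g a k) = ∑ k, ∑ l, gi k l * D k (g a l) := by
      rw [Finset.sum_comm]
      simp only [hgi.apply]
    have e2 : ∑ k, ∑ l, gi k l * D a (g k l) = ∑ k, ∑ l, gi k l * D a (g l k) := by
      simp only [hg.apply]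
    rw [e1, e2, add_sub_cancel_right]
  -- Differentiating g E g = E shows that g⁻¹∂g is conjugate to −∂g g⁻¹. Hence tr(g⁻¹∂g), twice the
  -- contracted symbol, equals its own negative.
  have h2 : gi * g.map (D a) + E * g.map (D a) * gi * E' = 0 := by
    have h3 := congrArg (fun M : Matrix ι ι A => gi * M.map (D a) * gi * E') hsymp
    simp only [map_deriv_mul, hEd, mul_zero, add_zero, zero_mul, mul_add, add_mul] at h3
    calc gi * g.map (D a) + E * g.map (D a) * gi * E'
        = gi * g.map (D a) * (E * (g * gi) * E') + (gi * g) * E * g.map (D a) * gi * E' := by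
          rw [hgig, mul_one, hE, mul_one, hig, one_mul]
      _ = 0 := by
          rw [← h3]; noncomm_ring
  have h3 := congrArg Matrix.trace h2
  rw [Matrix.trace_add, Matrix.trace_zero, Matrix.trace_mul_comm _ E', ← mul_assoc, ← mul_assoc,
    hE', one_mul, Matrix.trace_mul_comm _ gi] at h3
  rw [h1, eq_zero_of_add_self h3, smul_zero]

/-- The two terms that drop out contain contracted Christoffel symbols, the logarithmic derivatives
of the volume density. -/
theorem ricAlg_eq_of_symplectic (D : ι → Derivation ℝ A A) {g gi E E' : Matrix ι ι A}
    (hg : g.IsSymm) (hgi : gi.IsSymm) (hig : gi * g = 1) (hgig : g * gi = 1) (hE : E * E' = 1)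
    (hE' : E' * E = 1)
    (hEd : ∀ a, E.map (D a) = 0) (hsymp : g * E * g = E) (a b : ι) :
    ricAlg D g gi a b = ∑ k, D k (chrAlg D g gi k a b)
      - ∑ k, ∑ l, chrAlg D g gi k b l * chrAlg D g gi l a k := by
  have h0 := sum_chrAlg_eq_zero D hg hgi hig hgig hE hE' hEd hsymp
  have h1 : ∀ l, ∑ k, chrAlg D g gi k k l = 0 := fun l => by
    simp only [chrAlg_symm D gi hg _ _ l, h0 l]
  rw [ricAlg, ← map_sum, h0 a, map_zero, sub_zero, Finset.sum_comm (γ := ι)]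
  simp only [← Finset.sum_mul, h1, zero_mul, Finset.sum_const_zero, add_zero]

end Ricci

end Algebraic

end ActionAngle

end

/-! ### The metric in block form -/

noncomputable section

namespace ActionAngle

section Block

open Matrix

variable {A : Type} [CommRing A] {n : ℕ}

/-- The metric determined by the graph matrix `P + iQ`, with `h = Q⁻¹`. -/
def metricBlock (P Q h : Matrix (Fin n) (Fin n) A) : Matrix (Coord n) (Coord n) A :=
  fromBlocks h (-(h * P)) (-(P * h)) (Q + P * h * P)

/-- The inverse of `metricBlock`. -/
def metricBlockInv (P Q h : Matrix (Fin n) (Fin n) A) : Matrix (Coord n) (Coord n) A :=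
  fromBlocks (Q + P * h * P) (P * h) (h * P) h

theorem metricBlock_isSymm {P Q h : Matrix (Fin n) (Fin n) A} (hP : P.IsSymm) (hQ : Q.IsSymm)
    (hh : h.IsSymm) : (metricBlock P Q h).IsSymm := by
  rw [metricBlock, Matrix.IsSymm, fromBlocks_transpose]
  simp [transpose_mul, hP.eq, hQ.eq, hh.eq, mul_assoc]

theorem metricBlockInv_isSymm {P Q h : Matrix (Fin n) (Fin n) A} (hP : P.IsSymm) (hQ : Q.IsSymm)
    (hh : h.IsSymm) : (metricBlockInv P Q h).IsSymm := by
  rw [metricBlockInv, Matrix.IsSymm, fromBlocks_transpose]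
  simp [transpose_mul, hP.eq, hQ.eq, hh.eq, mul_assoc]

theorem metricBlockInv_mul {P Q h : Matrix (Fin n) (Fin n) A} (hQh : Q * h = 1) (hhQ : h * Q = 1) :
    metricBlockInv P Q h * metricBlock P Q h = 1 := by
  rw [metricBlock, metricBlockInv, fromBlocks_multiply, ← fromBlocks_one]
  congr 1
  · rw [mul_neg, add_mul, hQh]; noncomm_ring
  · calc _ = -((Q * h) * P) + P * (h * Q) := by noncomm_ring
      _ = 0 := by rw [hQh, hhQ]; noncomm_ring
  · noncomm_ring
  · rw [mul_add, hhQ]; noncomm_ring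

theorem metricBlock_mul_inv {P Q h : Matrix (Fin n) (Fin n) A} (hQh : Q * h = 1)
    (hhQ : h * Q = 1) : metricBlock P Q h * metricBlockInv P Q h = 1 :=
  mul_eq_one_comm.1 (metricBlockInv_mul hQh hhQ)

/-- This supplies the hypothesis of `sum_chrAlg_eq_zero`: a metric compatible with ω has constant
volume density. -/
theorem metricBlock_symplectic {P Q h : Matrix (Fin n) (Fin n) A} (hQh : Q * h = 1)
    (hhQ : h * Q = 1) :
    metricBlock P Q h * fromBlocks 0 1 (-1) 0 * metricBlock P Q h = fromBlocks 0 1 (-1) 0 := by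
  rw [metricBlock, fromBlocks_multiply, fromBlocks_multiply]
  congr 1
  · noncomm_ring
  · calc _ = h * Q := by noncomm_ring
      _ = 1 := hhQ
  · calc _ = -(Q * h) := by noncomm_ring
      _ = -1 := by rw [hQh]
  · calc _ = (Q * h) * P - P * (h * Q) := by noncomm_ring
      _ = 0 := by rw [hQh, hhQ]; noncomm_ring

end Block

/-! ### Curvature of the limit metric, which depends on the angles only -/

section Collapsed

open Matrix

variable {A : Type} [CommRing A] [Algebra ℝ A] {n : ℕ}

/-- Matrices `P`, `Q`, `h = Q⁻¹` whose derivatives in the angle directions are totally symmetric,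
and which do not depend on the action directions. -/
structure IsCollapsed (D : Coord n → Derivation ℝ A A) (P Q h : Matrix (Fin n) (Fin n) A) :
    Prop where
  symmP : P.IsSymm
  symmQ : Q.IsSymm
  symmh : h.IsSymm
  mul_inv : Q * h = 1
  inv_mul : h * Q = 1
  inl_eq : ∀ i, D (Sum.inl i) = 0
  comm : ∀ i j x, D i (D j x) = D j (D i x)
  closedP : ∀ i j k, D (Sum.inr i) (P j k) = D (Sum.inr j) (P i k)
  closedQ : ∀ i j k, D (Sum.inr i) (Q j k) = D (Sum.inr j) (Q i k)

namespace IsCollapsed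

variable {D : Coord n → Derivation ℝ A A} {P Q h : Matrix (Fin n) (Fin n) A}

theorem ricAlg_eq (H : IsCollapsed D P Q h) (a b : Coord n) :
    ricAlg D (metricBlock P Q h) (metricBlockInv P Q h) a b =
      ∑ k, D k (chrAlg D (metricBlock P Q h) (metricBlockInv P Q h) k a b)
      - ∑ k, ∑ l, chrAlg D (metricBlock P Q h) (metricBlockInv P Q h) k b l *
          chrAlg D (metricBlock P Q h) (metricBlockInv P Q h) l a k := by
  refine ricAlg_eq_of_symplectic D (E := fromBlocks 0 1 (-1) 0) (E' := fromBlocks 0 (-1) 1 0)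
    (metricBlock_isSymm H.symmP H.symmQ H.symmh)
    (metricBlockInv_isSymm H.symmP H.symmQ H.symmh) (metricBlockInv_mul H.mul_inv H.inv_mul)
    (metricBlock_mul_inv H.mul_inv H.inv_mul) ?_ ?_ ?_
    (metricBlock_symplectic H.mul_inv H.inv_mul) a b
  · rw [fromBlocks_multiply, ← fromBlocks_one]; simp
  · rw [fromBlocks_multiply, ← fromBlocks_one]; simp
  · intro a
    rw [fromBlocks_map, ← fromBlocks_zero]
    simp [map_deriv_neg, map_deriv_one]

/-- The derivative of `P` in the direction of the `i`-th angle. -/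
theorem map_inv (H : IsCollapsed D P Q h) (i : Coord n) :
    h.map (D i) = -(h * Q.map (D i) * h) := by
  have h1 := congrArg (fun M : Matrix (Fin n) (Fin n) A => h * M.map (D i)) H.mul_inv
  simp only [map_deriv_mul, map_deriv_one, mul_zero, mul_add, ← mul_assoc, H.inv_mul, one_mul] at h1
  rw [eq_neg_iff_add_eq_zero, add_comm]
  exact h1

theorem mul_map_inv (H : IsCollapsed D P Q h) (i : Coord n) :
    Q * h.map (D i) = -(Q.map (D i) * h) := by
  rw [H.map_inv, mul_neg, ← mul_assoc, ← mul_assoc, H.mul_inv, one_mul]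

theorem symm_map {M : Matrix (Fin n) (Fin n) A} (hM : M.IsSymm) (d : Derivation ℝ A A) :
    (M.map d).IsSymm :=
  Matrix.IsSymm.ext fun i j => by rw [Matrix.map_apply, Matrix.map_apply, hM.apply]

/-- From ∂h = −h ∂Q h and the total symmetry of ∂Q: the divergence of h is h applied to the gradient
of log det h, since tr(Q ∂_m h) = ∂_m log det h. This turns the trace of the Ricci tensor into a
double divergence. -/
theorem sum_deriv_inv (H : IsCollapsed D P Q h) (k : Fin n) :
    ∑ m, D (Sum.inr m) (h m k) =
      ∑ m, h k m * (Q * h.map (D (Sum.inr m))).trace := by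
  have e1 : ∀ m, D (Sum.inr m) (h m k) = -∑ b, ∑ a, h m a * D (Sum.inr b) (Q m a) * h b k := by
    intro m
    have := congrFun (congrFun (H.map_inv (Sum.inr m)) m) k
    simp only [Matrix.map_apply, Matrix.neg_apply, mul_apply, Finset.sum_mul] at this
    rw [this]
    congr 1
    refine Finset.sum_congr rfl fun b _ => Finset.sum_congr rfl fun a _ => ?_
    rw [← H.symmQ.apply a b, H.closedQ m b a]
  have e2 : ∀ b, (Q * h.map (D (Sum.inr b))).trace = -∑ m, ∑ a, h m a * D (Sum.inr b) (Q m a) := by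
    intro b
    rw [H.mul_map_inv, Matrix.trace_neg, Matrix.trace_mul_comm]
    simp only [Matrix.trace, Matrix.diag, mul_apply, Matrix.map_apply]
    congr 1
    refine Finset.sum_congr rfl fun m _ => Finset.sum_congr rfl fun a _ => ?_
    rw [H.symmQ.apply]
  simp only [e1, e2, Finset.sum_neg_distrib, mul_neg, Finset.mul_sum]
  rw [Finset.sum_comm]
  congr 1
  refine Finset.sum_congr rfl fun b _ => Finset.sum_congr rfl fun m _ =>
    Finset.sum_congr rfl fun a _ => ?_
  rw [← H.symmh.apply b k]
  ring

/-- The matrix with entries `∂_l h_{bk}`. -/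
def gradRow (D : Coord n → Derivation ℝ A A) (h : Matrix (Fin n) (Fin n) A) (b : Fin n) :
    Matrix (Fin n) (Fin n) A :=
  Matrix.of fun l k => D (Sum.inr l) (h b k)

/-- The terms that differentiate P cancel, because ∂_l P_{km} is symmetric in l and m. -/
theorem deriv_mul_apply (H : IsCollapsed D P Q h) (b m l : Fin n) :
    D (Sum.inr l) ((h * P) b m) - D (Sum.inr m) ((h * P) b l) =
      (gradRow D h b * P) l m - (gradRow D h b * P) m l := by
  simp only [mul_apply, map_sum, Derivation.leibniz, smul_eq_mul, gradRow, Matrix.of_apply,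
    Finset.sum_add_distrib]
  have : ∀ k, D (Sum.inr l) (P k m) = D (Sum.inr m) (P k l) := fun k => by
    rw [← H.symmP.apply, H.closedP, H.symmP.apply]
  simp only [this, mul_comm (P _ _)]
  ring

/-- With a lower index in an action direction only derivatives of h survive, and P enters only
through conjugation by the shear `fromBlocks 1 P 0 1`. Traces of products of these matrices
therefore do not see P. -/
theorem chrAlg_inl (H : IsCollapsed D P Q h) (b : Fin n) (k l : Coord n) :
    chrAlg D (metricBlock P Q h) (metricBlockInv P Q h) k (Sum.inl b) l =
      (1 / 2 : ℝ) • (fromBlocks 1 P 0 1 *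
        fromBlocks 0 (Q * (gradRow D h b)ᵀ) (-(h * gradRow D h b)) 0 *
        fromBlocks 1 (-P) 0 1 : Matrix (Coord n) (Coord n) A) k l := by
  set T := gradRow D h b with hT
  have hS : ∀ m l, D (Sum.inl b) (metricBlock P Q h l m) + D l (metricBlock P Q h (Sum.inl b) m)
      - D m (metricBlock P Q h (Sum.inl b) l) =
      fromBlocks 0 Tᵀ (-T) (T * P - P * Tᵀ) m l := by
    intro m l
    rw [H.inl_eq]
    rcases m with m | m <;> rcases l with l | l
    · simp [H.inl_eq]
    · simp [H.inl_eq, metricBlock, hT, gradRow]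
    · simp [H.inl_eq, metricBlock, hT, gradRow]
    · have := H.deriv_mul_apply b m l
      have e : (P * Tᵀ) m l = (T * P) l m := by
        rw [← transpose_apply (P * Tᵀ), transpose_mul, transpose_transpose, H.symmP.eq]
      simp only [metricBlock, Derivation.coe_zero, Pi.zero_apply, fromBlocks_apply₁₂,
        fromBlocks_apply₂₂, Matrix.neg_apply, map_neg, zero_add, Matrix.sub_apply, e, ← hT] at this ⊢
      linear_combination -this
  have hM : metricBlockInv P Q h * fromBlocks 0 Tᵀ (-T) (T * P - P * Tᵀ) =
      fromBlocks (1 : Matrix (Fin n) (Fin n) A) P 0 1 *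
        fromBlocks 0 (Q * Tᵀ) (-(h * T)) 0 * fromBlocks (1 : Matrix (Fin n) (Fin n) A) (-P) 0 1 := by
    rw [metricBlockInv, fromBlocks_multiply, fromBlocks_multiply, fromBlocks_multiply]
    congr 1 <;> noncomm_ring
  rw [chrAlg, ← hM, mul_apply]
  simp only [hS]

theorem trace_chr_mul (H : IsCollapsed D P Q h) (a b : Fin n) :
    ∑ k, ∑ l, chrAlg D (metricBlock P Q h) (metricBlockInv P Q h) k (Sum.inl b) l *
      chrAlg D (metricBlock P Q h) (metricBlockInv P Q h) l (Sum.inl a) k =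
    -((1 / 4 : ℝ) • ((h * (gradRow D h b * Q * (gradRow D h a)ᵀ)).trace
      + (h * (gradRow D h a * Q * (gradRow D h b)ᵀ)).trace)) := by
  simp only [H.chrAlg_inl, smul_mul_smul_comm, ← Finset.smul_sum]
  set U : Matrix (Coord n) (Coord n) A := fromBlocks 1 P 0 1
  set V : Matrix (Coord n) (Coord n) A := fromBlocks 1 (-P) 0 1
  have hVU : V * U = 1 := by
    simp only [U, V, fromBlocks_multiply, ← fromBlocks_one]; simp
  set Nb : Matrix (Coord n) (Coord n) A := fromBlocks 0 (Q * (gradRow D h b)ᵀ) (-(h * gradRow D h b)) 0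
  set Na : Matrix (Coord n) (Coord n) A := fromBlocks 0 (Q * (gradRow D h a)ᵀ) (-(h * gradRow D h a)) 0
  have h1 : ∑ k, ∑ l, (U * Nb * V) k l * (U * Na * V) l k = (Nb * Na).trace := by
    calc _ = ((U * Nb * V) * (U * Na * V)).trace := by
          simp [Matrix.trace, mul_apply]
      _ = (U * (Nb * (V * U) * Na * V)).trace := by congr 1; noncomm_ring
      _ = (Nb * Na * (V * U)).trace := by
          rw [hVU, mul_one, Matrix.trace_mul_comm, mul_assoc (Nb * Na), hVU, mul_one]
      _ = _ := by rw [hVU, mul_one]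
  rw [h1]
  simp only [Nb, Na, fromBlocks_multiply, Matrix.trace, Matrix.diag, Fintype.sum_sum_type, fromBlocks_apply₁₁,
    fromBlocks_apply₂₂]
  simp only [mul_zero, zero_add, add_zero, mul_neg, neg_mul, Matrix.neg_apply,
    Finset.sum_neg_distrib]
  rw [← neg_add, smul_neg]
  have e1 : (Q * (gradRow D h b)ᵀ * (h * gradRow D h a)).trace
      = (h * (gradRow D h a * Q * (gradRow D h b)ᵀ)).trace := by
    rw [Matrix.trace_mul_comm]; congr 1; noncomm_ring
  have e2 : (h * gradRow D h b * (Q * (gradRow D h a)ᵀ)).trace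
      = (h * (gradRow D h b * Q * (gradRow D h a)ᵀ)).trace := by
    congr 1; noncomm_ring
  simp only [Matrix.trace, Matrix.diag] at e1 e2
  rw [e1, e2, add_comm]
  norm_num

/-- By Q ∂h Q = −∂Q, the quadratic terms of the Ricci tensor contract with Q to this one expression.
It cancels a product rule term in `sum_mul_ricAlg`. -/
theorem sum_trace_eq (H : IsCollapsed D P Q h) :
    ∑ a, ∑ b, Q a b * (h * (gradRow D h b * Q * (gradRow D h a)ᵀ)).trace =
      -∑ i, ∑ j, h i j * (Q.map (D (Sum.inr i)) * h.map (D (Sum.inr j))).trace := by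
  have e1 : ∀ a b i j, (gradRow D h b * Q * (gradRow D h a)ᵀ) j i =
      (h.map (D (Sum.inr j)) * Q * h.map (D (Sum.inr i))) b a := by
    intro a b i j
    rw [mul_apply, mul_apply]
    refine Finset.sum_congr rfl fun k _ => ?_
    rw [← (symm_map H.symmh (D (Sum.inr i))).apply k a]
    simp only [mul_apply, gradRow, Matrix.of_apply, transpose_apply, Matrix.map_apply]
  have e2 : ∀ a b, (h * (gradRow D h b * Q * (gradRow D h a)ᵀ)).trace =
      ∑ i, ∑ j, h i j * (h.map (D (Sum.inr j)) * Q * h.map (D (Sum.inr i))) b a := by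
    intro a b
    rw [Matrix.trace]
    refine Finset.sum_congr rfl fun i _ => ?_
    rw [Matrix.diag, mul_apply]
    simp only [e1]
  have e3 : ∀ i j, ∑ a, ∑ b, Q a b * (h.map (D (Sum.inr j)) * Q * h.map (D (Sum.inr i))) b a
      = -(Q.map (D (Sum.inr i)) * h.map (D (Sum.inr j))).trace := by
    intro i j
    calc _ = (Q * (h.map (D (Sum.inr j)) * Q * h.map (D (Sum.inr i)))).trace := by
          simp only [Matrix.trace, Matrix.diag, Matrix.mul_apply (M := Q)]
      _ = ((h.map (D (Sum.inr j))) * (Q * h.map (D (Sum.inr i)) * Q)).trace := by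
          rw [Matrix.trace_mul_comm]; congr 1; noncomm_ring
      _ = _ := by
          rw [H.mul_map_inv, neg_mul, mul_assoc, H.inv_mul, mul_one, mul_neg, Matrix.trace_neg,
            Matrix.trace_mul_comm]
  simp only [e2, Finset.mul_sum]
  calc _ = ∑ i, ∑ j, h i j * ∑ a, ∑ b,
        Q a b * (h.map (D (Sum.inr j)) * Q * h.map (D (Sum.inr i))) b a := by
        simp only [Finset.mul_sum]
        rw [Finset.sum_congr rfl fun a _ => Finset.sum_comm, Finset.sum_comm]
        refine Finset.sum_congr rfl fun i _ => ?_
        rw [Finset.sum_congr rfl fun a _ => Finset.sum_comm, Finset.sum_comm]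
        refine Finset.sum_congr rfl fun j _ => Finset.sum_congr rfl fun a _ =>
          Finset.sum_congr rfl fun b _ => by ring
    _ = _ := by simp only [e3, mul_neg, Finset.sum_neg_distrib]

/-- Half of the scalar curvature, in terms of the second derivatives of `h`. -/
theorem sum_mul_ricAlg (H : IsCollapsed D P Q h) :
    ∑ a, ∑ b, Q a b * ricAlg D (metricBlock P Q h) (metricBlockInv P Q h) (Sum.inl a) (Sum.inl b) =
      -((1 / 2 : ℝ) • ∑ k, D (Sum.inr k) (∑ m, D (Sum.inr m) (h m k))) := by
  set X := ∑ i, ∑ j, h i j * (Q.map (D (Sum.inr i)) * h.map (D (Sum.inr j))).trace with hX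
  have hR : ∀ a b, ricAlg D (metricBlock P Q h) (metricBlockInv P Q h) (Sum.inl a) (Sum.inl b) =
      -((1 / 2 : ℝ) • ∑ i, D (Sum.inr i) (∑ m, h i m * D (Sum.inr m) (h a b)))
      + (1 / 4 : ℝ) • ((h * (gradRow D h b * Q * (gradRow D h a)ᵀ)).trace
      + (h * (gradRow D h a * Q * (gradRow D h b)ᵀ)).trace) := by
    intro a b
    rw [H.ricAlg_eq, H.trace_chr_mul, sub_neg_eq_add]
    congr 1
    have e1 : ∀ i, D (Sum.inr i) (chrAlg D (metricBlock P Q h) (metricBlockInv P Q h)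
        (Sum.inr i) (Sum.inl a) (Sum.inl b)) =
        -((1 / 2 : ℝ) • D (Sum.inr i) (∑ m, h i m * D (Sum.inr m) (h a b))) := by
      intro i
      rw [H.chrAlg_inl, fromBlocks_multiply, fromBlocks_multiply, fromBlocks_apply₂₁,
        Derivation.map_smul, ← smul_neg, ← map_neg]
      simp [mul_apply, gradRow]
    simp only [Fintype.sum_sum_type, H.inl_eq, Derivation.coe_zero, Pi.zero_apply,
      Finset.sum_const_zero, zero_add, e1, Finset.sum_neg_distrib, Finset.smul_sum]
  have hQ2 : ∑ a, ∑ b, Q a b * (h * (gradRow D h a * Q * (gradRow D h b)ᵀ)).trace = -X := by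
    rw [Finset.sum_comm, ← H.sum_trace_eq]
    simp only [H.symmQ.apply]
  -- Since Q_{ab} ∂_m h_{ab} = ∂_m log det h, moving Q under the outer derivative produces the
  -- double divergence by `sum_deriv_inv`; the derivative falling on Q leaves −X.
  have hL : ∑ a, ∑ b, Q a b * ∑ i, D (Sum.inr i) (∑ m, h i m * D (Sum.inr m) (h a b)) =
      ∑ k, D (Sum.inr k) (∑ m, D (Sum.inr m) (h m k)) - X := by
    have e1 : ∀ i, ∑ a, ∑ b, Q a b * D (Sum.inr i) (∑ m, h i m * D (Sum.inr m) (h a b)) =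
        D (Sum.inr i) (∑ m, D (Sum.inr m) (h m i)) -
          ∑ j, h i j * (Q.map (D (Sum.inr i)) * h.map (D (Sum.inr j))).trace := by
      intro i
      rw [H.sum_deriv_inv i]
      have f1 : ∑ m, h i m * (Q * h.map (D (Sum.inr m))).trace =
          ∑ a, ∑ b, Q a b * ∑ m, h i m * D (Sum.inr m) (h a b) := by
        simp only [Matrix.trace, Matrix.diag, mul_apply, Matrix.map_apply, Finset.mul_sum]
        rw [Finset.sum_comm]
        refine Finset.sum_congr rfl fun a _ => ?_
        rw [Finset.sum_comm]
        refine Finset.sum_congr rfl fun b _ => Finset.sum_congr rfl fun m _ => ?_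
        rw [H.symmh.apply a b]; ring
      have f2 : ∑ j, h i j * (Q.map (D (Sum.inr i)) * h.map (D (Sum.inr j))).trace =
          ∑ a, ∑ b, D (Sum.inr i) (Q a b) * ∑ m, h i m * D (Sum.inr m) (h a b) := by
        simp only [Matrix.trace, Matrix.diag, mul_apply, Matrix.map_apply, Finset.mul_sum]
        rw [Finset.sum_comm]
        refine Finset.sum_congr rfl fun a _ => ?_
        rw [Finset.sum_comm]
        refine Finset.sum_congr rfl fun b _ => Finset.sum_congr rfl fun m _ => ?_
        rw [H.symmh.apply a b]; ring
      rw [f1, f2, map_sum, ← Finset.sum_sub_distrib]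
      refine Finset.sum_congr rfl fun a _ => ?_
      rw [map_sum, ← Finset.sum_sub_distrib]
      refine Finset.sum_congr rfl fun b _ => ?_
      rw [Derivation.leibniz]
      simp only [smul_eq_mul]
      ring
    rw [hX, ← Finset.sum_sub_distrib, ← Finset.sum_congr rfl fun i _ => e1 i]
    simp only [Finset.mul_sum]
    rw [Finset.sum_congr rfl fun a _ => Finset.sum_comm, Finset.sum_comm]
  simp only [hR, mul_add, mul_neg, mul_smul_comm, Finset.sum_add_distrib, Finset.sum_neg_distrib,
    ← Finset.smul_sum]
  rw [hL, H.sum_trace_eq, hQ2, ← hX]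
  module

end IsCollapsed

end Collapsed

end ActionAngle

end

/-! ### The divergence identity for `Q`, and Ricci-flatness when `Q` is constant -/

noncomputable section

namespace ActionAngle

namespace IsCollapsed

open Matrix

variable {A : Type} [CommRing A] [Algebra ℝ A] {n : ℕ}
  {D : Coord n → Derivation ℝ A A} {P Q h : Matrix (Fin n) (Fin n) A}

/-- The vector field whose divergence compares the scalar curvature with the derivative of `Q` in
the `c`-th angle. -/
def fluxField (D : Coord n → Derivation ℝ A A) (Q h : Matrix (Fin n) (Fin n) A) (c k : Fin n) : A :=
  (∑ m, D (Sum.inr m) (h m k)) * Q c c - ∑ m, h k m * D (Sum.inr m) (Q c c)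
    + if k = c then ∑ a, ∑ b, h a b * D (Sum.inr c) (Q a b) else 0

/-- The first two terms of the field give S·Q_{cc} − h_{km} ∂_k∂_m Q_{cc}, their mixed first-order
terms cancelling. By total symmetry ∂_k∂_m Q_{cc} = ∂_c² Q_{km}, so the third term cancels the
second derivatives and leaves ∂_c h_{ab} ∂_c Q_{ab}, which is minus the trace. -/
theorem sum_deriv_fluxField (H : IsCollapsed D P Q h) (c : Fin n) :
    ∑ k, D (Sum.inr k) (fluxField D Q h c k) =
      (∑ k, D (Sum.inr k) (∑ m, D (Sum.inr m) (h m k))) * Q c c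
        - (h * Q.map (D (Sum.inr c)) * h * Q.map (D (Sum.inr c))).trace := by
  have hcc : ∀ k m, D (Sum.inr k) (D (Sum.inr m) (Q c c)) =
      D (Sum.inr c) (D (Sum.inr c) (Q k m)) := by
    intro k m
    rw [H.closedQ m c c, H.comm, ← H.symmQ.apply m c, H.closedQ k c m]
  have e1 : ∑ k, D (Sum.inr k) (if k = c then ∑ a, ∑ b, h a b * D (Sum.inr c) (Q a b) else 0) =
      ∑ a, ∑ b, (D (Sum.inr c) (h a b) * D (Sum.inr c) (Q a b)
        + h a b * D (Sum.inr c) (D (Sum.inr c) (Q a b))) := by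
    rw [Finset.sum_eq_single c]
    · simp only [if_true, map_sum, Derivation.leibniz, smul_eq_mul]
      refine Finset.sum_congr rfl fun a _ => Finset.sum_congr rfl fun b _ => by ring
    · intro b _ hb
      rw [if_neg hb, map_zero]
    · simp
  have e2 : ∑ k, ∑ m, D (Sum.inr k) (h k m * D (Sum.inr m) (Q c c)) =
      ∑ k, (∑ m, D (Sum.inr m) (h m k)) * D (Sum.inr k) (Q c c)
        + ∑ a, ∑ b, h a b * D (Sum.inr c) (D (Sum.inr c) (Q a b)) := by
    simp only [Derivation.leibniz, smul_eq_mul, hcc, Finset.sum_add_distrib, Finset.sum_mul]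
    rw [add_comm]
    congr 1
    rw [Finset.sum_comm]
    refine Finset.sum_congr rfl fun a _ => Finset.sum_congr rfl fun b _ => by ring
  have e3 : (h * Q.map (D (Sum.inr c)) * h * Q.map (D (Sum.inr c))).trace =
      -∑ a, ∑ b, D (Sum.inr c) (h a b) * D (Sum.inr c) (Q a b) := by
    have : h * Q.map (D (Sum.inr c)) * h = -h.map (D (Sum.inr c)) := by rw [H.map_inv, neg_neg]
    rw [this, neg_mul, Matrix.trace_neg]
    simp only [Matrix.trace, Matrix.diag, mul_apply, Matrix.map_apply]
    congr 1
    refine Finset.sum_congr rfl fun a _ => Finset.sum_congr rfl fun b _ => ?_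
    rw [H.symmQ.apply]
  simp only [fluxField, map_add, map_sub, Finset.sum_add_distrib, Finset.sum_sub_distrib, e1, e3,
    Derivation.leibniz _ (∑ m, D (Sum.inr m) (h m _)), map_sum _ _ Finset.univ] at e2 ⊢
  rw [e2]
  simp only [smul_eq_mul, Finset.sum_mul, mul_comm (Q c c)]
  ring

theorem map_inv_eq_zero (H : IsCollapsed D P Q h) (hQ : ∀ i j k, D (Sum.inr i) (Q j k) = 0)
    (a : Coord n) (j k : Fin n) : D a (h j k) = 0 := by
  rcases a with a | a
  · simp [H.inl_eq]
  · have h1 : Q.map (D (Sum.inr a)) = 0 := by ext j k; simp [hQ]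
    have h2 := congrFun (congrFun (H.map_inv (Sum.inr a)) j) k
    simpa [h1] using h2

/-- The Christoffel symbols when `Q` does not depend on the angles. -/
def flatChr (D : Coord n → Derivation ℝ A A) (P : Matrix (Fin n) (Fin n) A) :
    Coord n → Coord n → Coord n → A
  | Sum.inl k, Sum.inr i, Sum.inr j => -D (Sum.inr i) (P j k)
  | _, _, _ => 0

/-- The metric is h(dx − P dθ)² + Q dθ² with P dθ closed. If dφ = P dθ locally, the coordinates (x −
φ(θ), θ) make its coefficients constant; the remaining symbols are minus the second derivatives of
φ. -/
theorem chrAlg_eq_flatChr (H : IsCollapsed D P Q h) (hQ : ∀ i j k, D (Sum.inr i) (Q j k) = 0)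
    (k a b : Coord n) :
    chrAlg D (metricBlock P Q h) (metricBlockInv P Q h) k a b = flatChr D P k a b := by
  have hh := H.map_inv_eq_zero hQ
  have hcl : ∀ i j k, D (Sum.inr i) (P k j) = D (Sum.inr j) (P k i) := fun i j k => by
    rw [← H.symmP.apply, H.closedP, H.symmP.apply]
  have hhP : ∀ i a b, D (Sum.inr i) ((h * P) a b) = (h * P.map (D (Sum.inr i))) a b := by
    intro i a b
    simp [mul_apply, Derivation.leibniz, hh]
  have hPh : ∀ i a b, D (Sum.inr i) ((P * h) a b) = (P.map (D (Sum.inr i)) * h) a b := by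
    intro i a b
    simp [mul_apply, Derivation.leibniz, hh, mul_comm]
  have hPhP : ∀ i a b, D (Sum.inr i) ((P * h * P) a b) =
      (P.map (D (Sum.inr i)) * (h * P)) a b + (P * h * P.map (D (Sum.inr i))) a b := by
    intro i a b
    have := congrFun (congrFun (map_deriv_mul (D (Sum.inr i)) (P * h) P) a) b
    rw [Matrix.map_apply, Matrix.add_apply] at this
    rw [this, map_deriv_mul, show h.map (D (Sum.inr i)) = 0 from by ext; simp [hh], mul_zero,
      add_zero, mul_assoc]
  -- The comparison is made with the upper index lowered, so that the inverse metric need not be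
  -- expanded; it is applied to both sides at the end.
  have hfirst : ∀ m, (1 / 2 : ℝ) • (D a (metricBlock P Q h b m) + D b (metricBlock P Q h a m)
      - D m (metricBlock P Q h a b)) = ∑ l, metricBlock P Q h m l * flatChr D P l a b := by
    intro m
    rw [Fintype.sum_sum_type]
    have half : ∀ x : A, (1 / 2 : ℝ) • (x + x) = x := fun x => by module
    rcases a with a | a <;> rcases b with b | b
    · simp [H.inl_eq, flatChr]
      rcases m with m | m <;> simp [H.inl_eq, metricBlock, hh]
    · simp only [flatChr, mul_zero, Finset.sum_const_zero, add_zero]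
      rcases m with m | m <;> simp [H.inl_eq, metricBlock, hh, hhP]
      simp only [mul_apply, Matrix.map_apply, hcl m b, neg_add_cancel]
    · simp only [flatChr, mul_zero, Finset.sum_const_zero, add_zero]
      rcases m with m | m
      · simp [H.inl_eq, metricBlock, hh]
      · simp only [metricBlock, H.inl_eq, fromBlocks_apply₁₂, fromBlocks_apply₂₁, map_neg, hhP, hPh,
          Derivation.coe_zero, Pi.zero_apply, add_zero, Matrix.neg_apply]
        have : (h * P.map (D (Sum.inr a))) b m = (P.map (D (Sum.inr m)) * h) a b := by
          simp only [mul_apply, Matrix.map_apply]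
          refine Finset.sum_congr rfl fun k _ => ?_
          rw [H.symmh.apply k b, hcl a m k, H.symmP.apply k a, mul_comm]
        rw [this]; simp
    · simp only [flatChr, mul_zero, Finset.sum_const_zero, add_zero]
      rcases m with m | m
      · simp only [metricBlock, H.inl_eq, fromBlocks_apply₁₁, fromBlocks_apply₂₁, map_neg, hPh,
          Derivation.coe_zero, Pi.zero_apply, sub_zero, Matrix.neg_apply]
        have e1 : (P.map (D (Sum.inr b)) * h) a m = (P.map (D (Sum.inr a)) * h) b m := by
          simp only [mul_apply, Matrix.map_apply, H.closedP a b]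
        rw [e1, half]
        simp only [mul_apply, Matrix.map_apply, mul_neg, Finset.sum_neg_distrib]
        congr 1
        refine Finset.sum_congr rfl fun k _ => ?_
        rw [H.symmh.apply k m, mul_comm]
      · simp only [metricBlock, fromBlocks_apply₂₂, fromBlocks_apply₂₁, Matrix.add_apply, map_add,
          hQ, hPhP, zero_add]
        have e1 : (P.map (D (Sum.inr b)) * (h * P)) a m = (P.map (D (Sum.inr a)) * (h * P)) b m := by
          simp only [mul_apply (M := P.map _), Matrix.map_apply, H.closedP a b]
        have e2 : (P * h * P.map (D (Sum.inr a))) b m = (P * h * P.map (D (Sum.inr m))) b a := by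
          simp only [mul_apply (N := P.map _), Matrix.map_apply, hcl a m]
        have e3 : (P * h * P.map (D (Sum.inr b))) a m = (P * h * P.map (D (Sum.inr m))) a b := by
          simp only [mul_apply (N := P.map _), Matrix.map_apply, hcl b m]
        have e4 : (P.map (D (Sum.inr m)) * (h * P)) a b = (P * h * P.map (D (Sum.inr m))) b a := by
          rw [← transpose_apply (P.map (D (Sum.inr m)) * (h * P)), transpose_mul, transpose_mul,
            H.symmP.eq, H.symmh.eq, (symm_map H.symmP _).eq]
        have e5 : ∑ k, -(P * h) m k * -D (Sum.inr a) (P b k) =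
            (P.map (D (Sum.inr a)) * (h * P)) b m := by
          rw [← transpose_apply (P.map (D (Sum.inr a)) * (h * P)), transpose_mul, transpose_mul,
            H.symmP.eq, H.symmh.eq, (symm_map H.symmP _).eq, mul_apply]
          refine Finset.sum_congr rfl fun k _ => ?_
          rw [neg_mul_neg, Matrix.map_apply, H.symmP.apply]
        rw [e1, e2, e3, e4]
        simp only [Matrix.neg_apply, e5]
        rw [← half ((P.map (D (Sum.inr a)) * (h * P)) b m)]
        congr 1
        rw [half]
        ring
  have hinv := metricBlockInv_mul (P := P) H.mul_inv H.inv_mul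
  calc chrAlg D (metricBlock P Q h) (metricBlockInv P Q h) k a b
      = ∑ m, metricBlockInv P Q h k m * ∑ l, metricBlock P Q h m l * flatChr D P l a b := by
        simp only [← hfirst, mul_smul_comm, chrAlg, Finset.smul_sum]
    _ = (metricBlockInv P Q h *ᵥ (metricBlock P Q h *ᵥ fun l => flatChr D P l a b)) k := rfl
    _ = _ := by rw [mulVec_mulVec, hinv, one_mulVec]

/-- The Ricci tensor vanishes when `Q` does not depend on the angles. -/
theorem ricAlg_eq_zero (H : IsCollapsed D P Q h) (hQ : ∀ i j k, D (Sum.inr i) (Q j k) = 0)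
    (a b : Coord n) : ricAlg D (metricBlock P Q h) (metricBlockInv P Q h) a b = 0 := by
  -- Nonzero symbols have an upper action index and two lower angle indices. A derivative contracted
  -- with the upper index is in an action direction, hence zero; in the quadratic term a contracted
  -- index would have to be of both kinds.
  simp only [H.ricAlg_eq, H.chrAlg_eq_flatChr hQ, Fintype.sum_sum_type, H.inl_eq]
  rcases a with a | a <;> rcases b with b | b <;> simp [flatChr]

end IsCollapsed

end ActionAngle

end

/-! ### The divergence theorem on the torus and trace inequalities -/

noncomputable section

namespace ActionAngle

open MeasureTheory

/-- A periodic vector field with nonpositive divergence has zero divergence. -/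
theorem divergence_eq_zero_of_nonpos {n : ℕ} {Z : Fin n → (Fin n → ℝ) → ℝ}
    (hZ : ∀ i, ContDiff ℝ 1 (Z i)) (hper : ∀ i θ, Z i (θ + Pi.single i 1) = Z i θ)
    (hdiv : ∀ θ, ∑ i, fderiv ℝ (Z i) θ (Pi.single i 1) ≤ 0) (θ : Fin n → ℝ) :
    ∑ i, fderiv ℝ (Z i) θ (Pi.single i 1) = 0 := by
  rcases n with _ | n
  · simp
  -- The unit cell is centred at θ, so that θ is interior and vanishing almost everywhere in the
  -- cell reaches θ by continuity.
  set a : Fin (n + 1) → ℝ := fun i => θ i - 1 / 2 with ha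
  set b : Fin (n + 1) → ℝ := fun i => θ i + 1 / 2 with hb
  have hcont : Continuous fun x => ∑ i, fderiv ℝ (Z i) x (Pi.single i 1) :=
    continuous_finsetSum _ fun i _ => ((hZ i).continuous_fderiv (by simp)).clm_apply
      continuous_const
  have hint : ∫ x in Set.Icc a b, ∑ i, fderiv ℝ (Z i) x (Pi.single i 1) = 0 := by
    rw [integral_divergence_of_hasFDerivAt_off_countable' a b
      (fun i => by simp only [ha, hb]; linarith) Z (fun i => fderiv ℝ (Z i)) ∅
      Set.countable_empty (fun i => (hZ i).continuous.continuousOn)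
      (fun x _ i => ((hZ i).differentiable (by simp) x).hasFDerivAt)
      (hcont.continuousOn.integrableOn_compact isCompact_Icc)]
    -- Opposite faces carry equal integrals by periodicity.
    refine Finset.sum_eq_zero fun i _ => ?_
    rw [sub_eq_zero]
    congr 1
    funext x
    rw [← hper i (i.insertNth (a i) x)]
    congr 1
    funext j
    refine Fin.succAboveCases i ?_ (fun k => ?_) j
    · simp [ha, hb]; ring
    · simp [Fin.succAbove_ne]
  have hneg : ∫ x in Set.Icc a b, -∑ i, fderiv ℝ (Z i) x (Pi.single i 1) = 0 := by
    rw [integral_neg, hint, neg_zero]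
  rw [setIntegral_eq_zero_iff_of_nonneg_ae
    (Filter.Eventually.of_forall fun x => neg_nonneg.2 (hdiv x))
    (hcont.neg.continuousOn.integrableOn_compact isCompact_Icc)] at hneg
  set V : Set (Fin (n + 1) → ℝ) := Set.pi Set.univ fun i => Set.Ioo (a i) (b i)
  have hV : IsOpen V := isOpen_set_pi Set.finite_univ fun i _ => isOpen_Ioo
  have hVsub : V ⊆ Set.Icc a b := fun x hx =>
    ⟨fun i => (hx i trivial).1.le, fun i => (hx i trivial).2.le⟩
  have := Measure.eqOn_open_of_ae_eq (ae_restrict_of_ae_restrict_of_subset hVsub hneg) hV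
    hcont.neg.continuousOn continuousOn_const
  have h0 := this (x := θ) fun i _ => ⟨by simp [ha], by simp [hb]⟩
  simpa using h0

section PosSemidef

open Matrix
open scoped MatrixOrder

theorem exists_eq_transpose_mul_self {m : ℕ} {M : Matrix (Fin m) (Fin m) ℝ} (hM : M.PosSemidef) :
    ∃ B : Matrix (Fin m) (Fin m) ℝ, M = Bᵀ * B := by
  obtain ⟨B, hB⟩ := CStarAlgebra.nonneg_iff_eq_star_mul_self.mp hM.nonneg
  exact ⟨B, by rw [hB, star_eq_conjTranspose, conjTranspose_eq_transpose_of_trivial]⟩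

/-- For h = BᵀB the trace tr(h X h X) is the squared Frobenius norm of B X Bᵀ. This gives the sign
of the quadratic term in the divergence identity, and X = 0 when it vanishes and h is invertible. -/
theorem trace_mul_mul_mul_eq {m : ℕ} {B X : Matrix (Fin m) (Fin m) ℝ} (hX : X.IsSymm) :
    (Bᵀ * B * X * (Bᵀ * B) * X).trace = ((B * X * Bᵀ)ᵀ * (B * X * Bᵀ)).trace := by
  rw [transpose_mul, transpose_mul, hX.eq, transpose_transpose, Matrix.mul_assoc _ _ X,
    Matrix.mul_assoc Bᵀ B, Matrix.mul_assoc, Matrix.trace_mul_comm]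
  congr 1
  noncomm_ring

theorem trace_mul_mul_mul_nonneg {m : ℕ} {h X : Matrix (Fin m) (Fin m) ℝ} (hh : h.PosSemidef)
    (hX : X.IsSymm) : 0 ≤ (h * X * h * X).trace := by
  obtain ⟨B, rfl⟩ := exists_eq_transpose_mul_self hh
  rw [trace_mul_mul_mul_eq hX]
  exact (posSemidef_conjTranspose_mul_self (B * X * Bᵀ)).trace_nonneg

theorem eq_zero_of_trace_mul_mul_mul {m : ℕ} {Q h X : Matrix (Fin m) (Fin m) ℝ}
    (hh : h.PosSemidef) (hQ : Q * h = 1) (hX : X.IsSymm) (h0 : (h * X * h * X).trace = 0) :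
    X = 0 := by
  obtain ⟨B, rfl⟩ := exists_eq_transpose_mul_self hh
  rw [trace_mul_mul_mul_eq hX] at h0
  have h1 : B * X * Bᵀ = 0 := trace_conjTranspose_mul_self_eq_zero_iff.1 h0
  calc X = (Q * (Bᵀ * B)) * X * ((Bᵀ * B) * Q) := by rw [hQ, mul_eq_one_comm.1 hQ]; simp
    _ = Q * Bᵀ * (B * X * Bᵀ) * B * Q := by noncomm_ring
    _ = 0 := by rw [h1]; simp

/-- With Q = BᵀB the contraction is the sum of the values of the quadratic form of S on the rows of
B; symmetry of S plays no role. -/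
theorem sum_mul_nonneg {m : ℕ} {Q S : Matrix (Fin m) (Fin m) ℝ} (hQ : Q.PosSemidef)
    (hS : ∀ v, 0 ≤ v ⬝ᵥ S *ᵥ v) : 0 ≤ ∑ a, ∑ b, Q a b * S a b := by
  obtain ⟨B, rfl⟩ := exists_eq_transpose_mul_self hQ
  have : ∑ a, ∑ b, (Bᵀ * B) a b * S a b = ∑ c, B c ⬝ᵥ S *ᵥ B c := by
    simp only [mul_apply, transpose_apply, Finset.sum_mul, dotProduct, mulVec, Finset.mul_sum]
    rw [Finset.sum_congr rfl fun a _ => Finset.sum_comm, Finset.sum_comm]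
    refine Finset.sum_congr rfl fun c _ => Finset.sum_congr rfl fun a _ =>
      Finset.sum_congr rfl fun b _ => by ring
  rw [this]
  exact Finset.sum_nonneg fun c _ => hS _

end PosSemidef

/-! ### Restriction to the torus fibres and rigidity of `Q` along them -/

section Fibre

open TopologicalSpace (Opens)
open Matrix

variable {n : ℕ}

theorem isOpen_dom (n : ℕ) (R : ℝ) : IsOpen (dom n R) :=
  isOpen_lt (by fun_prop) continuous_const

/-- `dom n R` as an open set. -/
def domOpens (n : ℕ) (R : ℝ) : Opens (Pt n) := ⟨dom n R, isOpen_dom n R⟩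

theorem mem_domOpens {R : ℝ} {p : Pt n} : p ∈ domOpens n R ↔ p ∈ dom n R := Iff.rfl

theorem shift_mem {R : ℝ} (k : Fin n → ℤ) {p : Pt n} (hp : p ∈ dom n R) : shift k p ∈ dom n R := by
  simpa [dom, shift] using hp

theorem contDiff_shift (k : Fin n → ℤ) : ContDiff ℝ ∞ (shift k) := by
  unfold shift; fun_prop

/-- Pull-back along the translation by `k` in the angles. -/
def shiftPull (R : ℝ) (k : Fin n → ℤ) :
    SmoothFun (domOpens n R) →ₐ[ℝ] SmoothFun (domOpens n R) :=
  SmoothFun.pullback (shift k) (contDiff_shift k)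
    fun _ hp => mem_domOpens.2 (shift_mem k (mem_domOpens.1 hp))

theorem shiftPull_ext {R : ℝ} (k : Fin n → ℤ) (f : SmoothFun (domOpens n R)) {p : Pt n}
    (hp : p ∈ dom n R) : (shiftPull R k f).ext p = f.ext (shift k p) :=
  SmoothFun.pullback_ext _ _ _ f (mem_domOpens.2 hp)

theorem deriv_shiftPull {R : ℝ} (k : Fin n → ℤ) (v : Pt n) (f : SmoothFun (domOpens n R)) :
    SmoothFun.deriv v (shiftPull R k f) = shiftPull R k (SmoothFun.deriv v f) := by
  refine SmoothFun.deriv_pullback _ _ _ (fun p _ => ?_) f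
  unfold shift
  rw [fderiv_add_const, fderiv_fun_id]
  rfl

/-- The coordinate derivations. -/
def coordDeriv (n : ℕ) (R : ℝ) (a : Coord n) :
    Derivation ℝ (SmoothFun (domOpens n R)) (SmoothFun (domOpens n R)) :=
  SmoothFun.deriv (Pi.single a 1)

/-- The derivations in the angle coordinates; zero in the directions of the action coordinates. -/
def angleDeriv (n : ℕ) (R : ℝ) : Coord n →
    Derivation ℝ (SmoothFun (domOpens n R)) (SmoothFun (domOpens n R))
  | Sum.inl _ => 0
  | Sum.inr i => coordDeriv n R (Sum.inr i)

theorem angleDeriv_comm (R : ℝ) (i j : Coord n) (f : SmoothFun (domOpens n R)) :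
    angleDeriv n R i (angleDeriv n R j f) = angleDeriv n R j (angleDeriv n R i f) := by
  rcases i with i | i <;> rcases j with j | j <;> simp [angleDeriv]
  exact SmoothFun.deriv_comm _ _ _

theorem angleDeriv_shiftPull {R : ℝ} (k : Fin n → ℤ) (a : Coord n) (f : SmoothFun (domOpens n R)) :
    angleDeriv n R a (shiftPull R k f) = shiftPull R k (angleDeriv n R a f) := by
  rcases a with a | a
  · simp [angleDeriv]
  · exact deriv_shiftPull k _ f

/-- The point with action coordinates `x` and angle coordinates `θ`. -/
def fibrePt (x θ : Fin n → ℝ) : Pt n := Sum.elim x θ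

theorem fibrePt_mem {R : ℝ} {p : Pt n} (hp : p ∈ dom n R) (θ : Fin n → ℝ) :
    fibrePt (fun i => p (Sum.inl i)) θ ∈ dom n R := by
  simpa [dom, fibrePt] using hp

theorem hasFDerivAt_fibrePt (x θ : Fin n → ℝ) :
    HasFDerivAt (fibrePt x) (ContinuousLinearMap.pi (R := ℝ) (φ := fun _ : Coord n => ℝ)
      (Sum.elim (fun _ => 0) fun i => ContinuousLinearMap.proj i)) θ := by
  rw [hasFDerivAt_pi]
  rintro (i | i)
  · exact hasFDerivAt_const _ _
  · exact hasFDerivAt_apply i θ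

theorem contDiff_fibrePt (x : Fin n → ℝ) : ContDiff ℝ ∞ (fibrePt x) := by
  rw [contDiff_pi]
  rintro (i | i)
  · exact contDiff_const
  · exact contDiff_apply ℝ ℝ i

variable {R : ℝ} {p : Pt n}

/-- The restriction of a smooth function to the fibre through `p`. -/
def fibreFun (p : Pt n) (f : SmoothFun (domOpens n R)) (θ : Fin n → ℝ) : ℝ :=
  f.ext (fibrePt (fun i => p (Sum.inl i)) θ)

theorem contDiff_fibreFun (hp : p ∈ dom n R) (f : SmoothFun (domOpens n R)) :
    ContDiff ℝ ∞ (fibreFun p f) := by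
  rw [← contDiffOn_univ]
  exact f.contDiffOn_ext.comp (contDiff_fibrePt _).contDiffOn fun θ _ => fibrePt_mem hp θ

theorem fderiv_fibreFun (hp : p ∈ dom n R) (f : SmoothFun (domOpens n R)) (θ : Fin n → ℝ)
    (i : Fin n) : fderiv ℝ (fibreFun p f) θ (Pi.single i 1) =
      fibreFun p (angleDeriv n R (Sum.inr i) f) θ := by
  have h1 := (f.differentiableAt_ext (mem_domOpens.2 (fibrePt_mem hp θ))).hasFDerivAt
  have h2 := (h1.comp θ (hasFDerivAt_fibrePt _ θ)).fderiv
  change fderiv ℝ (f.ext ∘ fibrePt fun i => p (Sum.inl i)) θ _ = _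
  rw [h2]
  change _ = (SmoothFun.deriv (Pi.single (Sum.inr i) 1) f).ext _
  rw [SmoothFun.deriv_ext _ _ (mem_domOpens.2 (fibrePt_mem hp θ))]
  rw [ContinuousLinearMap.comp_apply]
  congr 1
  funext a
  rcases a with a | a
  · simp
  · simp [Pi.single_apply]

theorem fibreFun_add_single (hp : p ∈ dom n R) {f : SmoothFun (domOpens n R)}
    (hf : ∀ k, shiftPull R k f = f) (θ : Fin n → ℝ) (i : Fin n) :
    fibreFun p f (θ + Pi.single i 1) = fibreFun p f θ := by
  have := congrArg (fun g => fibreFun p g θ) (hf (Pi.single i 1))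
  simp only [fibreFun] at this ⊢
  rw [shiftPull_ext _ _ (fibrePt_mem hp θ)] at this
  rw [← this]
  congr 1
  funext a
  rcases a with a | a
  · simp [fibrePt, shift]
  · by_cases h : a = i
    · subst h; simp [fibrePt, shift]
    · simp [fibrePt, shift, h]

theorem fibreFun_const (hp : p ∈ dom n R) {f : SmoothFun (domOpens n R)}
    (hf : ∀ i θ, fibreFun p (angleDeriv n R (Sum.inr i) f) θ = 0) (θ θ' : Fin n → ℝ) :
    fibreFun p f θ = fibreFun p f θ' := by
  refine is_const_of_fderiv_eq_zero (𝕜 := ℝ)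
    ((contDiff_fibreFun hp f).differentiable (by simp)) (fun θ => ?_) θ θ'
  refine ContinuousLinearMap.coe_injective (LinearMap.pi_ext' fun i => ?_)
  ext
  simp only [LinearMap.comp_apply, LinearMap.single_apply, ContinuousLinearMap.coe_coe,
    fderiv_fibreFun hp, hf]
  rfl

/-- Nonnegative Ricci curvature along a fibre forces `Q` to be constant along it. -/
theorem IsCollapsed.fibre_const {P Q h : Matrix (Fin n) (Fin n) (SmoothFun (domOpens n R))}
    (H : IsCollapsed (angleDeriv n R) P Q h) (hper : ∀ k i j, shiftPull R k (Q i j) = Q i j)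
    (hp : p ∈ dom n R) (hpos : ∀ θ, (Matrix.of fun i j => fibreFun p (Q i j) θ).PosDef)
    (hric : ∀ θ v, 0 ≤ v ⬝ᵥ (Matrix.of fun a b => fibreFun p (ricAlg (angleDeriv n R)
      (metricBlock P Q h) (metricBlockInv P Q h) (Sum.inl a) (Sum.inl b)) θ) *ᵥ v)
    (i j : Fin n) (θ θ' : Fin n → ℝ) : fibreFun p (Q i j) θ = fibreFun p (Q i j) θ' := by
  have hev : ∀ θ f, fibreFun p f θ =
      SmoothFun.eval _ (mem_domOpens.2 (fibrePt_mem hp θ)) f := fun θ f =>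
    (SmoothFun.eval_eq _ _ f).symm
  have hperh : ∀ k i j, shiftPull R k (h i j) = h i j := by
    intro k
    have e0 : Q.map (shiftPull R k) = Q := by ext i j; exact hper k i j
    have e1 : Q * h.map (shiftPull R k) = 1 := by
      rw [← e0, ← Matrix.map_mul, H.mul_inv]
      exact Matrix.map_one _ (map_zero _) (map_one _)
    have e2 : h.map (shiftPull R k) = h := by
      calc h.map (shiftPull R k) = (h * Q) * h.map (shiftPull R k) := by rw [H.inv_mul, one_mul]
        _ = h := by rw [mul_assoc, e1, mul_one]
    intro i j
    exact congrFun (congrFun e2 i) j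
  have hperZ : ∀ c k m, shiftPull R m (fluxField (angleDeriv n R) Q h c k) =
      fluxField (angleDeriv n R) Q h c k := by
    intro c k m
    simp only [fluxField, map_add, map_sub, map_mul, map_sum, ← angleDeriv_shiftPull, hper, hperh]
    split_ifs
    · simp only [map_sum, map_mul, ← angleDeriv_shiftPull, hper, hperh]
    · rw [map_zero]
  refine fibreFun_const hp (fun c θ => ?_) θ θ'
  set S : SmoothFun (domOpens n R) := ∑ k, angleDeriv n R (Sum.inr k)
    (∑ m, angleDeriv n R (Sum.inr m) (h m k)) with hS
  -- Contracting the nonnegative action block of the Ricci tensor with Q gives −S/2 ≥ 0.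
  have hS0 : ∀ θ, fibreFun p S θ ≤ 0 := by
    intro θ
    have h1 := sum_mul_nonneg (hpos θ).posSemidef (hric θ)
    have h2 := congrArg (fun f => fibreFun p f θ) H.sum_mul_ricAlg
    simp only [hev, map_sum, map_mul, map_neg, map_smul, Matrix.of_apply, smul_eq_mul] at h1 h2
    rw [h2] at h1
    rw [hev, hS]
    simp only [map_sum]
    linarith
  set Qθ : (Fin n → ℝ) → Matrix (Fin n) (Fin n) ℝ := fun θ =>
    Matrix.of fun i j => fibreFun p (Q i j) θ with hQθ
  set hθ : (Fin n → ℝ) → Matrix (Fin n) (Fin n) ℝ := fun θ =>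
    Matrix.of fun i j => fibreFun p (h i j) θ with hhθ
  set X : (Fin n → ℝ) → Matrix (Fin n) (Fin n) ℝ := fun θ =>
    Matrix.of fun i j => fibreFun p (angleDeriv n R (Sum.inr c) (Q i j)) θ with hX
  have hQh : ∀ θ, Qθ θ * hθ θ = 1 := by
    intro θ
    have := congrArg (fun M : Matrix (Fin n) (Fin n) (SmoothFun (domOpens n R)) =>
      M.map (SmoothFun.eval _ (mem_domOpens.2 (fibrePt_mem hp θ)))) H.mul_inv
    simp only [Matrix.map_mul] at this
    rw [Matrix.map_one _ (map_zero _) (map_one _)] at this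
    rw [← this]
    congr 1 <;> (ext i j; simp [hQθ, hhθ, hev])
  have hhpos : ∀ θ, (hθ θ).PosSemidef := by
    intro θ
    have : hθ θ = (Qθ θ)⁻¹ := (Matrix.inv_eq_right_inv (hQh θ)).symm
    rw [this]
    exact (hpos θ).inv.posSemidef
  have hXsymm : ∀ θ, (X θ).IsSymm := fun θ => Matrix.IsSymm.ext fun i j => by
    simp only [hX, Matrix.of_apply, H.symmQ.apply]
  have hdiv : ∀ θ, ∑ k, fderiv ℝ (fibreFun p (fluxField (angleDeriv n R) Q h c k)) θ
      (Pi.single k 1) = fibreFun p S θ * Qθ θ c c - (hθ θ * X θ * hθ θ * X θ).trace := by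
    intro θ
    have h1 := congrArg (fun f => fibreFun p f θ) (H.sum_deriv_fluxField c)
    simp only [fderiv_fibreFun hp]
    rw [← hS] at h1
    simp only [hev, map_sum, map_sub, map_mul] at h1 ⊢
    rw [h1]
    simp only [hQθ, hhθ, hX, Matrix.of_apply, hev, Matrix.trace, Matrix.diag, Matrix.mul_apply,
      Matrix.map_apply, map_sum, map_mul]
  have hle : ∀ θ, fibreFun p S θ * Qθ θ c c ≤ 0 := fun θ =>
    mul_nonpos_of_nonpos_of_nonneg (hS0 θ) (hpos θ).posSemidef.diag_nonneg
  have htr : ∀ θ, 0 ≤ (hθ θ * X θ * hθ θ * X θ).trace := fun θ =>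
    trace_mul_mul_mul_nonneg (hhpos θ) (hXsymm θ)
  -- The divergence is S·Q_{cc} − tr(h X h X) with X = ∂_cQ, a sum of two nonpositive terms. It
  -- vanishes at every point, hence so does each term.
  have hz := divergence_eq_zero_of_nonpos
    (Z := fun k => fibreFun p (fluxField (angleDeriv n R) Q h c k))
    (fun k => (contDiff_fibreFun hp _).of_le (by simp))
    (fun k θ => fibreFun_add_single hp (hperZ c k) θ k)
    (fun θ => by rw [hdiv]; linarith [hle θ, htr θ]) θ
  rw [hdiv] at hz
  have hX0 := eq_zero_of_trace_mul_mul_mul (hhpos θ) (hQh θ) (hXsymm θ)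
    (by linarith [hle θ, htr θ])
  exact congrFun (congrFun hX0 i) j

end Fibre

end ActionAngle

end

/-! ### Lagrangian graphs and compatible complex structures at a point -/

noncomputable section

namespace ActionAngle

open Matrix

variable {n : ℕ}

/-- The vector `∂/∂θ^i + ∑_j A_{ij} ∂/∂x_j`. -/
def graphVec (A : Matrix (Fin n) (Fin n) ℂ) (i : Fin n) : CVec n :=
  Sum.elim (fun j => A i j) (Pi.single i 1)

theorem graphVec_mem (A : Matrix (Fin n) (Fin n) ℂ) (i : Fin n) : graphVec A i ∈ graphPol A :=
  Submodule.subset_span ⟨i, rfl⟩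

theorem eq_sum_graphVec_of_forall {A : Matrix (Fin n) (Fin n) ℂ} {w : CVec n}
    (h : ∀ j, w (Sum.inl j) = ∑ i, w (Sum.inr i) * A i j) :
    w = ∑ i, w (Sum.inr i) • graphVec A i := by
  funext a
  rcases a with j | j
  · simp [graphVec, h]
  · simp [graphVec, Pi.single_apply]

theorem mem_graphPol {A : Matrix (Fin n) (Fin n) ℂ} {w : CVec n} :
    w ∈ graphPol A ↔ ∀ j, w (Sum.inl j) = ∑ i, w (Sum.inr i) * A i j := by
  constructor
  · intro hw
    refine Submodule.span_induction (p := fun w _ => ∀ j, w (Sum.inl j) =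
      ∑ i, w (Sum.inr i) * A i j) ?_ ?_ ?_ ?_ hw
    · rintro _ ⟨i, rfl⟩ j
      simp [Pi.single_apply]
    · simp
    · intro x y _ _ hx hy j
      simp [hx, hy, add_mul, Finset.sum_add_distrib]
    · intro c x _ hx j
      simp [hx, Finset.mul_sum, mul_assoc]
  · intro h
    rw [eq_sum_graphVec_of_forall h]
    exact Submodule.sum_mem _ fun i _ => Submodule.smul_mem _ _ (graphVec_mem A i)

/-- The angle parts of the spanning vectors form the standard basis, so the matrix can be read off.
Through this uniqueness the matrix inherits smoothness and periodicity from the subspaces. -/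
theorem graphPol_injective : Function.Injective (graphPol (n := n)) := by
  intro A B h
  ext i j
  have h1 := graphVec_mem A i
  rw [h, mem_graphPol] at h1
  simpa [graphVec, Pi.single_apply] using h1 j

theorem realPol_eq_graphPol : realPol n = graphPol 0 := by
  ext w
  rw [mem_graphPol]
  simp only [Matrix.zero_apply, mul_zero, Finset.sum_const_zero]
  rfl

theorem isSymm_of_isLagrangian {A : Matrix (Fin n) (Fin n) ℂ} (h : IsLagrangian (graphPol A)) :
    A.IsSymm := by
  refine Matrix.IsSymm.ext fun i j => ?_
  have := h.2 _ (graphVec_mem A i) _ (graphVec_mem A j)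
  simp [omega, Omega, graphVec, dotProduct, mulVec, Matrix.one_apply, Pi.single_apply,
    Fintype.sum_sum_type] at this
  linear_combination -this

/-- A space of vectors transversal to the `∂/∂x_i` is the graph of a matrix, computed from a
frame. -/
theorem eq_graphPol_of_frame {W : Submodule ℂ (CVec n)} {w : Fin n → CVec n}
    (hli : LinearIndependent ℂ w) (hspan : Submodule.span ℂ (Set.range w) = W)
    (htr : ∀ u ∈ W, (∀ i, u (Sum.inr i) = 0) → u = 0) :
    (Matrix.of fun i k => w i (Sum.inr k)).det ≠ 0 ∧
      W = graphPol ((Matrix.of fun i k => w i (Sum.inr k))⁻¹ *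
        Matrix.of fun i j => w i (Sum.inl j)) := by
  set Θ : Matrix (Fin n) (Fin n) ℂ := Matrix.of fun i k => w i (Sum.inr k) with hΘ
  set X : Matrix (Fin n) (Fin n) ℂ := Matrix.of fun i j => w i (Sum.inl j) with hX
  -- A linear relation among the rows of Θ yields a vector of W without angle part, which is zero by
  -- transversality; independence of the frame then makes the relation trivial.
  have hdet : Θ.det ≠ 0 := by
    intro h0
    obtain ⟨v, hv, hv0⟩ := Matrix.exists_vecMul_eq_zero_iff.2 h0
    have h1 : ∑ i, v i • w i = 0 := by
      refine htr _ ?_ fun k => ?_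
      · rw [← hspan]
        exact Submodule.sum_mem _ fun i _ =>
          Submodule.smul_mem _ _ (Submodule.subset_span ⟨i, rfl⟩)
      · have := congrFun hv0 k
        simpa [vecMul, dotProduct, hΘ] using this
    exact hv (funext fun i => Fintype.linearIndependent_iff.1 hli v h1 i)
  refine ⟨hdet, ?_⟩
  have hu : IsUnit Θ.det := hdet.isUnit
  have hΘA : Θ * (Θ⁻¹ * X) = X := by rw [← mul_assoc, Matrix.mul_nonsing_inv _ hu, one_mul]
  apply le_antisymm
  · rw [← hspan, Submodule.span_le]
    rintro _ ⟨i, rfl⟩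
    rw [SetLike.mem_coe, mem_graphPol]
    intro j
    have := congrFun (congrFun hΘA i) j
    rw [mul_apply] at this
    exact this.symm
  · rw [graphPol, Submodule.span_le]
    rintro _ ⟨i, rfl⟩
    have : graphVec (Θ⁻¹ * X) i = ∑ k, Θ⁻¹ i k • w k := by
      funext a
      rcases a with j | j
      · simp [graphVec, mul_apply, hX]
      · have := congrFun (congrFun (Matrix.nonsing_inv_mul _ hu) i) j
        rw [mul_apply] at this
        simpa [graphVec, hΘ, Matrix.one_apply, Pi.single_apply, eq_comm] using this.symm
    change graphVec (Θ⁻¹ * X) i ∈ W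
    rw [this, ← hspan]
    exact Submodule.sum_mem _ fun k _ =>
      Submodule.smul_mem _ _ (Submodule.subset_span ⟨k, rfl⟩)

section ComplexStructure

variable {R : ℝ} {J : Pt n → Matrix (Coord n) (Coord n) ℝ} {p : Pt n}

theorem metric_eq (J : Pt n → Matrix (Coord n) (Coord n) ℝ) (p : Pt n) :
    metric J p = Matrix.fromBlocks (J p).toBlocks₂₁ (J p).toBlocks₂₂
      (-(J p).toBlocks₁₁) (-(J p).toBlocks₁₂) := by
  ext a b
  rcases a with a | a <;> rcases b with b | b <;>
  simp [metric, omega, Omega, dotProduct, mulVec, Fintype.sum_sum_type, Matrix.one_apply,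
    Pi.single_apply, toBlocks₁₁, toBlocks₁₂, toBlocks₂₁, toBlocks₂₂]

theorem omega_mulVec_eq (J : Pt n → Matrix (Coord n) (Coord n) ℝ) (p u : Pt n) :
    omega u ((J p).mulVec u) = u ⬝ᵥ metric J p *ᵥ u := by
  have : metric J p = Omega n ℝ * J p := by
    rw [metric_eq, Omega, ← fromBlocks_toBlocks (J p), fromBlocks_multiply]
    simp
  rw [this, omega, mulVec_mulVec]

/-- This block is the restriction of g_J to the directions ∂/∂x_i. Its positivity makes T^{1,0} a
graph over the angle directions and the imaginary part of the graph matrix positive. -/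
theorem dotProduct_toBlocks₂₁_pos (hJ : IsCompatibleComplexStructure R J) (hp : p ∈ dom n R)
    {x : Fin n → ℝ} (hx : x ≠ 0) : 0 < x ⬝ᵥ (J p).toBlocks₂₁ *ᵥ x := by
  have h1 := hJ.positive p hp (Sum.elim x 0) (fun h => hx (funext fun i => congrFun h (Sum.inl i)))
  rw [omega_mulVec_eq, metric_eq] at h1
  simpa [fromBlocks_mulVec] using h1

/-- For u in the span of the ∂/∂x_i, the angle part of Ju = iu reads J₂₁u = 0. The block is real, so
it kills the real and imaginary parts of u separately, and definiteness applies to each. -/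
theorem kahlerPol_transversal (hJ : IsCompatibleComplexStructure R J) (hp : p ∈ dom n R)
    {u : CVec n} (hu : u ∈ kahlerPol J p) (h0 : ∀ i, u (Sum.inr i) = 0) : u = 0 := by
  rw [kahlerPol, Module.End.mem_eigenspace_iff, Matrix.toLin'_apply] at hu
  have h1 : ∀ k, ∑ j, ((J p) (Sum.inr k) (Sum.inl j) : ℂ) * u (Sum.inl j) = 0 := by
    intro k
    have := congrFun hu (Sum.inr k)
    simpa [mulVec, dotProduct, Fintype.sum_sum_type, h0] using this
  have key : ∀ x : Fin n → ℝ, (∀ k, ∑ j, (J p) (Sum.inr k) (Sum.inl j) * x j = 0) → x = 0 := by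
    intro x hx
    by_contra hne
    have h2 := dotProduct_toBlocks₂₁_pos hJ hp hne
    have h3 : (J p).toBlocks₂₁ *ᵥ x = 0 := funext fun k => by
      simpa [mulVec, dotProduct, toBlocks₂₁] using hx k
    rw [h3, dotProduct_zero] at h2
    exact lt_irrefl _ h2
  have hre := key (fun j => (u (Sum.inl j)).re) fun k => by
    have := congrArg Complex.re (h1 k)
    simpa using this
  have him := key (fun j => (u (Sum.inl j)).im) fun k => by
    have := congrArg Complex.im (h1 k)
    simpa using this
  funext a
  rcases a with a | a
  · exact Complex.ext (congrFun hre a) (congrFun him a)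
  · exact h0 a

variable {A : Matrix (Fin n) (Fin n) ℂ}

/-- The blocks of `J` in terms of the graph matrix `A = P + iQ` of its `i`-eigenspace. -/
theorem blocks_of_kahlerPol_eq (h : kahlerPol J p = graphPol A) (hA : A.IsSymm) :
    (J p).toBlocks₂₁ * A.map Complex.im = 1 ∧ (J p).toBlocks₁₁ * A.map Complex.im = A.map Complex.re ∧
    (J p).toBlocks₂₂ = -((J p).toBlocks₂₁ * A.map Complex.re) ∧
    (J p).toBlocks₁₂ = -(A.map Complex.im + (J p).toBlocks₁₁ * A.map Complex.re) := by
  -- This is Jv = iv for the spanning vectors of the graph. The four identities are the real and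
  -- imaginary parts of its action and angle components.
  have key : ∀ i a, ∑ j, ((J p) a (Sum.inl j) : ℂ) * A i j + (J p) a (Sum.inr i)
      = Complex.I * graphVec A i a := by
    intro i a
    have h1 := graphVec_mem A i
    rw [← h, kahlerPol, Module.End.mem_eigenspace_iff, Matrix.toLin'_apply] at h1
    have h2 := congrFun h1 a
    simpa [mulVec, dotProduct, Fintype.sum_sum_type, graphVec, Pi.single_apply] using h2
  have hs : ∀ i j, A i j = A j i := fun i j => hA.apply j i
  refine ⟨?_, ?_, ?_, ?_⟩
  · ext k i
    have := congrArg Complex.im (key i (Sum.inr k))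
    simp [graphVec, Pi.single_apply] at this
    simp only [mul_apply, toBlocks₂₁, Matrix.of_apply, Matrix.map_apply, Matrix.one_apply]
    rw [Finset.sum_congr rfl fun j _ => by rw [hs j i], this]
    split_ifs <;> simp
  · ext k i
    have := congrArg Complex.im (key i (Sum.inl k))
    simp [graphVec] at this
    simp only [mul_apply, toBlocks₁₁, Matrix.of_apply, Matrix.map_apply]
    rw [Finset.sum_congr rfl fun j _ => by rw [hs j i], this, hs]
  · ext k i
    have := congrArg Complex.re (key i (Sum.inr k))
    simp [graphVec, Pi.single_apply] at this
    simp only [mul_apply, toBlocks₂₁, toBlocks₂₂, Matrix.of_apply, Matrix.map_apply,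
      Matrix.neg_apply]
    rw [Finset.sum_congr rfl fun j _ => by rw [hs j i]]
    have h0 : (if k = i then Complex.I else 0).re = 0 := by split_ifs <;> simp
    linarith
  · ext k i
    have := congrArg Complex.re (key i (Sum.inl k))
    simp [graphVec] at this
    simp only [mul_apply, toBlocks₁₁, toBlocks₁₂, Matrix.of_apply, Matrix.map_apply,
      Matrix.neg_apply, Matrix.add_apply]
    rw [Finset.sum_congr rfl fun j _ => by rw [hs j i], hs k i]
    linarith

theorem metric_eq_metricBlock (h : kahlerPol J p = graphPol A) (hA : A.IsSymm) :
    metric J p = metricBlock (A.map Complex.re) (A.map Complex.im) (J p).toBlocks₂₁ := by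
  obtain ⟨h1, h2, h3, h4⟩ := blocks_of_kahlerPol_eq h hA
  have h5 : (J p).toBlocks₁₁ = A.map Complex.re * (J p).toBlocks₂₁ := by
    rw [← h2, mul_assoc, mul_eq_one_comm.1 h1, mul_one]
  rw [metric_eq, metricBlock, h3, h4, h5, neg_neg]

/-- Im A is the inverse of the block J₂₁, so its quadratic form at x is that of J₂₁ at (Im A)x. -/
theorem posDef_im (hJ : IsCompatibleComplexStructure R J) (hp : p ∈ dom n R)
    (h : kahlerPol J p = graphPol A) (hA : A.IsSymm) : (A.map Complex.im).PosDef := by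
  obtain ⟨h1, -, -, -⟩ := blocks_of_kahlerPol_eq h hA
  have hsymm : (A.map Complex.im).IsSymm := by
    refine Matrix.IsSymm.ext fun i j => ?_
    simp [hA.apply i j]
  have h2 := mul_eq_one_comm.1 h1
  refine Matrix.PosDef.of_dotProduct_mulVec_pos ?_ fun x hx => ?_
  · rw [Matrix.IsHermitian, conjTranspose_eq_transpose_of_trivial, hsymm.eq]
  · have hy : A.map Complex.im *ᵥ x ≠ 0 := by
      intro h0
      apply hx
      rw [← one_mulVec x, ← h1, ← mulVec_mulVec, h0, mulVec_zero]
    have := dotProduct_toBlocks₂₁_pos hJ hp hy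
    rw [mulVec_mulVec, h1, one_mulVec, dotProduct_comm] at this
    simpa using this

end ComplexStructure

/-- `metricBlock P Q Q⁻¹` is positive definite if `Q` is. -/
theorem metricBlock_pos {P Q h : Matrix (Fin n) (Fin n) ℝ} (hP : P.IsSymm) (hQ : Q.PosDef)
    (hQh : Q * h = 1) {v : Coord n → ℝ} (hv : v ≠ 0) : 0 < v ⬝ᵥ metricBlock P Q h *ᵥ v := by
  have hh : h.PosDef := by
    rw [← Matrix.inv_eq_right_inv hQh]; exact hQ.inv
  set x : Fin n → ℝ := fun i => v (Sum.inl i)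
  set θ : Fin n → ℝ := fun i => v (Sum.inr i)
  have hv' : v = Sum.elim x θ := by ext (i | i) <;> rfl
  -- Completing the square in the action components.
  have hexp : v ⬝ᵥ metricBlock P Q h *ᵥ v =
      (x - P *ᵥ θ) ⬝ᵥ h *ᵥ (x - P *ᵥ θ) + θ ⬝ᵥ Q *ᵥ θ := by
    have e : ∀ u, (P *ᵥ θ) ⬝ᵥ u = θ ⬝ᵥ P *ᵥ u := fun u => by
      rw [dotProduct_mulVec θ, ← mulVec_transpose, hP.eq]
    rw [hv', metricBlock, fromBlocks_mulVec, sumElim_dotProduct_sumElim]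
    simp only [Matrix.neg_mulVec, add_mulVec, mulVec_sub, sub_dotProduct, dotProduct_sub,
      dotProduct_add, dotProduct_neg, e, ← mulVec_mulVec, Sum.elim_comp_inl, Sum.elim_comp_inr]
    ring
  have hQn : ∀ y, 0 ≤ y ⬝ᵥ Q *ᵥ y := fun y => by
    simpa using hQ.posSemidef.dotProduct_mulVec_nonneg y
  have hhn : ∀ y, 0 ≤ y ⬝ᵥ h *ᵥ y := fun y => by
    simpa using hh.posSemidef.dotProduct_mulVec_nonneg y
  rw [hexp]
  by_cases hθ : θ = 0
  · have hx : x ≠ 0 := by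
      intro hx
      apply hv
      rw [hv', hx, hθ]
      ext (i | i) <;> rfl
    have := hh.dotProduct_mulVec_pos hx
    rw [hθ]
    simpa using this
  · have := hQ.dotProduct_mulVec_pos hθ
    have h2 := hhn (x - P *ᵥ θ)
    simp only [star_trivial] at this
    linarith

end ActionAngle

end

/-! ### Smooth graph matrices and the substitution s = t² -/

noncomputable section

namespace ActionAngle

open Matrix TopologicalSpace

variable {n : ℕ}

theorem contDiffOn_det {E : Type} [NormedAddCommGroup E] [NormedSpace ℝ E] {S : Set E}
    {M : E → Matrix (Fin n) (Fin n) ℂ} (hM : ∀ i j, ContDiffOn ℝ ∞ (fun z => M z i j) S) :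
    ContDiffOn ℝ ∞ (fun z => (M z).det) S := by
  simp only [Matrix.det_apply']
  refine ContDiffOn.sum fun σ _ => ?_
  exact contDiffOn_const.mul (contDiffOn_prod fun i _ => hM _ _)

theorem contDiffOn_inv {E : Type} [NormedAddCommGroup E] [NormedSpace ℝ E] {S : Set E}
    {M : E → Matrix (Fin n) (Fin n) ℂ} (hM : ∀ i j, ContDiffOn ℝ ∞ (fun z => M z i j) S)
    (hdet : ∀ z ∈ S, (M z).det ≠ 0) (i j : Fin n) :
    ContDiffOn ℝ ∞ (fun z => (M z)⁻¹ i j) S := by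
  simp only [Matrix.inv_def, Matrix.smul_apply, smul_eq_mul, Ring.inverse_eq_inv',
    Matrix.adjugate_apply]
  refine ((contDiffOn_det hM).inv hdet).mul (contDiffOn_det fun k l => ?_)
  by_cases h : k = j
  · subst h
    simp only [Matrix.updateRow_self]
    exact contDiffOn_const
  · simp only [Matrix.updateRow_ne h]
    exact hM k l

variable {R δ : ℝ} {J : ℝ → Pt n → Matrix (Coord n) (Coord n) ℝ}
  {A₀ : Pt n → Matrix (Fin n) (Fin n) ℂ}

/-- Under `♠`, the polarizations are graphs of a smooth family of symmetric matrices. -/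
theorem exists_smooth_graph (hδ : 0 < δ)
    (hJ : ∀ s ∈ Set.Ioo 0 δ, IsCompatibleComplexStructure R (J s)) (hS : Spade R δ J A₀) :
    ∃ A : ℝ → Pt n → Matrix (Fin n) (Fin n) ℂ,
      (∀ i j, ContDiffOn ℝ ∞ (fun z : ℝ × Pt n => A z.1 z.2 i j) (Set.Ico 0 δ ×ˢ dom n R)) ∧
      (∀ s ∈ Set.Ioo 0 δ, ∀ p ∈ dom n R, kahlerPol (J s) p = graphPol (A s p)) ∧
      (∀ p ∈ dom n R, A 0 p = 0) ∧
      (∀ s ∈ Set.Ico 0 δ, ∀ p ∈ dom n R, (A s p).IsSymm) ∧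
      ∀ p ∈ dom n R, ∀ i j,
        HasDerivWithinAt (fun s => A s p i j) (A₀ p i j) (Set.Ici 0) 0 := by
  classical
  obtain ⟨P, hP, hPs, hP0, hPd⟩ := hS
  have htr : ∀ z ∈ Set.Ico 0 δ ×ˢ dom n R, ∀ u ∈ P z.1 z.2, (∀ i, u (Sum.inr i) = 0) → u = 0 := by
    rintro ⟨s, p⟩ ⟨hs, hp⟩ u hu h0
    simp only at hs hp hu
    rcases eq_or_lt_of_le hs.1 with rfl | hs0
    · rw [hP0 p hp] at hu
      funext a
      rcases a with a | a
      · exact hu a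
      · exact h0 a
    · rw [hPs s ⟨hs0, hs.2⟩ p hp] at hu
      exact kahlerPol_transversal (hJ s ⟨hs0, hs.2⟩) hp hu h0
  have hex : ∀ z ∈ Set.Ico 0 δ ×ˢ dom n R, ∃ A, P z.1 z.2 = graphPol A := by
    intro z hz
    obtain ⟨-, N, hN, w, -, hw2⟩ := hP z hz
    obtain ⟨h1, h2⟩ := hw2 z ⟨mem_of_mem_nhds hN, hz⟩
    exact ⟨_, (eq_graphPol_of_frame h1 h2 (htr z hz)).2⟩
  choose! A hA using hex
  refine ⟨fun s p => A (s, p), ?_, ?_, ?_, ?_, ?_⟩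
  · intro i j z hz
    obtain ⟨-, N, hN, w, hw, hw2⟩ := hP z hz
    set S := N ∩ Set.Ico 0 δ ×ˢ dom n R with hSdef
    have hframe : ∀ y ∈ S, _ := fun y hy =>
      eq_graphPol_of_frame (hw2 y hy).1 (hw2 y hy).2 (htr y hy.2)
    have hcomp : ∀ i a, ContDiffOn ℝ ∞ (fun y => w i y a) S := fun i a =>
      contDiffOn_pi.1 (hw i) a
    have h1 : ContDiffOn ℝ ∞ (fun y => ((Matrix.of fun i k => w i y (Sum.inr k))⁻¹ *
        Matrix.of fun i j => w i y (Sum.inl j)) i j) S := by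
      simp only [mul_apply]
      refine ContDiffOn.sum fun k _ => ContDiffOn.mul ?_ (hcomp k (Sum.inl j))
      exact contDiffOn_inv (fun i k => hcomp i (Sum.inr k)) (fun y hy => (hframe y hy).1) i k
    -- The matrices were chosen pointwise; uniqueness identifies them near z with the ones computed
    -- from a smooth frame.
    have h2 : ContDiffOn ℝ ∞ (fun y : ℝ × Pt n => A (y.1, y.2) i j) S := by
      refine h1.congr fun y hy => ?_
      have := (hA y hy.2).symm.trans (hframe y hy).2
      rw [graphPol_injective this]
    have h3 := h2 z ⟨mem_of_mem_nhds hN, hz⟩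
    rw [hSdef, Set.inter_comm] at h3
    exact (contDiffWithinAt_inter hN).1 h3
  · intro s hs p hp
    rw [← hPs s hs p hp]
    exact hA (s, p) ⟨⟨hs.1.le, hs.2⟩, hp⟩
  · intro p hp
    have := hA (0, p) ⟨⟨le_rfl, hδ⟩, hp⟩
    simp only [hP0 p hp, realPol_eq_graphPol] at this
    exact (graphPol_injective this).symm
  · intro s hs p hp
    have := (hP (s, p) ⟨hs, hp⟩).1
    rw [hA (s, p) ⟨hs, hp⟩] at this
    exact isSymm_of_isLagrangian this
  · intro p hp i j
    obtain ⟨⟨B, hB, hBd⟩, -, -⟩ := hPd p hp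
    have hev : ∀ᶠ s in 𝓝[≥] (0 : ℝ), A (s, p) = B s := by
      have hlt : ∀ᶠ s in 𝓝[≥] (0 : ℝ), s ∈ Set.Ico 0 δ := Ico_mem_nhdsGE hδ
      filter_upwards [hB, hlt] with s hs hs'
      exact graphPol_injective ((hA (s, p) ⟨hs', hp⟩).symm.trans hs)
    refine (hBd i j).congr_of_eventuallyEq ?_ ?_
    · filter_upwards [hev] with s hs
      rw [hs]
    · exact congrFun (congrFun (hev.self_of_nhdsWithin (Set.mem_Ici.2 le_rfl)) i) j

/-- The open set of parameters `(t, p)`, `t² < δ`, with `s = t²`. -/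
def famOpens (n : ℕ) (R δ : ℝ) : Opens (ℝ × Pt n) :=
  ⟨Set.Ioo (-√δ) (√δ) ×ˢ dom n R, isOpen_Ioo.prod (isOpen_dom n R)⟩

theorem mem_famOpens {z : ℝ × Pt n} :
    z ∈ famOpens n R δ ↔ z.1 ∈ Set.Ioo (-√δ) (√δ) ∧ z.2 ∈ dom n R := Iff.rfl

theorem sq_mem_Ico {t : ℝ} (ht : t ∈ Set.Ioo (-√δ) (√δ)) : t ^ 2 ∈ Set.Ico 0 δ :=
  ⟨sq_nonneg t, by
    have h1 : |t| < √δ := abs_lt.2 ht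
    rw [← sq_abs]
    exact (Real.lt_sqrt (abs_nonneg t)).1 h1⟩

theorem sq_mem_Ioo {t : ℝ} (ht : t ∈ Set.Ioo (-√δ) (√δ)) (h0 : t ≠ 0) : t ^ 2 ∈ Set.Ioo 0 δ :=
  ⟨by positivity, (sq_mem_Ico ht).2⟩

/-- A smooth function of `(s, p)`, `s ≥ 0`, vanishing at `s = 0`, is `t²` times a smooth function
when `s = t²`. -/
theorem exists_div_sq (hδ : 0 < δ) {f : ℝ × Pt n → ℝ}
    (hf : ContDiffOn ℝ ∞ f (Set.Ico 0 δ ×ˢ dom n R)) (h0 : ∀ p ∈ dom n R, f (0, p) = 0)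
    {f' : Pt n → ℝ}
    (hf' : ∀ p ∈ dom n R, HasDerivWithinAt (fun s => f (s, p)) (f' p) (Set.Ici 0) 0) :
    ∃ b : SmoothFun (famOpens n R δ),
      (∀ t ∈ Set.Ioo (-√δ) (√δ), ∀ p ∈ dom n R, f (t ^ 2, p) = t ^ 2 * b.ext (t, p)) ∧
      ∀ p ∈ dom n R, b.ext (0, p) = f' p := by
  have hδ' : 0 < √δ := Real.sqrt_pos.2 hδ
  -- Composition with s = t² turns smoothness up to the boundary s = 0 into smoothness on an open
  -- set around t = 0, and the result is even in t.
  have h1 : ContDiffOn ℝ ∞ (fun z : ℝ × Pt n => f (z.1 ^ 2, z.2))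
      (Set.Ioo (-√δ) (√δ) ×ˢ dom n R) :=
    hf.comp (t := Set.Ico 0 δ ×ˢ dom n R) (f := fun z : ℝ × Pt n => (z.1 ^ 2, z.2))
      (ContDiff.contDiffOn (by fun_prop)) fun z hz => ⟨sq_mem_Ico hz.1, hz.2⟩
  obtain ⟨g, hg, hfg⟩ := exists_eq_sq_mul_of_even hδ' (isOpen_dom n R) h1
    (fun p hp => by simpa using h0 p hp) (fun t _ p _ => by simp)
  have hg' : ContDiffOn ℝ ∞ g (famOpens n R δ : Set (ℝ × Pt n)) := hg
  have hm : ∀ t ∈ Set.Ioo (-√δ) (√δ), ∀ p ∈ dom n R, (t, p) ∈ famOpens n R δ :=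
    fun t ht p hp => ⟨ht, hp⟩
  refine ⟨SmoothFun.ofFun g hg', fun t ht p hp => ?_, fun p hp => ?_⟩
  · rw [SmoothFun.ofFun_ext _ _ (hm t ht p hp)]
    exact hfg (t, p) ⟨ht, hp⟩
  · have hmem : (0 : ℝ) ∈ Set.Ioo (-√δ) (√δ) := ⟨by linarith, hδ'⟩
    rw [SmoothFun.ofFun_ext _ _ (hm 0 hmem p hp)]
    have hc : Filter.Tendsto (fun t => g (t, p)) (𝓝[≠] 0) (𝓝 (g (0, p))) := by
      have : ContinuousAt (fun t => g (t, p)) 0 :=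
        (hg.continuousOn.comp (f := fun t : ℝ => (t, p)) (Continuous.continuousOn (by fun_prop))
          fun t ht => ⟨ht, hp⟩).continuousAt (isOpen_Ioo.mem_nhds hmem)
      exact this.tendsto.mono_left nhdsWithin_le_nhds
    -- For t ≠ 0, g(t, p) is the difference quotient of f(·, p) at s = t², so its limit is the
    -- one-sided derivative.
    have hd := hasDerivWithinAt_iff_tendsto_slope.1 (hf' p hp)
    have hsq : Filter.Tendsto (fun t : ℝ => t ^ 2) (𝓝[≠] 0) (𝓝[Set.Ici 0 \ {0}] 0) := by
      refine tendsto_nhdsWithin_iff.2 ⟨?_, ?_⟩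
      · have : Filter.Tendsto (fun t : ℝ => t ^ 2) (𝓝 0) (𝓝 (0 ^ 2)) :=
          (continuous_pow 2).tendsto 0
        simpa using this.mono_left nhdsWithin_le_nhds
      · filter_upwards [self_mem_nhdsWithin] with t ht
        exact ⟨sq_nonneg t, pow_ne_zero 2 ht⟩
    refine tendsto_nhds_unique hc ((hd.comp hsq).congr' ?_)
    filter_upwards [self_mem_nhdsWithin, nhdsWithin_le_nhds (isOpen_Ioo.mem_nhds hmem)]
      with t ht htm
    have ht0 : t ≠ 0 := ht
    simp only [Function.comp_apply, slope_def_field, h0 p hp, sub_zero]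
    rw [hfg (t, p) ⟨htm, hp⟩]
    field_simp

end ActionAngle

end

/-! ### Integrability of `J` as equations for the graph matrix -/

noncomputable section

namespace ActionAngle

open Matrix TopologicalSpace

variable {n : ℕ} {R : ℝ}

section Bracket

/-- The vector field on the coordinate space with the given smooth components. -/
def extField (V : Coord n → SmoothFun (domOpens n R)) (q : Pt n) : Pt n := fun a => (V a).ext q

/-- The components of the Lie bracket of two vector fields. -/
def bracket (V W : Coord n → SmoothFun (domOpens n R)) (l : Coord n) : SmoothFun (domOpens n R) :=
  ∑ a, (V a * coordDeriv n R a (W l) - W a * coordDeriv n R a (V l))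

theorem contDiffOn_extField (V : Coord n → SmoothFun (domOpens n R)) :
    ContDiffOn ℝ ∞ (extField V) (dom n R) :=
  contDiffOn_pi.2 fun a => (V a).contDiffOn_ext

theorem fderiv_extField (W : Coord n → SmoothFun (domOpens n R)) {p : Pt n} (hp : p ∈ dom n R)
    (v : Pt n) (l : Coord n) :
    fderiv ℝ (extField W) p v l = ∑ a, v a * (coordDeriv n R a (W l)).ext p := by
  have h1 : HasFDerivAt (extField W) (ContinuousLinearMap.pi fun l => fderiv ℝ (W l).ext p) p :=
    hasFDerivAt_pi.2 fun l => ((W l).differentiableAt_ext (mem_domOpens.2 hp)).hasFDerivAt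
  rw [h1.fderiv]
  change fderiv ℝ (W l).ext p v = _
  conv_lhs => rw [pi_eq_sum_univ' v]
  rw [map_sum]
  refine Finset.sum_congr rfl fun a _ => ?_
  rw [map_smul, smul_eq_mul, coordDeriv, SmoothFun.deriv_ext _ _ (mem_domOpens.2 hp)]

theorem lieBracket_extField (V W : Coord n → SmoothFun (domOpens n R)) {p : Pt n}
    (hp : p ∈ dom n R) :
    VectorField.lieBracket ℝ (extField V) (extField W) p = extField (bracket V W) p := by
  funext l
  rw [VectorField.lieBracket, Pi.sub_apply, fderiv_extField W hp, fderiv_extField V hp,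
    ← Finset.sum_sub_distrib]
  simp only [extField, bracket, ← SmoothFun.eval_eq p (mem_domOpens.2 hp), map_sum, map_sub,
    map_mul]

theorem lieBracket_congr {V V' W W' : Pt n → Pt n} (hV : Set.EqOn V V' (dom n R))
    (hW : Set.EqOn W W' (dom n R)) {p : Pt n} (hp : p ∈ dom n R) :
    VectorField.lieBracket ℝ V W p = VectorField.lieBracket ℝ V' W' p :=
  Filter.EventuallyEq.lieBracket_vectorField_eq
    (Filter.eventuallyEq_of_mem ((isOpen_dom n R).mem_nhds hp) hV)
    (Filter.eventuallyEq_of_mem ((isOpen_dom n R).mem_nhds hp) hW)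

/-- The vector field `∂/∂θ^i + ∑_j P_{ij} ∂/∂x_j`. -/
def reField (P : Matrix (Fin n) (Fin n) (SmoothFun (domOpens n R))) (i : Fin n) :
    Coord n → SmoothFun (domOpens n R) :=
  Sum.elim (P i) (fun j => if j = i then 1 else 0)

/-- The vector field `∑_j Q_{ij} ∂/∂x_j`. -/
def imField (Q : Matrix (Fin n) (Fin n) (SmoothFun (domOpens n R))) (i : Fin n) :
    Coord n → SmoothFun (domOpens n R) :=
  Sum.elim (Q i) 0

variable {J : Pt n → Matrix (Coord n) (Coord n) ℝ}
  {P Q : Matrix (Fin n) (Fin n) (SmoothFun (domOpens n R))}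

/-- `P + iQ` is the graph matrix of the `i`-eigenspaces of `J`. -/
def IsGraphOf (J : Pt n → Matrix (Coord n) (Coord n) ℝ)
    (P Q : Matrix (Fin n) (Fin n) (SmoothFun (domOpens n R))) : Prop :=
  ∀ p ∈ dom n R, ∃ A : Matrix (Fin n) (Fin n) ℂ, A.IsSymm ∧ kahlerPol J p =
    graphPol A ∧ (∀ i j, (A i j).re = (P i j).ext p) ∧ ∀ i j, (A i j).im = (Q i j).ext p

theorem bracket_inr_eq_zero {V W : Coord n → SmoothFun (domOpens n R)}
    (hV : ∀ i a, coordDeriv n R a (V (Sum.inr i)) = 0)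
    (hW : ∀ i a, coordDeriv n R a (W (Sum.inr i)) = 0) (i : Fin n) :
    bracket V W (Sum.inr i) = 0 := by
  simp [bracket, hV, hW]

theorem coordDeriv_reField (i j : Fin n) (a : Coord n) :
    coordDeriv n R a (reField P i (Sum.inr j)) = 0 := by
  simp only [reField, Sum.elim_inr]
  split_ifs <;> simp

theorem coordDeriv_imField (i j : Fin n) (a : Coord n) :
    coordDeriv n R a (imField Q i (Sum.inr j)) = 0 := by
  simp [imField]

/-- The integrability of `J` in terms of the graph matrix. -/
theorem bracket_eq_of_integrable (hJ : IsCompatibleComplexStructure R J) (hG : IsGraphOf J P Q)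
    (i k l : Fin n) :
    bracket (reField P i) (reField P k) (Sum.inl l) =
        bracket (imField Q i) (imField Q k) (Sum.inl l) ∧
      bracket (reField P i) (imField Q k) (Sum.inl l) +
        bracket (imField Q i) (reField P k) (Sum.inl l) = 0 := by
  have hsmall : ∀ p ∈ dom n R,
      (extField (bracket (reField P i) (reField P k)) p (Sum.inl l) =
        extField (bracket (imField Q i) (imField Q k)) p (Sum.inl l)) ∧
      extField (bracket (reField P i) (imField Q k)) p (Sum.inl l) +
        extField (bracket (imField Q i) (reField P k)) p (Sum.inl l) = 0 := by
    intro p hp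
    -- The fields Re + i Im span the i-eigenspace, so J Im = Re, and the Nijenhuis tensor of two Im
    -- fields involves only brackets of Re and Im fields.
    have hJf : ∀ i, Set.EqOn (fun q => (J q).mulVec (extField (imField Q i) q))
        (extField (reField P i)) (dom n R) := by
      intro i q hq
      obtain ⟨A, hA, hk, hre, him⟩ := hG q hq
      obtain ⟨h1, h2, -, -⟩ := blocks_of_kahlerPol_eq hk hA
      funext a
      rcases a with a | a
      · have := congrFun (congrFun h2 a) i
        simp only [mul_apply, toBlocks₁₁, Matrix.of_apply, Matrix.map_apply] at this
        simp only [mulVec, dotProduct, Fintype.sum_sum_type, extField, imField, reField,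
          Sum.elim_inl, Sum.elim_inr, ← hre, ← him] at this ⊢
        simp only [hA.apply i] at this
        rw [← this]
        simp only [Pi.zero_apply]
        have h0 : (0 : SmoothFun (domOpens n R)).ext q = 0 := by
          rw [← SmoothFun.eval_eq q (mem_domOpens.2 hq), map_zero]
        simp [h0]
      · have := congrFun (congrFun h1 a) i
        simp only [mul_apply, toBlocks₂₁, Matrix.of_apply, Matrix.map_apply] at this
        simp only [mulVec, dotProduct, Fintype.sum_sum_type, extField, imField, reField,
          Sum.elim_inl, Sum.elim_inr, ← him] at this ⊢
        simp only [hA.apply i] at this ⊢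
        have h0 : (0 : SmoothFun (domOpens n R)).ext q = 0 := by
          rw [← SmoothFun.eval_eq q (mem_domOpens.2 hq), map_zero]
        have h1 : (1 : SmoothFun (domOpens n R)).ext q = 1 := by
          rw [← SmoothFun.eval_eq q (mem_domOpens.2 hq), map_one]
        simp only [Pi.zero_apply, h0, mul_zero, Finset.sum_const_zero, add_zero]
        rw [this, Matrix.one_apply]
        split_ifs <;> simp [h0, h1]
    have hN := hJ.integrable _ _ (contDiffOn_extField (imField Q i))
      (contDiffOn_extField (imField Q k)) p hp
    rw [nijenhuis, lieBracket_congr (hJf i) (hJf k) hp,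
      lieBracket_congr (hJf i) (fun _ _ => rfl) hp, lieBracket_congr (fun _ _ => rfl) (hJf k) hp,
      lieBracket_extField _ _ hp, lieBracket_extField _ _ hp, lieBracket_extField _ _ hp,
      lieBracket_extField _ _ hp] at hN
    have hz : ∀ V W : Coord n → SmoothFun (domOpens n R),
        (∀ i a, coordDeriv n R a (V (Sum.inr i)) = 0) →
        (∀ i a, coordDeriv n R a (W (Sum.inr i)) = 0) → ∀ j,
        extField (bracket V W) p (Sum.inr j) = 0 := by
      intro V W hV hW j
      rw [extField, bracket_inr_eq_zero hV hW, ← SmoothFun.eval_eq p (mem_domOpens.2 hp), map_zero]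
    set Y : Fin n → ℝ := fun l => extField (bracket (reField P i) (imField Q k)) p (Sum.inl l) +
        extField (bracket (imField Q i) (reField P k)) p (Sum.inl l) with hY
    have hJY : ∀ a, (J p).mulVec (extField (bracket (reField P i) (imField Q k)) p) a +
        (J p).mulVec (extField (bracket (imField Q i) (reField P k)) p) a =
        ∑ j, J p a (Sum.inl j) * Y j := by
      intro a
      simp only [mulVec, dotProduct, Fintype.sum_sum_type,
        hz _ _ (coordDeriv_reField (P := P) i) (coordDeriv_imField (Q := Q) k),
        hz _ _ (coordDeriv_imField (Q := Q) i) (coordDeriv_reField (P := P) k), mul_zero,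
        Finset.sum_const_zero, add_zero, hY, mul_add, Finset.sum_add_distrib]
    obtain ⟨A, hA, hk, -, -⟩ := hG p hp
    obtain ⟨h1, -, -, -⟩ := blocks_of_kahlerPol_eq hk hA
    -- All these brackets have zero angle part. The angle component of the Nijenhuis equation is
    -- therefore J₂₁Y = 0 with J₂₁ invertible; its action component then becomes the other identity.
    have hY0 : Y = 0 := by
      have h3 : (J p).toBlocks₂₁ *ᵥ Y = 0 := by
        funext m
        have := congrFun hN (Sum.inr m)
        simp only [Pi.sub_apply, Pi.zero_apply,
          hz _ _ (coordDeriv_reField (P := P) i) (coordDeriv_reField (P := P) k),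
          hz _ _ (coordDeriv_imField (Q := Q) i) (coordDeriv_imField (Q := Q) k)] at this
        have h4 := hJY (Sum.inr m)
        simp only [mulVec, dotProduct, toBlocks₂₁, Matrix.of_apply, Pi.zero_apply] at this h4 ⊢
        linarith
      rw [← one_mulVec Y, ← mul_eq_one_comm.1 h1, ← mulVec_mulVec, h3, mulVec_zero]
    refine ⟨?_, congrFun hY0 l⟩
    have := congrFun hN (Sum.inl l)
    have h4 := hJY (Sum.inl l)
    simp only [Pi.sub_apply, Pi.zero_apply, hY0, mul_zero, Finset.sum_const_zero] at this h4
    linarith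
  constructor
  · exact SmoothFun.ext_injective fun p hp => (hsmall p hp).1
  · refine SmoothFun.ext_injective fun p hp => ?_
    rw [SmoothFun.ext_add _ _ hp, ← SmoothFun.eval_eq p hp 0, map_zero]
    exact (hsmall p hp).2

theorem bracket_reField_reField (i k l : Fin n) :
    bracket (reField P i) (reField P k) (Sum.inl l) =
      coordDeriv n R (Sum.inr i) (P k l) - coordDeriv n R (Sum.inr k) (P i l)
      + ∑ j, (P i j * coordDeriv n R (Sum.inl j) (P k l)
        - P k j * coordDeriv n R (Sum.inl j) (P i l)) := by
  simp [bracket, Fintype.sum_sum_type, reField, Finset.sum_sub_distrib]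
  ring

theorem bracket_imField_imField (i k l : Fin n) :
    bracket (imField Q i) (imField Q k) (Sum.inl l) =
      ∑ j, (Q i j * coordDeriv n R (Sum.inl j) (Q k l)
        - Q k j * coordDeriv n R (Sum.inl j) (Q i l)) := by
  simp [bracket, Fintype.sum_sum_type, imField, Finset.sum_sub_distrib]

theorem bracket_reField_imField (i k l : Fin n) :
    bracket (reField P i) (imField Q k) (Sum.inl l) =
      coordDeriv n R (Sum.inr i) (Q k l)
      + ∑ j, (P i j * coordDeriv n R (Sum.inl j) (Q k l)
        - Q k j * coordDeriv n R (Sum.inl j) (P i l)) := by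
  simp [bracket, Fintype.sum_sum_type, reField, imField, Finset.sum_sub_distrib]
  ring

theorem bracket_imField_reField (i k l : Fin n) :
    bracket (imField Q i) (reField P k) (Sum.inl l) =
      -coordDeriv n R (Sum.inr k) (Q i l)
      + ∑ j, (Q i j * coordDeriv n R (Sum.inl j) (P k l)
        - P k j * coordDeriv n R (Sum.inl j) (Q i l)) := by
  simp [bracket, Fintype.sum_sum_type, reField, imField, Finset.sum_sub_distrib]
  ring

end Bracket

end ActionAngle

end

/-! ### The rescaled family and its slice at t = 0 -/

noncomputable section

namespace ActionAngle

open Matrix TopologicalSpace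

variable {n : ℕ} {R δ : ℝ} {J : ℝ → Pt n → Matrix (Coord n) (Coord n) ℝ}
  {A₀ : Pt n → Matrix (Fin n) (Fin n) ℂ}

/-- The graph matrices of the polarizations of `J_s`, `s = t²`, are `t² (P + iQ)` with `P` and `Q`
smooth up to `t = 0`, where `P + iQ = A₀`. -/
structure IsCollapsingFamily (J : ℝ → Pt n → Matrix (Coord n) (Coord n) ℝ)
    (A₀ : Pt n → Matrix (Fin n) (Fin n) ℂ)
    (P Q : Matrix (Fin n) (Fin n) (SmoothFun (famOpens n R δ))) : Prop where
  graph : ∀ t ∈ Set.Ioo (-√δ) (√δ), t ≠ 0 → ∀ p ∈ dom n R, ∃ A : Matrix (Fin n) (Fin n) ℂ,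
    A.IsSymm ∧ kahlerPol (J (t ^ 2)) p = graphPol A ∧
      (∀ i j, (A i j).re = t ^ 2 * (P i j).ext (t, p)) ∧
      ∀ i j, (A i j).im = t ^ 2 * (Q i j).ext (t, p)
  re_eq : ∀ p ∈ dom n R, ∀ i j, (P i j).ext (0, p) = (A₀ p i j).re
  im_eq : ∀ p ∈ dom n R, ∀ i j, (Q i j).ext (0, p) = (A₀ p i j).im
  symmP : P.IsSymm
  symmQ : Q.IsSymm
  pos : ∀ t ∈ Set.Ioo (-√δ) (√δ), ∀ p ∈ dom n R,
    (Matrix.of fun i j => (Q i j).ext (t, p)).PosDef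

theorem exists_isCollapsingFamily (hδ : 0 < δ)
    (hJ : ∀ s ∈ Set.Ioo 0 δ, IsCompatibleComplexStructure R (J s)) (hS : Spade R δ J A₀) :
    ∃ P Q : Matrix (Fin n) (Fin n) (SmoothFun (famOpens n R δ)), IsCollapsingFamily J A₀ P Q := by
  have hA₀ : ∀ p ∈ dom n R, (A₀ p).IsSymm ∧ (imPart (A₀ p)).PosDef := by
    obtain ⟨_, -, -, -, h⟩ := hS
    exact fun p hp => (h p hp).2
  obtain ⟨A, hAs, hAg, hA0, hAsymm, hAd⟩ := exists_smooth_graph hδ hJ hS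
  have hre : ∀ i j, ContDiffOn ℝ ∞ (fun z : ℝ × Pt n => (A z.1 z.2 i j).re)
      (Set.Ico 0 δ ×ˢ dom n R) := fun i j =>
    Complex.reCLM.contDiff.comp_contDiffOn (hAs i j)
  have him : ∀ i j, ContDiffOn ℝ ∞ (fun z : ℝ × Pt n => (A z.1 z.2 i j).im)
      (Set.Ico 0 δ ×ˢ dom n R) := fun i j =>
    Complex.imCLM.contDiff.comp_contDiffOn (hAs i j)
  have hred : ∀ i j, ∀ p ∈ dom n R, HasDerivWithinAt (fun s => (A s p i j).re) (A₀ p i j).re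
      (Set.Ici 0) 0 := fun i j p hp =>
    Complex.reCLM.hasFDerivAt.comp_hasDerivWithinAt 0 (hAd p hp i j)
  have himd : ∀ i j, ∀ p ∈ dom n R, HasDerivWithinAt (fun s => (A s p i j).im) (A₀ p i j).im
      (Set.Ici 0) 0 := fun i j p hp =>
    Complex.imCLM.hasFDerivAt.comp_hasDerivWithinAt 0 (hAd p hp i j)
  choose P hP hP0 using fun i j => exists_div_sq hδ (hre i j)
    (fun p hp => by simp [hA0 p hp]) (hred i j)
  choose Q hQ hQ0 using fun i j => exists_div_sq hδ (him i j)
    (fun p hp => by simp [hA0 p hp]) (himd i j)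
  have hsymm : ∀ t ∈ Set.Ioo (-√δ) (√δ), ∀ p ∈ dom n R, ∀ i j,
      A (t ^ 2) p i j = A (t ^ 2) p j i := fun t ht p hp i j =>
    (hAsymm _ (sq_mem_Ico ht) p hp).apply j i
  refine ⟨Matrix.of P, Matrix.of Q, ?_, fun p hp i j => hP0 i j p hp, fun p hp i j => hQ0 i j p hp,
    ?_, ?_, ?_⟩
  · intro t ht h0 p hp
    exact ⟨A (t ^ 2) p, hAsymm _ (sq_mem_Ico ht) p hp, hAg _ (sq_mem_Ioo ht h0) p hp,
      fun i j => hP i j t ht p hp, fun i j => hQ i j t ht p hp⟩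
  · refine Matrix.IsSymm.ext fun i j => SmoothFun.ext_injective fun z hz => ?_
    obtain ⟨t, p⟩ := z
    obtain ⟨ht, hp⟩ := mem_famOpens.1 hz
    simp only [Matrix.of_apply] at *
    by_cases h0 : t = 0
    · subst h0
      rw [hP0 j i p hp, hP0 i j p hp, (hA₀ p hp).1.apply]
    · have h1 := hP i j t ht p hp
      have h2 := hP j i t ht p hp
      rw [hsymm t ht p hp i j, h2] at h1
      exact mul_left_cancel₀ (pow_ne_zero 2 h0) h1
  · refine Matrix.IsSymm.ext fun i j => SmoothFun.ext_injective fun z hz => ?_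
    obtain ⟨t, p⟩ := z
    obtain ⟨ht, hp⟩ := mem_famOpens.1 hz
    simp only [Matrix.of_apply] at *
    by_cases h0 : t = 0
    · subst h0
      rw [hQ0 j i p hp, hQ0 i j p hp, (hA₀ p hp).1.apply]
    · have h1 := hQ i j t ht p hp
      have h2 := hQ j i t ht p hp
      rw [hsymm t ht p hp i j, h2] at h1
      exact mul_left_cancel₀ (pow_ne_zero 2 h0) h1
  · intro t ht p hp
    -- At t = 0 positivity is part of ♠; for t ≠ 0 it follows from positivity of the metric of J_s
    -- after division by t².
    by_cases h0 : t = 0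
    · subst h0
      have : (Matrix.of fun i j => (Matrix.of Q i j).ext (0, p)) = imPart (A₀ p) := by
        ext i j
        simp [imPart, hQ0 i j p hp]
      rw [this]
      exact (hA₀ p hp).2
    · have hs := sq_mem_Ioo ht h0
      have h1 := posDef_im (hJ _ hs) hp (hAg _ hs p hp) (hAsymm _ (sq_mem_Ico ht) p hp)
      have : (Matrix.of fun i j => (Matrix.of Q i j).ext (t, p)) =
          (t ^ 2)⁻¹ • (A (t ^ 2) p).map Complex.im := by
        ext i j
        have := hQ i j t ht p hp
        simp only at this
        simp [this, h0]
      rw [this]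
      exact h1.smul (by positivity)

section Slice

/-- The function `t²` on the parameter space. -/
def tsq (n : ℕ) (R δ : ℝ) : SmoothFun (famOpens n R δ) :=
  SmoothFun.ofFun (fun z => z.1 ^ 2) (ContDiff.contDiffOn (by fun_prop))

/-- The rescaled coordinate derivations `t² ∂/∂x_i` and `∂/∂θ^i`. -/
def famDeriv (n : ℕ) (R δ : ℝ) : Coord n →
    Derivation ℝ (SmoothFun (famOpens n R δ)) (SmoothFun (famOpens n R δ))
  | Sum.inl i => tsq n R δ • SmoothFun.deriv (0, Pi.single (Sum.inl i) 1)
  | Sum.inr i => SmoothFun.deriv (0, Pi.single (Sum.inr i) 1)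

/-- The scaling factors of the coordinates. -/
def scaleFactor (τ : ℝ) : Coord n → ℝ
  | Sum.inl _ => τ ^ 2
  | Sum.inr _ => 1

theorem slice_mem {τ : ℝ} (hτ : τ ∈ Set.Ioo (-√δ) (√δ)) {r : ℝ} (hr : dom n r ⊆ dom n R) :
    ∀ p ∈ domOpens n r, (τ, p) ∈ famOpens n R δ :=
  fun _ hp => ⟨hτ, hr hp⟩

/-- Restriction of a smooth function of `(t, p)` to `t = τ` and `‖x‖ < r`. -/
def slice {τ : ℝ} (hτ : τ ∈ Set.Ioo (-√δ) (√δ)) {r : ℝ} (hr : dom n r ⊆ dom n R) :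
    SmoothFun (famOpens n R δ) →ₐ[ℝ] SmoothFun (domOpens n r) :=
  SmoothFun.pullback (fun p => (τ, p)) (by fun_prop) (slice_mem hτ hr)

variable {τ : ℝ} (hτ : τ ∈ Set.Ioo (-√δ) (√δ)) {r : ℝ} (hr : dom n r ⊆ dom n R)

theorem slice_ext (f : SmoothFun (famOpens n R δ)) {p : Pt n} (hp : p ∈ dom n r) :
    (slice hτ hr f).ext p = f.ext (τ, p) :=
  SmoothFun.pullback_ext _ _ _ f (mem_domOpens.2 hp)

theorem slice_deriv (v : Pt n) (f : SmoothFun (famOpens n R δ)) :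
    slice hτ hr (SmoothFun.deriv (0, v) f) = SmoothFun.deriv v (slice hτ hr f) := by
  refine (SmoothFun.deriv_pullback _ _ _ (fun p _ => ?_) f).symm
  rw [(hasFDerivAt_prodMk_right τ p).fderiv]
  rfl

theorem slice_famDeriv (a : Coord n) (f : SmoothFun (famOpens n R δ)) :
    slice hτ hr (famDeriv n R δ a f) = (scaleFactor τ a • coordDeriv n r a) (slice hτ hr f) := by
  rcases a with a | a
  · have h1 : slice hτ hr (tsq n R δ) = algebraMap ℝ _ (τ ^ 2) := by
      refine SmoothFun.ext_injective fun p hp => ?_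
      rw [slice_ext hτ hr _ hp, tsq, SmoothFun.ofFun_ext _ _ (slice_mem hτ hr p hp),
        ← SmoothFun.eval_eq p hp, AlgHom.commutes]
      rfl
    rw [famDeriv, Derivation.smul_apply, smul_eq_mul, map_mul, h1, slice_deriv,
      Derivation.smul_apply, Algebra.smul_def]
    rfl
  · rw [famDeriv, slice_deriv, scaleFactor, one_smul]
    rfl

theorem zero_mem_Ioo (hδ : 0 < δ) : (0 : ℝ) ∈ Set.Ioo (-√δ) (√δ) := by
  have := Real.sqrt_pos.2 hδ
  exact ⟨by linarith, this⟩

/-- The factor t² in the action derivations vanishes on this slice, which is why the limit geometry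
differentiates in the angles only. -/
theorem slice_zero_famDeriv (hδ : 0 < δ) (a : Coord n) (f : SmoothFun (famOpens n R δ)) :
    slice (zero_mem_Ioo hδ) hr (famDeriv n R δ a f) =
      angleDeriv n r a (slice (zero_mem_Ioo hδ) hr f) := by
  rw [slice_famDeriv]
  rcases a with a | a <;> simp [scaleFactor, angleDeriv]

/-- Identities coming from J_s are available only for t ≠ 0; continuity carries them to t = 0. -/
theorem eq_zero_of_ne {f : SmoothFun (famOpens n R δ)}
    (h : ∀ t ∈ Set.Ioo (-√δ) (√δ), t ≠ 0 → ∀ p ∈ dom n R, f.ext (t, p) = 0) : f = 0 := by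
  refine SmoothFun.ext_injective fun z hz => ?_
  obtain ⟨t, p⟩ := z
  obtain ⟨ht, hp⟩ := mem_famOpens.1 hz
  rw [← SmoothFun.eval_eq _ hz 0, map_zero]
  by_cases h0 : t = 0
  · subst h0
    have hc : Filter.Tendsto (fun t => f.ext (t, p)) (𝓝[≠] 0) (𝓝 (f.ext (0, p))) := by
      have h1 := (f.contDiffAt_ext hz).continuousAt
      have : ContinuousAt (fun t => f.ext (t, p)) 0 :=
        ContinuousAt.comp (f := fun t : ℝ => (t, p)) h1 (by fun_prop)
      exact this.tendsto.mono_left nhdsWithin_le_nhds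
    refine tendsto_nhds_unique hc (tendsto_const_nhds.congr' ?_)
    filter_upwards [self_mem_nhdsWithin, nhdsWithin_le_nhds (isOpen_Ioo.mem_nhds ht)] with t h1 h2
    exact (h t h2 h1 p hp).symm
  · exact h t ht h0 p hp

end Slice

namespace IsCollapsingFamily

variable {P Q : Matrix (Fin n) (Fin n) (SmoothFun (famOpens n R δ))}

theorem isGraphOf (H : IsCollapsingFamily J A₀ P Q) {t : ℝ} (ht : t ∈ Set.Ioo (-√δ) (√δ))
    (h0 : t ≠ 0) :
    IsGraphOf (J (t ^ 2)) (t ^ 2 • P.map (slice ht subset_rfl))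
      (t ^ 2 • Q.map (slice ht subset_rfl)) := by
  intro p hp
  obtain ⟨A, h1, h2, h3, h4⟩ := H.graph t ht h0 p hp
  have key : ∀ f : SmoothFun (famOpens n R δ),
      (t ^ 2 • slice ht subset_rfl f).ext p = t ^ 2 * f.ext (t, p) := by
    intro f
    rw [← slice_ext ht subset_rfl f hp, ← SmoothFun.eval_eq p (mem_domOpens.2 hp),
      map_smul, smul_eq_mul, SmoothFun.eval_eq]
  refine ⟨A, h1, h2, fun i j => ?_, fun i j => ?_⟩
  · rw [h3, Matrix.smul_apply, Matrix.map_apply, key]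
  · rw [h4, Matrix.smul_apply, Matrix.map_apply, key]

/-- The integrability conditions of `J_s`, divided by `s`. -/
theorem integrability (H : IsCollapsingFamily J A₀ P Q)
    (hJ : ∀ s ∈ Set.Ioo 0 δ, IsCompatibleComplexStructure R (J s)) (i k l : Fin n) :
    famDeriv n R δ (Sum.inr i) (P k l) - famDeriv n R δ (Sum.inr k) (P i l)
      + (∑ j, (P i j * famDeriv n R δ (Sum.inl j) (P k l)
        - P k j * famDeriv n R δ (Sum.inl j) (P i l))
      - ∑ j, (Q i j * famDeriv n R δ (Sum.inl j) (Q k l)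
        - Q k j * famDeriv n R δ (Sum.inl j) (Q i l))) = 0 ∧
    famDeriv n R δ (Sum.inr i) (Q k l) - famDeriv n R δ (Sum.inr k) (Q i l)
      + (∑ j, (P i j * famDeriv n R δ (Sum.inl j) (Q k l)
        - Q k j * famDeriv n R δ (Sum.inl j) (P i l))
      + ∑ j, (Q i j * famDeriv n R δ (Sum.inl j) (P k l)
        - P k j * famDeriv n R δ (Sum.inl j) (Q i l))) = 0 := by
  -- In the bracket equations for t²P and t²Q the angle derivatives carry one factor t² and the
  -- quadratic terms carry t⁴; half of the latter is absorbed by the rescaled action derivations, so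
  -- t² divides out.
  have hred : ∀ f : SmoothFun (famOpens n R δ),
      (∀ t (ht : t ∈ Set.Ioo (-√δ) (√δ)), t ≠ 0 →
        t ^ 2 • slice ht (subset_rfl : dom n R ⊆ dom n R) f = 0) → f = 0 := by
    intro f hf
    refine eq_zero_of_ne fun t ht h0 p hp => ?_
    have h1 := congrArg (fun g => g.ext p) (hf t ht h0)
    simp only [← SmoothFun.eval_eq p (mem_domOpens.2 hp), map_smul, smul_eq_mul, map_zero] at h1
    rw [SmoothFun.eval_eq, slice_ext _ _ _ hp] at h1
    exact (mul_eq_zero.1 h1).resolve_left (pow_ne_zero 2 h0)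
  constructor
  · refine hred _ fun t ht h0 => ?_
    have h1 := (bracket_eq_of_integrable (hJ _ (sq_mem_Ioo ht h0)) (H.isGraphOf ht h0) i k l).1
    rw [← sub_eq_zero, bracket_reField_reField, bracket_imField_imField] at h1
    rw [← h1]
    simp only [map_add, map_sub, map_mul, map_sum, slice_famDeriv, scaleFactor, one_smul,
      Derivation.smul_apply, Matrix.smul_apply, Matrix.map_apply, Derivation.map_smul, smul_add,
      smul_sub, Finset.smul_sum, mul_smul_comm, smul_mul_assoc, smul_smul]
    abel
  · refine hred _ fun t ht h0 => ?_
    have h1 := (bracket_eq_of_integrable (hJ _ (sq_mem_Ioo ht h0)) (H.isGraphOf ht h0) i k l).2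
    rw [bracket_reField_imField, bracket_imField_reField] at h1
    rw [← h1]
    simp only [map_add, map_sub, map_mul, map_sum, slice_famDeriv, scaleFactor, one_smul,
      Derivation.smul_apply, Matrix.smul_apply, Matrix.map_apply, Derivation.map_smul, smul_add,
      smul_sub, Finset.smul_sum, mul_smul_comm, smul_mul_assoc, smul_smul]
    abel

theorem isUnit_det (H : IsCollapsingFamily J A₀ P Q) : IsUnit Q.det := by
  refine SmoothFun.isUnit_of_ne_zero fun z hz => ?_
  rw [← SmoothFun.eval_eq z hz, AlgHom.map_det]
  have := (H.pos z.1 (mem_famOpens.1 hz).1 z.2 (mem_famOpens.1 hz).2).isUnit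
  rw [Matrix.isUnit_iff_isUnit_det] at this
  convert this.ne_zero using 2
  ext i j
  simp [SmoothFun.eval_eq]

theorem symm_inv (H : IsCollapsingFamily J A₀ P Q) : Q⁻¹.IsSymm := by
  rw [Matrix.IsSymm, Matrix.transpose_nonsing_inv, H.symmQ.eq]

/-- The first-order terms at `t = 0`. -/
theorem isCollapsed (H : IsCollapsingFamily J A₀ P Q) (hδ : 0 < δ)
    (hJ : ∀ s ∈ Set.Ioo 0 δ, IsCompatibleComplexStructure R (J s)) {r : ℝ}
    (hr : dom n r ⊆ dom n R) :
    IsCollapsed (angleDeriv n r) (P.map (slice (zero_mem_Ioo hδ) hr))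
      (Q.map (slice (zero_mem_Ioo hδ) hr)) (Q⁻¹.map (slice (zero_mem_Ioo hδ) hr)) where
  symmP := Matrix.IsSymm.ext fun i j => by simp only [Matrix.map_apply, H.symmP.apply]
  symmQ := Matrix.IsSymm.ext fun i j => by simp only [Matrix.map_apply, H.symmQ.apply]
  symmh := Matrix.IsSymm.ext fun i j => by simp only [Matrix.map_apply, H.symm_inv.apply]
  mul_inv := by
    rw [← Matrix.map_mul, Matrix.mul_nonsing_inv _ H.isUnit_det,
      Matrix.map_one _ (map_zero _) (map_one _)]
  inv_mul := by
    rw [← Matrix.map_mul, Matrix.nonsing_inv_mul _ H.isUnit_det,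
      Matrix.map_one _ (map_zero _) (map_one _)]
  inl_eq := fun i => rfl
  comm := fun i j x => angleDeriv_comm r i j x
  closedP := fun i j k => by
    have := congrArg (slice (zero_mem_Ioo hδ) hr) (H.integrability hJ i j k).1
    simp only [map_add, map_sub, map_mul, map_sum, slice_zero_famDeriv hr hδ, map_zero] at this
    simp only [Matrix.map_apply]
    rw [← sub_eq_zero]
    simpa [angleDeriv] using this
  closedQ := fun i j k => by
    have := congrArg (slice (zero_mem_Ioo hδ) hr) (H.integrability hJ i j k).2
    simp only [map_add, map_sub, map_mul, map_sum, slice_zero_famDeriv hr hδ, map_zero] at this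
    simp only [Matrix.map_apply]
    rw [← sub_eq_zero]
    simpa [angleDeriv] using this

end IsCollapsingFamily

end ActionAngle

end

/-! ### Ricci tensors in rescaled coordinates, and periodicity -/

noncomputable section

namespace ActionAngle

open Matrix TopologicalSpace

variable {n : ℕ} {R δ : ℝ}

theorem map_metricBlock {A B : Type} [CommRing A] [CommRing B] [Algebra ℝ A] [Algebra ℝ B]
    (φ : A →ₐ[ℝ] B) (P Q h : Matrix (Fin n) (Fin n) A) :
    (metricBlock P Q h).map φ = metricBlock (P.map φ) (Q.map φ) (h.map φ) := by
  have hneg : ∀ M : Matrix (Fin n) (Fin n) A, (-M).map φ = -M.map φ := fun M => by ext; simp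
  have hadd : ∀ M N : Matrix (Fin n) (Fin n) A, (M + N).map φ = M.map φ + N.map φ :=
    fun M N => by ext; simp
  simp only [metricBlock, fromBlocks_map, hneg, hadd, Matrix.map_mul]

theorem map_metricBlockInv {A B : Type} [CommRing A] [CommRing B] [Algebra ℝ A] [Algebra ℝ B]
    (φ : A →ₐ[ℝ] B) (P Q h : Matrix (Fin n) (Fin n) A) :
    (metricBlockInv P Q h).map φ = metricBlockInv (P.map φ) (Q.map φ) (h.map φ) := by
  have hadd : ∀ M N : Matrix (Fin n) (Fin n) A, (M + N).map φ = M.map φ + N.map φ :=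
    fun M N => by ext; simp
  simp only [metricBlockInv, fromBlocks_map, hadd, Matrix.map_mul]

section Ricci

variable {g : Pt n → Matrix (Coord n) (Coord n) ℝ}
  {G Gi : Matrix (Coord n) (Coord n) (SmoothFun (domOpens n R))}

theorem pderiv_eq_coordDeriv {F : Pt n → ℝ} {f : SmoothFun (domOpens n R)}
    (h : ∀ p ∈ dom n R, F p = f.ext p) {p : Pt n} (hp : p ∈ dom n R) (a : Coord n) :
    pderiv a F p = (coordDeriv n R a f).ext p :=
  SmoothFun.fderiv_eq_of_eqOn h (mem_domOpens.2 hp) _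

theorem christoffel_eq (hg : ∀ p ∈ dom n R, ∀ a b, g p a b = (G a b).ext p) (hG : Gi * G = 1)
    {p : Pt n} (hp : p ∈ dom n R) (k a b : Coord n) :
    christoffel g k a b p = (chrAlg (coordDeriv n R) G Gi k a b).ext p := by
  have hev := SmoothFun.eval_eq p (mem_domOpens.2 hp)
  have hinv : (g p)⁻¹ = Gi.map (SmoothFun.eval p (mem_domOpens.2 hp)) := by
    refine Matrix.inv_eq_left_inv ?_
    have h1 : g p = G.map (SmoothFun.eval p (mem_domOpens.2 hp)) := by
      ext a b
      rw [hg p hp, Matrix.map_apply, hev]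
    rw [h1, ← Matrix.map_mul, hG, Matrix.map_one _ (map_zero _) (map_one _)]
  have hd : ∀ a b c, pderiv a (fun q => g q b c) p = (coordDeriv n R a (G b c)).ext p :=
    fun a b c => pderiv_eq_coordDeriv (fun q hq => hg q hq b c) hp a
  rw [christoffel, hinv]
  simp only [hd, ← hev, Matrix.map_apply, chrAlg, map_smul, map_sum, map_mul, map_add, map_sub,
    smul_eq_mul]

theorem ricci_eq (hg : ∀ p ∈ dom n R, ∀ a b, g p a b = (G a b).ext p) (hG : Gi * G = 1)
    {p : Pt n} (hp : p ∈ dom n R) (a b : Coord n) :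
    ricci g p a b = (ricAlg (coordDeriv n R) G Gi a b).ext p := by
  have hev := SmoothFun.eval_eq p (mem_domOpens.2 hp)
  have hd : ∀ c k a b, pderiv c (christoffel g k a b) p =
      (coordDeriv n R c (chrAlg (coordDeriv n R) G Gi k a b)).ext p := fun c k a b =>
    pderiv_eq_coordDeriv (fun q hq => christoffel_eq hg hG hq k a b) hp c
  rw [ricci, Matrix.of_apply]
  simp only [hd, christoffel_eq hg hG hp, ← hev, ricAlg, map_sum, map_mul, map_add, map_sub]

end Ricci

variable {J : ℝ → Pt n → Matrix (Coord n) (Coord n) ℝ}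
  {A₀ : Pt n → Matrix (Fin n) (Fin n) ℂ}
  {P Q : Matrix (Fin n) (Fin n) (SmoothFun (famOpens n R δ))}

/-- The rescaled metrics. -/
def famMetric (P Q : Matrix (Fin n) (Fin n) (SmoothFun (famOpens n R δ))) :
    Matrix (Coord n) (Coord n) (SmoothFun (famOpens n R δ)) :=
  metricBlock P Q Q⁻¹

/-- The Ricci tensors in the rescaled coordinates. -/
def famRicci (P Q : Matrix (Fin n) (Fin n) (SmoothFun (famOpens n R δ))) :
    Matrix (Coord n) (Coord n) (SmoothFun (famOpens n R δ)) :=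
  Matrix.of (ricAlg (famDeriv n R δ) (famMetric P Q) (metricBlockInv P Q Q⁻¹))

theorem scaleFactor_ne_zero {t : ℝ} (h0 : t ≠ 0) (a : Coord n) : scaleFactor t a ≠ 0 := by
  rcases a with a | a <;> simp [scaleFactor, h0]

namespace IsCollapsingFamily

/-- For the graph matrix t²(P + iQ) the action, mixed and angle blocks of the metric scale as t⁻², 1
and t², that is, as t² divided by the scale factors of the two indices. -/
theorem metric_family (H : IsCollapsingFamily J A₀ P Q) {t : ℝ} (ht : t ∈ Set.Ioo (-√δ) (√δ))
    (h0 : t ≠ 0) {p : Pt n} (hp : p ∈ dom n R) (a b : Coord n) :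
    metric (J (t ^ 2)) p a b =
      t ^ 2 * (scaleFactor t a)⁻¹ * (scaleFactor t b)⁻¹ * (famMetric P Q a b).ext (t, p) := by
  obtain ⟨A, hA, hk, hre, him⟩ := H.graph t ht h0 p hp
  have hz : (t, p) ∈ famOpens n R δ := ⟨ht, hp⟩
  set φ := SmoothFun.eval (t, p) hz
  have hev : ∀ f, f.ext (t, p) = φ f := fun f => (SmoothFun.eval_eq _ hz f).symm
  have hre' : A.map Complex.re = t ^ 2 • P.map φ := by
    ext i j
    simp [hre, hev]
  have him' : A.map Complex.im = t ^ 2 • Q.map φ := by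
    ext i j
    simp [him, hev]
  obtain ⟨h1, -, -, -⟩ := blocks_of_kahlerPol_eq hk hA
  have hQh : Q.map φ * Q⁻¹.map φ = 1 := by
    rw [← Matrix.map_mul, Matrix.mul_nonsing_inv _ H.isUnit_det,
      Matrix.map_one _ (map_zero _) (map_one _)]
  have h2 : (J (t ^ 2) p).toBlocks₂₁ = (t ^ 2)⁻¹ • Q⁻¹.map φ := by
    have h3 : A.map Complex.im * ((t ^ 2)⁻¹ • Q⁻¹.map φ) = 1 := by
      rw [him', smul_mul_smul_comm, hQh, mul_inv_cancel₀ (pow_ne_zero 2 h0), one_smul]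
    calc (J (t ^ 2) p).toBlocks₂₁
        = (J (t ^ 2) p).toBlocks₂₁ * (A.map Complex.im * ((t ^ 2)⁻¹ • Q⁻¹.map φ)) := by
          rw [h3, mul_one]
      _ = _ := by rw [← mul_assoc, h1, one_mul]
  have h4 : (famMetric P Q a b).ext (t, p) =
      metricBlock (P.map φ) (Q.map φ) (Q⁻¹.map φ) a b := by
    rw [hev, ← map_metricBlock]
    rfl
  have ht2 : t ^ 2 ≠ 0 := pow_ne_zero 2 h0
  rw [h4, metric_eq_metricBlock hk hA, hre', him', h2]
  rcases a with a | a <;> rcases b with b | b <;>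
    simp only [metricBlock, scaleFactor, fromBlocks_apply₁₁, fromBlocks_apply₁₂,
      fromBlocks_apply₂₁, fromBlocks_apply₂₂, Matrix.neg_apply, Matrix.add_apply,
      Matrix.smul_apply, smul_mul_assoc, mul_smul_comm, smul_eq_mul, smul_smul] <;> field_simp

/-- By `ricAlg_rescale` the overall factor t² of the metric does not enter, only the scale factors
of the two indices. The left side is smooth up to t = 0, where the metrics themselves degenerate. -/
theorem ricci_family (H : IsCollapsingFamily J A₀ P Q) {t : ℝ} (ht : t ∈ Set.Ioo (-√δ) (√δ))
    (h0 : t ≠ 0) {p : Pt n} (hp : p ∈ dom n R) (a b : Coord n) :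
    (famRicci P Q a b).ext (t, p) =
      scaleFactor t a * scaleFactor t b * ricci (metric (J (t ^ 2))) p a b := by
  set φ := slice ht (subset_rfl : dom n R ⊆ dom n R)
  have ht2 : t ^ 2 ≠ 0 := pow_ne_zero 2 h0
  have hc := scaleFactor_ne_zero (n := n) h0
  set G : Matrix (Coord n) (Coord n) (SmoothFun (domOpens n R)) := Matrix.of fun i j =>
    (t ^ 2 * (scaleFactor t i)⁻¹ * (scaleFactor t j)⁻¹) • ((famMetric P Q).map φ) i j with hGdef
  set Gi : Matrix (Coord n) (Coord n) (SmoothFun (domOpens n R)) := Matrix.of fun i j =>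
    ((t ^ 2)⁻¹ * scaleFactor t i * scaleFactor t j) • ((metricBlockInv P Q Q⁻¹).map φ) i j
    with hGidef
  have hG : ∀ q ∈ dom n R, ∀ a b, metric (J (t ^ 2)) q a b = (G a b).ext q := by
    intro q hq a b
    rw [H.metric_family ht h0 hq, hGdef, Matrix.of_apply, Matrix.map_apply,
      ← slice_ext ht subset_rfl _ hq]
    simp only [← SmoothFun.eval_eq q (mem_domOpens.2 hq), map_smul, smul_eq_mul]
    rfl
  have hinv : Gi * G = 1 := by
    have h1 : (metricBlockInv P Q Q⁻¹).map φ * (famMetric P Q).map φ = 1 := by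
      rw [← Matrix.map_mul, famMetric, metricBlockInv_mul (Matrix.mul_nonsing_inv _ H.isUnit_det)
        (Matrix.nonsing_inv_mul _ H.isUnit_det), Matrix.map_one _ (map_zero _) (map_one _)]
    ext i j
    have h2 := congrFun (congrFun h1 i) j
    rw [mul_apply] at h2 ⊢
    have h3 : ∀ k, Gi i k * G k j = (scaleFactor t i * (scaleFactor t j)⁻¹) •
        (((metricBlockInv P Q Q⁻¹).map φ) i k * ((famMetric P Q).map φ) k j) := by
      intro k
      rw [hGdef, hGidef, Matrix.of_apply, Matrix.of_apply, smul_mul_smul_comm]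
      congr 1
      have := hc k
      field_simp
    rw [Finset.sum_congr rfl fun k _ => h3 k, ← Finset.smul_sum, h2, Matrix.one_apply]
    split_ifs with hij
    · subst hij
      rw [mul_inv_cancel₀ (hc i), one_smul]
    · rw [smul_zero]
  rw [ricci_eq hG hinv hp, ← slice_ext ht subset_rfl _ hp, famRicci, Matrix.of_apply,
    map_ricAlg φ (fun i x => slice_famDeriv ht subset_rfl i x), ricAlg_rescale _ _ _ hc ht2,
    ← SmoothFun.eval_eq p (mem_domOpens.2 hp), ← SmoothFun.eval_eq p (mem_domOpens.2 hp), map_smul,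
    smul_eq_mul]

end IsCollapsingFamily

/-- The quadratic form of a matrix of smooth functions. -/
def quadFun (M : Matrix (Coord n) (Coord n) (SmoothFun (famOpens n R δ))) (u : Pt n) :
    SmoothFun (famOpens n R δ) :=
  ∑ a, ∑ b, (u a * u b) • M a b

theorem quadFun_ext (M : Matrix (Coord n) (Coord n) (SmoothFun (famOpens n R δ))) (u : Pt n)
    {z : ℝ × Pt n} (hz : z ∈ famOpens n R δ) :
    (quadFun M u).ext z = ∑ a, ∑ b, u a * u b * (M a b).ext z := by
  simp only [quadFun, ← SmoothFun.eval_eq z hz, map_sum, map_smul, smul_eq_mul]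

theorem dotProduct_mulVec_eq_sum (M : Matrix (Coord n) (Coord n) ℝ) (u : Pt n) :
    u ⬝ᵥ M *ᵥ u = ∑ a, ∑ b, u a * u b * M a b := by
  simp only [dotProduct, mulVec, Finset.mul_sum]
  refine Finset.sum_congr rfl fun a _ => Finset.sum_congr rfl fun b _ => by ring

namespace IsCollapsingFamily

/-- The Ricci bound in rescaled coordinates. -/
theorem ricci_bound_iff (H : IsCollapsingFamily J A₀ P Q) {t : ℝ} (ht : t ∈ Set.Ioo (-√δ) (√δ))
    (h0 : t ≠ 0) {p : Pt n} (hp : p ∈ dom n R) (κ : ℝ) (u : Pt n) :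
    (κ * ((fun a => scaleFactor t a * u a) ⬝ᵥ
        metric (J (t ^ 2)) p *ᵥ fun a => scaleFactor t a * u a) ≤
      (fun a => scaleFactor t a * u a) ⬝ᵥ
        ricci (metric (J (t ^ 2))) p *ᵥ fun a => scaleFactor t a * u a) ↔
    κ * (t ^ 2 * (quadFun (famMetric P Q) u).ext (t, p)) ≤ (quadFun (famRicci P Q) u).ext (t, p) := by
  have hz : (t, p) ∈ famOpens n R δ := ⟨ht, hp⟩
  have hc := scaleFactor_ne_zero (n := n) h0
  rw [dotProduct_mulVec_eq_sum, dotProduct_mulVec_eq_sum, quadFun_ext _ _ hz, quadFun_ext _ _ hz]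
  have e1 : ∑ a, ∑ b, scaleFactor t a * u a * (scaleFactor t b * u b) * metric (J (t ^ 2)) p a b =
      t ^ 2 * ∑ a, ∑ b, u a * u b * (famMetric P Q a b).ext (t, p) := by
    simp only [Finset.mul_sum]
    refine Finset.sum_congr rfl fun a _ => Finset.sum_congr rfl fun b _ => ?_
    rw [H.metric_family ht h0 hp]
    have := hc a
    have := hc b
    field_simp
  have e2 : ∑ a, ∑ b, scaleFactor t a * u a * (scaleFactor t b * u b) *
      ricci (metric (J (t ^ 2))) p a b =
      ∑ a, ∑ b, u a * u b * (famRicci P Q a b).ext (t, p) := by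
    refine Finset.sum_congr rfl fun a _ => Finset.sum_congr rfl fun b _ => ?_
    rw [H.ricci_family ht h0 hp]
    ring
  rw [e1, e2]

end IsCollapsingFamily

section Shift

/-- Pull-back along the translation by `k` in the angles. -/
def famShift (n : ℕ) (R δ : ℝ) (k : Fin n → ℤ) :
    SmoothFun (famOpens n R δ) →ₐ[ℝ] SmoothFun (famOpens n R δ) :=
  SmoothFun.pullback (fun z => (z.1, shift k z.2))
    (contDiff_fst.prodMk ((contDiff_shift k).comp contDiff_snd))
    fun _ hz => ⟨(mem_famOpens.1 hz).1, shift_mem k (mem_famOpens.1 hz).2⟩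

theorem famShift_ext (k : Fin n → ℤ) (f : SmoothFun (famOpens n R δ)) {t : ℝ} {p : Pt n}
    (hz : (t, p) ∈ famOpens n R δ) : (famShift n R δ k f).ext (t, p) = f.ext (t, shift k p) :=
  SmoothFun.pullback_ext _ _ _ f hz

theorem famShift_famDeriv (k : Fin n → ℤ) (a : Coord n) (f : SmoothFun (famOpens n R δ)) :
    famShift n R δ k (famDeriv n R δ a f) = famDeriv n R δ a (famShift n R δ k f) := by
  have h1 : ∀ (v : Pt n) (f : SmoothFun (famOpens n R δ)),
      famShift n R δ k (SmoothFun.deriv (0, v) f) =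
        SmoothFun.deriv (0, v) (famShift n R δ k f) := by
    intro v f
    refine (SmoothFun.deriv_pullback _ _ _ (fun z _ => ?_) f).symm
    have h2 : HasFDerivAt (fun z : ℝ × Pt n => (z.1, shift k z.2))
        ((ContinuousLinearMap.fst ℝ ℝ (Pt n)).prod (ContinuousLinearMap.snd ℝ ℝ (Pt n))) z :=
      hasFDerivAt_fst.prodMk (by unfold shift; exact hasFDerivAt_snd.add_const _)
    rw [h2.fderiv]
    rfl
  rcases a with a | a
  · have h2 : famShift n R δ k (tsq n R δ) = tsq n R δ := by
      refine SmoothFun.ext_injective fun z hz => ?_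
      have hz' : (z.1, shift k z.2) ∈ famOpens n R δ :=
        ⟨(mem_famOpens.1 hz).1, shift_mem k (mem_famOpens.1 hz).2⟩
      rw [famShift_ext k _ hz, tsq, SmoothFun.ofFun_ext _ _ hz', SmoothFun.ofFun_ext _ _ hz]
    rw [famDeriv, Derivation.smul_apply, Derivation.smul_apply, smul_eq_mul, smul_eq_mul, map_mul,
      h2, h1]
  · exact h1 _ f

namespace IsCollapsingFamily

theorem kahlerPol_shift (hJ : ∀ s ∈ Set.Ioo 0 δ, IsCompatibleComplexStructure R (J s)) {s : ℝ}
    (hs : s ∈ Set.Ioo 0 δ) {p : Pt n} (hp : p ∈ dom n R) (k : Fin n → ℤ) :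
    kahlerPol (J s) (shift k p) = kahlerPol (J s) p := by
  rw [kahlerPol, (hJ s hs).periodic p hp k, kahlerPol]

/-- Periodicity of J makes the polarization periodic, hence its unique graph matrix for t ≠ 0; the
case t = 0 follows by continuity. -/
theorem famShift_eq (H : IsCollapsingFamily J A₀ P Q)
    (hJ : ∀ s ∈ Set.Ioo 0 δ, IsCompatibleComplexStructure R (J s)) (k : Fin n → ℤ) (i j : Fin n) :
    famShift n R δ k (P i j) = P i j ∧ famShift n R δ k (Q i j) = Q i j := by
  have key : ∀ t ∈ Set.Ioo (-√δ) (√δ), t ≠ 0 → ∀ p ∈ dom n R,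
      (P i j).ext (t, shift k p) = (P i j).ext (t, p) ∧
      (Q i j).ext (t, shift k p) = (Q i j).ext (t, p) := by
    intro t ht h0 p hp
    obtain ⟨A, -, h1, h2, h3⟩ := H.graph t ht h0 p hp
    obtain ⟨A', -, h1', h2', h3'⟩ := H.graph t ht h0 _ (shift_mem k hp)
    rw [kahlerPol_shift hJ (sq_mem_Ioo ht h0) hp, h1] at h1'
    have hAA := graphPol_injective h1'
    subst hAA
    have ht2 := pow_ne_zero 2 h0
    exact ⟨mul_left_cancel₀ ht2 ((h2' i j).symm.trans (h2 i j)),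
      mul_left_cancel₀ ht2 ((h3' i j).symm.trans (h3 i j))⟩
  have hred : ∀ f : SmoothFun (famOpens n R δ), (∀ t ∈ Set.Ioo (-√δ) (√δ), t ≠ 0 →
      ∀ p ∈ dom n R, f.ext (t, shift k p) = f.ext (t, p)) → famShift n R δ k f = f := by
    intro f hf
    rw [← sub_eq_zero]
    refine eq_zero_of_ne fun t ht h0 p hp => ?_
    have hz : (t, p) ∈ famOpens n R δ := ⟨ht, hp⟩
    rw [← SmoothFun.eval_eq _ hz, map_sub, SmoothFun.eval_eq, SmoothFun.eval_eq, famShift_ext _ _ hz,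
      hf t ht h0 p hp, sub_self]
  exact ⟨hred _ fun t ht h0 p hp => (key t ht h0 p hp).1,
    hred _ fun t ht h0 p hp => (key t ht h0 p hp).2⟩

theorem famShift_map_inv (H : IsCollapsingFamily J A₀ P Q)
    (hJ : ∀ s ∈ Set.Ioo 0 δ, IsCompatibleComplexStructure R (J s)) (k : Fin n → ℤ) :
    Q⁻¹.map (famShift n R δ k) = Q⁻¹ := by
  have h1 : Q.map (famShift n R δ k) = Q := by ext i j; exact (H.famShift_eq hJ k i j).2
  symm
  refine Matrix.inv_eq_right_inv ?_
  calc Q * Q⁻¹.map (famShift n R δ k)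
      = Q.map (famShift n R δ k) * Q⁻¹.map (famShift n R δ k) := by rw [h1]
    _ = 1 := by rw [← Matrix.map_mul, Matrix.mul_nonsing_inv _ H.isUnit_det,
      Matrix.map_one _ (map_zero _) (map_one _)]

theorem famShift_famMetric (H : IsCollapsingFamily J A₀ P Q)
    (hJ : ∀ s ∈ Set.Ioo 0 δ, IsCompatibleComplexStructure R (J s)) (k : Fin n → ℤ) :
    (famMetric P Q).map (famShift n R δ k) = famMetric P Q := by
  have h1 : Q.map (famShift n R δ k) = Q := by ext i j; exact (H.famShift_eq hJ k i j).2
  have h2 : P.map (famShift n R δ k) = P := by ext i j; exact (H.famShift_eq hJ k i j).1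
  rw [famMetric, map_metricBlock, h1, h2, H.famShift_map_inv hJ]

theorem famShift_famRicci (H : IsCollapsingFamily J A₀ P Q)
    (hJ : ∀ s ∈ Set.Ioo 0 δ, IsCompatibleComplexStructure R (J s)) (k : Fin n → ℤ) :
    (famRicci P Q).map (famShift n R δ k) = famRicci P Q := by
  have h1 : Q.map (famShift n R δ k) = Q := by ext i j; exact (H.famShift_eq hJ k i j).2
  have h2 : P.map (famShift n R δ k) = P := by ext i j; exact (H.famShift_eq hJ k i j).1
  ext1 a b
  rw [Matrix.map_apply, famRicci, Matrix.of_apply, map_ricAlg _ (famShift_famDeriv k),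
    H.famShift_famMetric hJ, map_metricBlockInv, h1, h2, H.famShift_map_inv hJ]

theorem quadFun_shift {M : Matrix (Coord n) (Coord n) (SmoothFun (famOpens n R δ))}
    {k : Fin n → ℤ} (hM : M.map (famShift n R δ k) = M) (u : Pt n) {t : ℝ} {p : Pt n}
    (hz : (t, p) ∈ famOpens n R δ) :
    (quadFun M u).ext (t, shift k p) = (quadFun M u).ext (t, p) := by
  rw [← famShift_ext k _ hz]
  congr 1
  simp only [quadFun, map_sum, map_smul]
  refine Finset.sum_congr rfl fun a _ => Finset.sum_congr rfl fun b _ => ?_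
  rw [← Matrix.map_apply (f := famShift n R δ k), hM]

end IsCollapsingFamily

end Shift

end ActionAngle

end

/-! ### The limit t → 0 and the compactness argument -/

noncomputable section

namespace ActionAngle

open Matrix TopologicalSpace

variable {n : ℕ} {R δ : ℝ} {J : ℝ → Pt n → Matrix (Coord n) (Coord n) ℝ}
  {A₀ : Pt n → Matrix (Fin n) (Fin n) ℂ}
  {P Q : Matrix (Fin n) (Fin n) (SmoothFun (famOpens n R δ))}

theorem dom_subset_dom {r : ℝ} (h0 : 0 ≤ r) (h : r ≤ R) : dom n r ⊆ dom n R :=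
  fun p (hp : ∑ i, (p (Sum.inl i)) ^ 2 < r ^ 2) => hp.trans_le (pow_le_pow_left₀ h0 h 2)

theorem fibrePt_self (p : Pt n) :
    fibrePt (fun i => p (Sum.inl i)) (fun i => p (Sum.inr i)) = p := by
  funext a
  rcases a with a | a <;> rfl

namespace IsCollapsingFamily

theorem first_order_eq (H : IsCollapsingFamily J A₀ P Q) (hδ : 0 < δ) (i j : Fin n) :
    ∀ p ∈ dom n R, A₀ p i j = ((slice (zero_mem_Ioo hδ) subset_rfl (P i j)).ext p : ℂ) +
      ((slice (zero_mem_Ioo hδ) subset_rfl (Q i j)).ext p : ℂ) * Complex.I := by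
  intro p hp
  rw [slice_ext _ _ _ hp, slice_ext _ _ _ hp, H.re_eq p hp, H.im_eq p hp, Complex.re_add_im]

theorem contDiffOn_first_order (H : IsCollapsingFamily J A₀ P Q) (hδ : 0 < δ) (i j : Fin n) :
    ContDiffOn ℝ ∞ (fun p => A₀ p i j) (dom n R) := by
  refine ContDiffOn.congr ?_ (H.first_order_eq hδ i j)
  exact (Complex.ofRealCLM.contDiff.comp_contDiffOn (SmoothFun.contDiffOn_ext _)).add
    ((Complex.ofRealCLM.contDiff.comp_contDiffOn (SmoothFun.contDiffOn_ext _)).mul contDiffOn_const)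

theorem pderiv_first_order (H : IsCollapsingFamily J A₀ P Q) (hδ : 0 < δ) (a : Coord n)
    (i j : Fin n) {p : Pt n} (hp : p ∈ dom n R) :
    pderiv a (fun q => A₀ q i j) p =
      ((coordDeriv n R a (slice (zero_mem_Ioo hδ) subset_rfl (P i j))).ext p : ℂ) +
      ((coordDeriv n R a (slice (zero_mem_Ioo hδ) subset_rfl (Q i j))).ext p : ℂ) *
        Complex.I := by
  have hev : (fun q => A₀ q i j) =ᶠ[𝓝 p] fun p =>
      ((slice (zero_mem_Ioo hδ) subset_rfl (P i j)).ext p : ℂ) +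
      ((slice (zero_mem_Ioo hδ) subset_rfl (Q i j)).ext p : ℂ) * Complex.I := by
    filter_upwards [(isOpen_dom n R).mem_nhds hp] with q hq using H.first_order_eq hδ i j q hq
  have hd : ∀ f : SmoothFun (domOpens n R), HasFDerivAt (fun q => (f.ext q : ℂ))
      (Complex.ofRealCLM.comp (fderiv ℝ f.ext p)) p := fun f =>
    Complex.ofRealCLM.hasFDerivAt.comp p (f.differentiableAt_ext (mem_domOpens.2 hp)).hasFDerivAt
  rw [pderiv, hev.fderiv_eq, ((hd _).fun_add ((hd _).mul_const Complex.I)).fderiv]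
  have e : ∀ f : SmoothFun (domOpens n R), (coordDeriv n R a f).ext p =
      fderiv ℝ f.ext p (Pi.single a 1) := fun f => SmoothFun.deriv_ext _ _ (mem_domOpens.2 hp)
  rw [e, e]
  simp [mul_comm]

/-- The quadratic terms of the integrability equations vanish at t = 0, leaving closedness in the
first two indices; the symmetry of A₀ brings it to the stated form. -/
theorem pderiv_first_order_comm (H : IsCollapsingFamily J A₀ P Q) (hδ : 0 < δ)
    (hJ : ∀ s ∈ Set.Ioo 0 δ, IsCompatibleComplexStructure R (J s)) (i j k : Fin n) {p : Pt n}
    (hp : p ∈ dom n R) :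
    pderiv (Sum.inr k) (fun q => A₀ q i j) p = pderiv (Sum.inr j) (fun q => A₀ q i k) p := by
  have hC := H.isCollapsed hδ hJ (subset_rfl : dom n R ⊆ dom n R)
  have h1 := hC.closedP k j i
  have h2 := hC.closedQ k j i
  simp only [Matrix.map_apply] at h1 h2
  rw [H.symmP.apply i j, H.symmP.apply i k] at h1
  rw [H.symmQ.apply i j, H.symmQ.apply i k] at h2
  rw [H.pderiv_first_order hδ _ _ _ hp, H.pderiv_first_order hδ _ _ _ hp]
  change coordDeriv n R (Sum.inr k) _ = coordDeriv n R (Sum.inr j) _ at h1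
  change coordDeriv n R (Sum.inr k) _ = coordDeriv n R (Sum.inr j) _ at h2
  rw [h1, h2]

theorem slice_famRicci (hδ : 0 < δ) {r : ℝ} (hr : dom n r ⊆ dom n R) (a b : Coord n) :
    slice (zero_mem_Ioo hδ) hr (famRicci P Q a b) = ricAlg (angleDeriv n r)
      (metricBlock (P.map (slice (zero_mem_Ioo hδ) hr)) (Q.map (slice (zero_mem_Ioo hδ) hr))
        (Q⁻¹.map (slice (zero_mem_Ioo hδ) hr)))
      (metricBlockInv (P.map (slice (zero_mem_Ioo hδ) hr)) (Q.map (slice (zero_mem_Ioo hδ) hr))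
        (Q⁻¹.map (slice (zero_mem_Ioo hδ) hr))) a b := by
  rw [famRicci, Matrix.of_apply, map_ricAlg _ (slice_zero_famDeriv hr hδ), famMetric,
    map_metricBlock, map_metricBlockInv]

theorem quadFun_ext_continuousAt (M : Matrix (Coord n) (Coord n) (SmoothFun (famOpens n R δ)))
    (u : Pt n) {t : ℝ} (ht : t ∈ Set.Ioo (-√δ) (√δ)) {p : Pt n} (hp : p ∈ dom n R) :
    ContinuousAt (fun t => (quadFun M u).ext (t, p)) t :=
  ContinuousAt.comp (f := fun t : ℝ => (t, p))
    ((quadFun M u).contDiffAt_ext (mem_famOpens.2 ⟨ht, hp⟩)).continuousAt (by fun_prop)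

/-- A uniform lower Ricci bound persists in the limit. -/
theorem quadFun_famRicci_zero_nonneg (H : IsCollapsingFamily J A₀ P Q) (hδ : 0 < δ) {r ε κ : ℝ}
    (hr : dom n r ⊆ dom n R) (hε : 0 < ε) (hεδ : ε ≤ δ)
    (hκ : ∀ s ∈ Set.Ioo 0 ε, RicciGE (metric (J s)) κ (dom n r)) {p : Pt n} (hp : p ∈ dom n r)
    (u : Pt n) : 0 ≤ (quadFun (famRicci P Q) u).ext (0, p) := by
  have h0 := zero_mem_Ioo hδ
  -- The rescaled bound is Ric ≥ κ t² G, whose right side tends to zero whatever the sign of κ.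
  have hc : ContinuousAt (fun t : ℝ => (quadFun (famRicci P Q) u).ext (t, p) -
      κ * (t ^ 2 * (quadFun (famMetric P Q) u).ext (t, p))) 0 :=
    (quadFun_ext_continuousAt _ u h0 (hr hp)).sub (continuousAt_const.mul
      ((continuousAt_id.pow 2).mul (quadFun_ext_continuousAt _ u h0 (hr hp))))
  have hlim := hc.tendsto.mono_left (nhdsWithin_le_nhds (s := {0}ᶜ))
  have hpos : ∀ᶠ t in 𝓝[≠] (0 : ℝ), 0 ≤ (quadFun (famRicci P Q) u).ext (t, p) -
      κ * (t ^ 2 * (quadFun (famMetric P Q) u).ext (t, p)) := by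
    filter_upwards [self_mem_nhdsWithin,
      mem_nhdsWithin_of_mem_nhds (Ioo_mem_nhds (zero_mem_Ioo hε).1 (zero_mem_Ioo hε).2)] with t ht ht'
    have hsq := Real.sqrt_le_sqrt hεδ
    exact sub_nonneg.2 ((H.ricci_bound_iff ⟨by linarith [ht'.1], by linarith [ht'.2]⟩ ht (hr hp) κ
      u).1 (hκ _ (sq_mem_Ioo ht' ht) p hp _))
  simpa using ge_of_tendsto hlim hpos

/-- Only the pointwise limit t → 0 enters, so r = R and ε = δ are allowed here. -/
theorem indepOfTheta (H : IsCollapsingFamily J A₀ P Q) (hδ : 0 < δ)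
    (hJ : ∀ s ∈ Set.Ioo 0 δ, IsCompatibleComplexStructure R (J s)) {r ε κ : ℝ}
    (hr : dom n r ⊆ dom n R) (hε : 0 < ε) (hεδ : ε ≤ δ)
    (hκ : ∀ s ∈ Set.Ioo 0 ε, RicciGE (metric (J s)) κ (dom n r)) :
    IndepOfTheta r (fun p => imPart (A₀ p)) := by
  intro p hp q hq hpq
  have hfib : ∀ (f : SmoothFun (famOpens n R δ)) θ,
      fibreFun p (slice (zero_mem_Ioo hδ) (subset_rfl : dom n R ⊆ dom n R) f) θ = f.ext (0, fibrePt (fun i => p (Sum.inl i)) θ) :=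
    fun f θ => slice_ext _ _ _ (fibrePt_mem (hr hp) θ)
  have key := (H.isCollapsed hδ hJ (subset_rfl : dom n R ⊆ dom n R)).fibre_const
    (fun k i j => by
      refine SmoothFun.ext_injective fun y hy => ?_
      have hz : ((0 : ℝ), y) ∈ famOpens n R δ := ⟨zero_mem_Ioo hδ, hy⟩
      rw [shiftPull_ext, Matrix.map_apply, slice_ext _ _ _ (shift_mem k hy), slice_ext _ _ _ hy,
        ← famShift_ext k _ hz, (H.famShift_eq hJ k i j).2]
      exact hy) (hr hp)
    (fun θ => by
      have := H.pos 0 (zero_mem_Ioo hδ) _ (fibrePt_mem (hr hp) θ)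
      simpa only [Matrix.map_apply, hfib] using this)
    (fun θ v => by
      have := H.quadFun_famRicci_zero_nonneg hδ hr hε hεδ hκ (fibrePt_mem hp θ) (Sum.elim v 0)
      rw [quadFun_ext _ _ (mem_famOpens.2 ⟨zero_mem_Ioo hδ, hr (fibrePt_mem hp θ)⟩)] at this
      have hs := fun a b => (slice_famRicci (P := P) (Q := Q) hδ (subset_rfl : dom n R ⊆ dom n R)
        a b).symm
      simp only [hs, hfib, dotProduct, mulVec, Matrix.of_apply, Finset.mul_sum]
      simp only [Fintype.sum_sum_type, Sum.elim_inl, Sum.elim_inr, Pi.zero_apply, mul_zero,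
        zero_mul, Finset.sum_const_zero, add_zero] at this
      refine this.trans_eq (Finset.sum_congr rfl fun a _ => Finset.sum_congr rfl fun b _ => ?_)
      ring)
  have hq' : fibrePt (fun i => p (Sum.inl i)) (fun i => q (Sum.inr i)) = q := by
    rw [funext hpq, fibrePt_self]
  ext i j
  have h1 := key i j (fun i => p (Sum.inr i)) (fun i => q (Sum.inr i))
  rw [Matrix.map_apply, hfib, hfib, fibrePt_self, hq', H.im_eq p (hr hp), H.im_eq q (hr hq)] at h1
  exact h1

/-- The slice is taken over the smaller set ‖x‖ < r, where Q has no angle derivatives and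
`ricAlg_eq_zero` applies. -/
theorem famRicci_zero_eq_zero (H : IsCollapsingFamily J A₀ P Q) (hδ : 0 < δ)
    (hJ : ∀ s ∈ Set.Ioo 0 δ, IsCompatibleComplexStructure R (J s)) {r : ℝ}
    (hr : dom n r ⊆ dom n R) (hI : IndepOfTheta r (fun p => imPart (A₀ p))) {p : Pt n}
    (hp : p ∈ dom n r) (a b : Coord n) : (famRicci P Q a b).ext (0, p) = 0 := by
  rw [← slice_ext (zero_mem_Ioo hδ) hr _ hp, slice_famRicci hδ hr,
    (H.isCollapsed hδ hJ hr).ricAlg_eq_zero fun i j k => ?_]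
  · rw [← SmoothFun.eval_eq p (mem_domOpens.2 hp), map_zero]
  · refine SmoothFun.ext_injective fun q hq => ?_
    set f := Q.map (slice (zero_mem_Ioo hδ) hr) j k with hf
    have hconst : fibreFun q f = fun _ => f.ext q := by
      funext θ
      have hm := fibrePt_mem hq θ
      have h1 := congrFun (congrFun (hI _ hm q hq fun i => rfl) j) k
      simp only [imPart, Matrix.map_apply] at h1
      rw [fibreFun, hf, Matrix.map_apply, slice_ext _ _ _ hm, slice_ext _ _ _ hq,
        H.im_eq _ (hr hm), H.im_eq _ (hr hq), h1]
    have h2 := fderiv_fibreFun hq f (fun i => q (Sum.inr i)) i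
    rw [hconst, fibreFun, fibrePt_self] at h2
    rw [← h2, ← SmoothFun.eval_eq q hq 0, map_zero]
    simp

theorem quadFun_famMetric_pos (H : IsCollapsingFamily J A₀ P Q) {t : ℝ}
    (ht : t ∈ Set.Ioo (-√δ) (√δ)) {p : Pt n} (hp : p ∈ dom n R) {u : Pt n} (hu : u ≠ 0) :
    0 < (quadFun (famMetric P Q) u).ext (t, p) := by
  have hz : (t, p) ∈ famOpens n R δ := ⟨ht, hp⟩
  set φ := SmoothFun.eval (t, p) hz
  have hQ : (Q.map φ).PosDef := by
    convert H.pos t ht p hp using 1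
    ext i j
    simp [φ, SmoothFun.eval_eq]
  have hP : (P.map φ).IsSymm := Matrix.IsSymm.ext fun i j => by
    simp only [Matrix.map_apply, H.symmP.apply]
  have hQh : Q.map φ * Q⁻¹.map φ = 1 := by
    rw [← Matrix.map_mul, Matrix.mul_nonsing_inv _ H.isUnit_det,
      Matrix.map_one _ (map_zero _) (map_one _)]
  have := metricBlock_pos hP hQ hQh hu
  rw [← map_metricBlock, dotProduct_mulVec_eq_sum] at this
  rw [quadFun_ext _ _ hz]
  simpa only [Matrix.map_apply, φ, SmoothFun.eval_eq, famMetric] using this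

/-- The Ricci tensor in rescaled coordinates is even in `t`. -/
theorem famRicci_even (H : IsCollapsingFamily J A₀ P Q) {t : ℝ} (ht : t ∈ Set.Ioo (-√δ) (√δ))
    {p : Pt n} (hp : p ∈ dom n R) (a b : Coord n) :
    (famRicci P Q a b).ext (-t, p) = (famRicci P Q a b).ext (t, p) := by
  by_cases h0 : t = 0
  · rw [h0, neg_zero]
  have hc : ∀ c : Coord n, scaleFactor (-t) c = scaleFactor t c := by
    rintro (c | c) <;> simp [scaleFactor]
  rw [H.ricci_family ht h0 hp, H.ricci_family ⟨by linarith [ht.2], by linarith [ht.1]⟩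
    (neg_ne_zero.2 h0) hp, hc, hc, neg_sq]

/-- Evenness in t upgrades the remainder from order t to order t², which is the order of the term κ
t² G to be compared with it. -/
theorem exists_famRicci_eq_sq_mul (H : IsCollapsingFamily J A₀ P Q) (hδ : 0 < δ) (a b : Coord n) :
    ∃ k : ℝ × Pt n → ℝ, ContinuousOn k (Set.Ioo (-√δ) (√δ) ×ˢ dom n R) ∧
      ∀ t ∈ Set.Ioo (-√δ) (√δ), ∀ p ∈ dom n R,
        (famRicci P Q a b).ext (t, p) - (famRicci P Q a b).ext (0, p) = t ^ 2 * k (t, p) := by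
  have h0 := zero_mem_Ioo hδ
  obtain ⟨k, hk, hfk⟩ := exists_eq_sq_mul_of_even (Real.sqrt_pos.2 hδ) (isOpen_dom n R)
    (f := fun z => (famRicci P Q a b).ext z - (famRicci P Q a b).ext (0, z.2))
    ((famRicci P Q a b).contDiffOn_ext.sub ((famRicci P Q a b).contDiffOn_ext.comp
      (f := fun z : ℝ × Pt n => ((0 : ℝ), z.2)) (ContDiff.contDiffOn (by fun_prop))
      fun z hz => ⟨h0, hz.2⟩)) (fun p _ => sub_self _)
    (fun t ht p hp => by rw [H.famRicci_even ht hp])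
  exact ⟨k, hk.continuousOn, fun t ht p hp => hfk (t, p) ⟨ht, hp⟩⟩

end IsCollapsingFamily

/-- A fundamental domain for the translations, over a closed ball. -/
def closedCube (n : ℕ) (r : ℝ) : Set (Pt n) :=
  {p | ∑ i, (p (Sum.inl i)) ^ 2 ≤ r ^ 2 ∧ ∀ i, p (Sum.inr i) ∈ Set.Icc 0 1}

theorem isCompact_closedCube (n : ℕ) {r : ℝ} (hr : 0 ≤ r) : IsCompact (closedCube n r) := by
  have hsub : closedCube n r ⊆ Set.univ.pi
      (Sum.elim (fun _ => Set.Icc (-r) r) fun _ => Set.Icc 0 1 : Coord n → Set ℝ) := by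
    rintro p ⟨h1, h2⟩ (a | a) -
    · have h3 : (p (Sum.inl a)) ^ 2 ≤ r ^ 2 :=
        (Finset.single_le_sum (f := fun i => (p (Sum.inl i)) ^ 2) (fun i _ => sq_nonneg _)
          (Finset.mem_univ a)).trans h1
      exact abs_le.1 (abs_le_of_sq_le_sq h3 hr)
    · exact h2 a
  refine (isCompact_univ_pi ?_).of_isClosed_subset ?_ hsub
  · rintro (a | a) <;> exact isCompact_Icc
  · have h1 : IsClosed {p : Pt n | ∀ i, p (Sum.inr i) ∈ Set.Icc (0 : ℝ) 1} := by
      rw [Set.ofPred_forall]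
      exact isClosed_iInter fun i => isClosed_Icc.preimage (continuous_apply _)
    exact (isClosed_le (f := fun p : Pt n => ∑ i, (p (Sum.inl i)) ^ 2) (by fun_prop)
      continuous_const).inter h1

theorem exists_shift_mem_closedCube {r : ℝ} {p : Pt n} (hp : p ∈ dom n r) :
    ∃ k, shift k p ∈ closedCube n r := by
  refine ⟨fun i => -⌊p (Sum.inr i)⌋, ?_, fun i => ?_⟩
  · exact (shift_mem (fun i => -⌊p (Sum.inr i)⌋) hp).le
  · have h1 := Int.floor_le (p (Sum.inr i))
    have h2 := Int.lt_floor_add_one (p (Sum.inr i))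
    simp only [shift, Pi.add_apply, Sum.elim_inr, Int.cast_neg]
    exact ⟨by linarith, by linarith⟩

theorem quadFun_smul (M : Matrix (Coord n) (Coord n) (SmoothFun (famOpens n R δ))) (c : ℝ)
    (u : Pt n) {z : ℝ × Pt n} (hz : z ∈ famOpens n R δ) :
    (quadFun M (c • u)).ext z = c ^ 2 * (quadFun M u).ext z := by
  simp only [quadFun_ext _ _ hz, Finset.mul_sum, Pi.smul_apply, smul_eq_mul]
  refine Finset.sum_congr rfl fun a _ => Finset.sum_congr rfl fun b _ => ?_
  ring

namespace IsCollapsingFamily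

/-- After division by t² both sides are quadratic forms in u with coefficients continuous up to t =
0, and the metric one stays positive there. Hence κ can be any lower bound of their quotient on a
compact set of (t, p, u); this is where r < R and ε < δ enter. -/
theorem exists_bound_on_closedCube (H : IsCollapsingFamily J A₀ P Q) (hδ : 0 < δ) {r ε : ℝ}
    (hr : r ∈ Set.Ioo 0 R) (hε : ε ∈ Set.Ioo 0 δ) :
    ∃ κ : ℝ, ∀ t ∈ Set.Icc 0 (√ε), ∀ p ∈ closedCube n r, ∀ u : Pt n, ‖u‖ = 1 →
      κ * (t ^ 2 * (quadFun (famMetric P Q) u).ext (t, p)) ≤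
        (quadFun (famRicci P Q) u).ext (t, p) - (quadFun (famRicci P Q) u).ext (0, p) := by
  choose k hk hRk using H.exists_famRicci_eq_sq_mul hδ
  set K : Set ((ℝ × Pt n) × Pt n) :=
    (Set.Icc 0 (√ε) ×ˢ closedCube n r) ×ˢ Metric.sphere 0 1 with hK
  have hKc : IsCompact K :=
    (isCompact_Icc.prod (isCompact_closedCube n hr.1.le)).prod (isCompact_sphere 0 1)
  have hsq : √ε < √δ := Real.sqrt_lt_sqrt hε.1.le hε.2
  have hsub : ∀ y ∈ K, y.1 ∈ famOpens n R δ := by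
    rintro ⟨⟨t, p⟩, u⟩ ⟨⟨ht, hp⟩, -⟩
    refine ⟨⟨?_, ht.2.trans_lt hsq⟩, hp.1.trans_lt (pow_lt_pow_left₀ hr.2 hr.1.le two_ne_zero)⟩
    exact (zero_mem_Ioo hδ).1.trans_le ht.1
  have hc : ∀ f : ℝ × Pt n → ℝ, ContinuousOn f (famOpens n R δ) →
      ContinuousOn (fun y : (ℝ × Pt n) × Pt n => f y.1) K := fun f hf =>
    hf.comp continuousOn_fst hsub
  have hq : ∀ f : Coord n → Coord n → ℝ × Pt n → ℝ,
      (∀ a b, ContinuousOn (f a b) (famOpens n R δ)) →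
      ContinuousOn (fun y : (ℝ × Pt n) × Pt n => ∑ a, ∑ b, y.2 a * y.2 b * f a b y.1) K :=
    fun f hf => continuousOn_finsetSum _ fun a _ => continuousOn_finsetSum _ fun b _ =>
      (by fun_prop : Continuous fun y : (ℝ × Pt n) × Pt n => y.2 a * y.2 b).continuousOn.mul
        (hc _ (hf a b))
  have hpos : ∀ y ∈ K, 0 < ∑ a, ∑ b, y.2 a * y.2 b * (famMetric P Q a b).ext y.1 := by
    intro y hy
    have h1 := hsub y hy
    have hne : y.2 ≠ 0 := by
      intro h
      have := hy.2
      rw [h] at this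
      simp at this
    have := H.quadFun_famMetric_pos h1.1 h1.2 hne
    rwa [quadFun_ext _ _ h1] at this
  have hcont := (hq k hk).div (hq (fun a b => (famMetric P Q a b).ext)
    fun a b => (famMetric P Q a b).contDiffOn_ext.continuousOn) fun y hy => (hpos y hy).ne'
  obtain ⟨κ, hκ⟩ := hKc.bddBelow_image hcont
  refine ⟨κ, fun t ht p hp u hu => ?_⟩
  have hy : ((t, p), u) ∈ K := ⟨⟨ht, hp⟩, by simpa using hu⟩
  have hz := hsub _ hy
  have hz0 : ((0 : ℝ), p) ∈ famOpens n R δ := ⟨zero_mem_Ioo hδ, hz.2⟩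
  have h1 := hκ (Set.mem_image_of_mem _ hy)
  simp only [Pi.div_apply] at h1
  rw [le_div_iff₀ (hpos _ hy)] at h1
  rw [quadFun_ext _ _ hz, quadFun_ext _ _ hz, quadFun_ext _ _ hz0]
  calc _ = t ^ 2 * (κ * ∑ a, ∑ b, u a * u b * (famMetric P Q a b).ext (t, p)) := by ring
    _ ≤ t ^ 2 * ∑ a, ∑ b, u a * u b * k a b (t, p) :=
      mul_le_mul_of_nonneg_left h1 (sq_nonneg t)
    _ = _ := by
      rw [Finset.mul_sum, ← Finset.sum_sub_distrib]
      refine Finset.sum_congr rfl fun a _ => ?_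
      rw [Finset.mul_sum, ← Finset.sum_sub_distrib]
      refine Finset.sum_congr rfl fun b _ => ?_
      rw [← mul_sub, hRk a b t hz.1 p hz.2]
      ring

theorem exists_ricciGE (H : IsCollapsingFamily J A₀ P Q) (hδ : 0 < δ)
    (hJ : ∀ s ∈ Set.Ioo 0 δ, IsCompatibleComplexStructure R (J s)) {r ε : ℝ}
    (hr : r ∈ Set.Ioo 0 R) (hε : ε ∈ Set.Ioo 0 δ)
    (hI : IndepOfTheta r (fun p => imPart (A₀ p))) :
    ∃ κ : ℝ, ∀ s ∈ Set.Ioo 0 ε, RicciGE (metric (J s)) κ (dom n r) := by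
  obtain ⟨κ, hκ⟩ := H.exists_bound_on_closedCube hδ hr hε
  have hsub : dom n r ⊆ dom n R := dom_subset_dom hr.1.le hr.2.le
  refine ⟨κ, fun s hs p hp w => ?_⟩
  have hsq : √ε < √δ := Real.sqrt_lt_sqrt hε.1.le hε.2
  have hts : √s < √ε := Real.sqrt_lt_sqrt hs.1.le hs.2
  have ht0 : 0 < √s := Real.sqrt_pos.2 hs.1
  have ht : √s ∈ Set.Ioo (-√δ) (√δ) := ⟨by linarith, by linarith⟩
  set t := √s
  have hst : s = t ^ 2 := (Real.sq_sqrt hs.1.le).symm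
  have hc := scaleFactor_ne_zero (n := n) ht0.ne'
  -- The components of w in the rescaled frame (t² ∂/∂x, ∂/∂θ).
  set u : Pt n := fun a => (scaleFactor t a)⁻¹ * w a
  have hw : w = fun a => scaleFactor t a * u a := by
    funext a
    simp only [u]
    rw [← mul_assoc, mul_inv_cancel₀ (hc a), one_mul]
  rw [hw, hst, H.ricci_bound_iff ht ht0.ne' (hsub hp)]
  have hz : (t, p) ∈ famOpens n R δ := ⟨ht, hsub hp⟩
  -- Periodicity moves p into the compact fundamental domain, and homogeneity of degree two reduces
  -- u to the unit sphere.
  obtain ⟨m, hm⟩ := exists_shift_mem_closedCube hp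
  by_cases hu : u = 0
  · simp [quadFun_ext _ _ hz, hu]
  have hun : ‖u‖ ≠ 0 := norm_ne_zero_iff.2 hu
  have h1 := hκ t ⟨ht0.le, hts.le⟩ _ hm (‖u‖⁻¹ • u) (by
    rw [norm_smul, norm_inv, norm_norm, inv_mul_cancel₀ hun])
  have hz0 : ((0 : ℝ), shift m p) ∈ famOpens n R δ := ⟨zero_mem_Ioo hδ, shift_mem m (hsub hp)⟩
  have h2 : (quadFun (famRicci P Q) (‖u‖⁻¹ • u)).ext (0, shift m p) = 0 := by
    rw [quadFun_ext _ _ hz0]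
    simp only [H.famRicci_zero_eq_zero hδ hJ hsub hI (shift_mem m hp), mul_zero,
      Finset.sum_const_zero]
  rw [h2, sub_zero, quadFun_shift (H.famShift_famMetric hJ m) _ hz,
    quadFun_shift (H.famShift_famRicci hJ m) _ hz, quadFun_smul _ _ _ hz,
    quadFun_smul _ _ _ hz] at h1
  have h3 : 0 < (‖u‖⁻¹) ^ 2 := by positivity
  refine le_of_mul_le_mul_left ?_ h3
  calc _ = κ * (t ^ 2 * (‖u‖⁻¹ ^ 2 * (quadFun (famMetric P Q) u).ext (t, p))) := by ring
    _ ≤ _ := h1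

end IsCollapsingFamily

end ActionAngle

end

open ActionAngle

theorem mainTheorem5 (n : ℕ) (R δ : ℝ) (hR : 0 < R) (hδ : 0 < δ)
    (J : ℝ → Pt n → Matrix (Coord n) (Coord n) ℝ)
    (hJ : ∀ s ∈ Set.Ioo 0 δ, IsCompatibleComplexStructure R (J s))
    (A₀ : Pt n → Matrix (Fin n) (Fin n) ℂ)
    (hSpade : Spade R δ J A₀) :
    ((∀ i j, ContDiffOn ℝ ∞ (fun p => A₀ p i j) (dom n R)) ∧
      ∀ i j k, ∀ p ∈ dom n R,
        pderiv (Sum.inr k) (fun q => A₀ q i j) p = pderiv (Sum.inr j) (fun q => A₀ q i k) p) ∧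
    (∀ r ∈ Set.Ioo 0 R, ∀ ε ∈ Set.Ioo 0 δ,
      ((∃ κ : ℝ, ∀ s ∈ Set.Ioo 0 ε, RicciGE (metric (J s)) κ (dom n r)) ↔
        IndepOfTheta r (fun p => imPart (A₀ p)))) ∧
    ((∃ κ : ℝ, ∀ s ∈ Set.Ioo 0 δ, RicciGE (metric (J s)) κ (dom n R)) →
      IndepOfTheta R (fun p => imPart (A₀ p))) := by
  obtain ⟨P, Q, H⟩ := exists_isCollapsingFamily hδ hJ hSpade
  refine ⟨⟨H.contDiffOn_first_order hδ, fun i j k p hp => H.pderiv_first_order_comm hδ hJ i j k hp⟩,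
    fun r hr ε hε => ⟨?_, H.exists_ricciGE hδ hJ hr hε⟩, ?_⟩
  · rintro ⟨κ, hκ⟩
    exact H.indepOfTheta hδ hJ (dom_subset_dom hr.1.le hr.2.le) hε.1 hε.2.le hκ
  · rintro ⟨κ, hκ⟩
    exact H.indepOfTheta hδ hJ subset_rfl hδ le_rfl hκ
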